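/- All groups are finite. For a group $G$, the directed power graph $DPow(G)$ has vertex set $G$ and an edge $(x,y)$ whenever $y=x^k$ for some integer $k$ (loops included); the power graph $Pow(G)$ is the simple graph on $G$ in which distinct $x,y$ are adjacent iff one is a power of the other; the enhanced power graph $EPow(G)$ is the simple graph on $G$ in which distinct $x,y$ are adjacent iff they lie in a common cyclic subgroup. *Covering cycles.* A minimal cyclic cover of $G$ is a set of cyclic subgroups with union $G$ of which no member can be omitted; it is unique. A CC-generator is a generator of a member of it, and a CCG-set is a set consisting of exactly one generator of each member. Two vertices of a simple graph are closed twins if they have the same closed neighbourhood. A set $\{g_1,\dots,g_m\}$ ($m$ distinct vertices) is a CCG-set up to closed twins in a graph $\Gamma$ on $G$ if there is a CCG-set $\{h_1,\dots,h_m\}$ with $m$ elements such that $h_i=g_i$ when $g_i$ is a CC-generator, and otherwise $h_i$ is a CC-generator that is a closed twin of $g_i$ in $\Gamma$. *Reductions.* Let $CDPow(G)$ be $DPow(G)$ with each vertex coloured by its out-degree. Two vertices of a digraph are closed twins if they have the same closed out-neighbourhood and the same closed in-neighbourhood. $R_1(G)$ is obtained from $CDPow(G)$ by identifying closed twins (keeping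 their common colour); $R_2(G)$ from $R_1(G)$ by deleting all loops and then all edges $(a,c)$ for which there are (non-loop) edges $(a,b)$ and $(b,c)$; $R_3(G)$ is the coloured undirected graph obtained from $R_2(G)$ by forgetting directions. For a vertex $u$ of $R_3(G)$, $Des(u)$ is the set of vertices reachable from $u$ by paths along which the colours strictly decrease. Let $g_1,\dots,g_m$ be the vertices of $R_3(G)$ that are classes of CC-generators. $R_4(G)$ is the coloured graph with vertices $g_1,\dots,g_m$ (with their colours) and, for each $i<j$, a new vertex $I(i,j)$, adjacent exactly to $g_i$ and $g_j$, whose colour is the maximum colour of a vertex in $Des(g_i)\cap Des(g_j)$. Isomorphisms of coloured graphs preserve colours. Graphs are given to algorithms by adjacency matrices (and lists of colours) on vertex sets $\{0,\dots,n-1\}$; the group is not given. Algorithms are programs for a unit-cost random access machine with addition and truncated subtraction, and *polynomial time* means time bounded by a polynomial in the order of the underlying group (in the sum of the two orders when two graphs are given). **Theorem.** Each of the following tasks can be performed by a polynomial time algorithm. The output is correct for every finite group $G$ from which the input may arise. 1. Given a graph $\Gamma\cong Pow(G)$, find a CCG-set of $G$ up to closed twins in $\Gamma$ (the vertices of $\Gamma$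 being identified with the elements of $G$ by any isomorphism). The same holds for $\Gamma\cong EPow(G)$. 2. Given $\Gamma\cong Pow(G)$ together with a CCG-set of $G$ up to closed twins in $\Gamma$, construct a coloured graph isomorphic to $R_4(G)$. The same holds for $\Gamma\cong EPow(G)$. 3. Given a coloured graph isomorphic to $R_4(G)$, construct a coloured graph isomorphic to $R_3(G)$. 4. Given a coloured graph isomorphic to $R_3(G)$, construct a directed graph isomorphic to $DPow(G)$. 5. Given $\Gamma\cong Pow(G)$, construct a directed graph isomorphic to $DPow(G)$. The same holds for $\Gamma\cong EPow(G)$. 6. Given a directed graph isomorphic to $DPow(G)$, construct the corresponding enhanced power graph on the same vertex set (that is, the graph which the given isomorphism identifies with $EPow(G)$); and given $\Gamma\cong Pow(G)$, construct a graph isomorphic to $EPow(G)$. 7. Given $\Gamma_1\cong Pow(G)$ and $\Gamma_2\cong Pow(H)$ with $G$ and $H$ finite nilpotent, decide whether $\Gamma_1\cong\Gamma_2$. The same holds for $\Gamma_1\cong EPow(G)$ and $\Gamma_2\cong EPow(H)$. -/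

import Mathlib

open Polynomial

/-! ## Graphs attached to a group -/

/-- The directed power graph `DPow(G)`: an edge `(x, y)` whenever `y` is a power of `x`. -/
def directedPowerGraph (G : Type*) [Group G] : Digraph G where
  Adj x y := ∃ m : ℤ, y = x ^ m

/-- The power graph `Pow(G)`: distinct `x, y` are adjacent when one is a power of the other. -/
def powerGraph (G : Type*) [Group G] : SimpleGraph G where
  Adj x y := x ≠ y ∧ ((directedPowerGraph G).Adj x y ∨ (directedPowerGraph G).Adj y x)
  symm := ⟨fun _ _ h => ⟨h.1.symm, h.2.symm⟩⟩
  loopless := ⟨fun _ h => h.1 rfl⟩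

/-- The enhanced power graph `EPow(G)`: distinct `x, y` are adjacent when they lie in a common
cyclic subgroup. -/
def enhancedPowerGraph (G : Type*) [Group G] : SimpleGraph G where
  Adj x y := x ≠ y ∧ ∃ z : G, x ∈ Subgroup.zpowers z ∧ y ∈ Subgroup.zpowers z
  symm := ⟨fun _ _ h => ⟨h.1.symm, h.2.imp fun _ hz => hz.symm⟩⟩
  loopless := ⟨fun _ h => h.1 rfl⟩

/-- Isomorphism of digraphs. -/
def Digraph.IsIso {V W : Type*} (D : Digraph V) (E : Digraph W) : Prop :=
  Nonempty (D.Adj ≃r E.Adj)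

/-! ## Cyclic covers and covering cycle generating sets -/

/-- A set of cyclic subgroups covering `G`, no member of which can be omitted. -/
def IsMinimalCyclicCover {G : Type*} [Group G] (C : Set (Subgroup G)) : Prop :=
  (∀ H ∈ C, ∃ g : G, H = Subgroup.zpowers g) ∧
  (∀ x : G, ∃ H ∈ C, x ∈ H) ∧
  (∀ K ∈ C, ¬ ∀ x : G, ∃ H ∈ C, H ≠ K ∧ x ∈ H)

/-- Covering cycle generator: a generator of a member of the minimal cyclic cover (a finite group
has exactly one minimal cyclic cover). -/
def IsCCGenerator {G : Type*} [Group G] (g : G) : Prop :=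
  ∃ C : Set (Subgroup G), IsMinimalCyclicCover C ∧ Subgroup.zpowers g ∈ C

/-- Covering cycle generating set: one generator for each member of the minimal cyclic cover. -/
def IsCCGSet {G : Type*} [Group G] (S : Set G) : Prop :=
  Set.InjOn (fun g : G => Subgroup.zpowers g) S ∧
  IsMinimalCyclicCover ((fun g : G => Subgroup.zpowers g) '' S)

/-- Closed twins of a simple graph: vertices with the same closed neighbourhood. -/
def SimpleGraph.ClosedTwins {V : Type*} (X : SimpleGraph V) (u v : V) : Prop :=
  insert u (X.neighborSet u) = insert v (X.neighborSet v)

/-- `S = {g₁, …, g_m}` is a CCG-set up to closed twins of the graph `X` on `G`: the `hᵢ = h gᵢ`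
form a CCG-set with `m` elements, where `hᵢ = gᵢ` if `gᵢ` is a CC-generator and otherwise `hᵢ` is a
CC-generator that is a closed twin of `gᵢ` in `X`. -/
def IsCCGSetUpToTwins {G : Type*} [Group G] (X : SimpleGraph G) (S : Set G) : Prop :=
  ∃ h : G → G,
    (∀ g ∈ S, (IsCCGenerator g → h g = g) ∧
      (¬ IsCCGenerator g → IsCCGenerator (h g) ∧ X.ClosedTwins g (h g))) ∧
    Set.InjOn h S ∧ IsCCGSet (h '' S)

/-! ## Coloured graphs and the reductions -/

/-- A directed graph whose vertices are coloured by natural numbers. -/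
structure ColoredDigraph (V : Type*) extends Digraph V where
  color : V → ℕ

/-- A simple graph whose vertices are coloured by natural numbers. -/
structure ColoredGraph (V : Type*) extends SimpleGraph V where
  color : V → ℕ

/-- Colour preserving isomorphism. -/
def ColoredGraph.IsIso {V W : Type*} (X : ColoredGraph V) (Y : ColoredGraph W) : Prop :=
  ∃ f : X.toSimpleGraph ≃g Y.toSimpleGraph, ∀ v, Y.color (f v) = X.color v

/-- Closed twins of a digraph: the same closed out-neighbourhoods and the same closed
in-neighbourhoods. -/
def Digraph.closedTwinSetoid {V : Type*} (D : Digraph V) : Setoid V where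
  r u v := insert u {w | D.Adj u w} = insert v {w | D.Adj v w} ∧
    insert u {w | D.Adj w u} = insert v {w | D.Adj w v}
  iseqv := ⟨fun _ => ⟨rfl, rfl⟩, fun h => ⟨h.1.symm, h.2.symm⟩,
    fun h k => ⟨h.1.trans k.1, h.2.trans k.2⟩⟩

/-- `CDPow(G)`: the directed power graph, each vertex coloured by its out-degree. -/
noncomputable def coloredDirectedPowerGraph (G : Type*) [Group G] : ColoredDigraph G where
  toDigraph := directedPowerGraph G
  color u := Set.ncard {w | (directedPowerGraph G).Adj u w}

/-- The closed-twin classes of `CDPow(G)`. -/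
def TwinClass (G : Type*) [Group G] : Type _ :=
  Quotient (coloredDirectedPowerGraph G).toDigraph.closedTwinSetoid

/-- The closed-twin class of an element. -/
noncomputable def twinClass {G : Type*} [Group G] (g : G) : TwinClass G :=
  Quotient.mk (coloredDirectedPowerGraph G).toDigraph.closedTwinSetoid g

/-- All loops are present, so out-neighbourhoods are closed. -/
theorem insert_outNeighbors (G : Type*) [Group G] (u : G) :
    insert u {w | (directedPowerGraph G).Adj u w} = {w | (directedPowerGraph G).Adj u w} :=
  Set.insert_eq_of_mem ⟨1, (zpow_one u).symm⟩

/-- Closed twins of `CDPow(G)` have the same colour. -/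
theorem color_eq_of_closedTwins (G : Type*) [Group G] (u v : G)
    (h : (coloredDirectedPowerGraph G).toDigraph.closedTwinSetoid.r u v) :
    (coloredDirectedPowerGraph G).color u = (coloredDirectedPowerGraph G).color v := by
  have h1 : insert u {w | (directedPowerGraph G).Adj u w} =
      insert v {w | (directedPowerGraph G).Adj v w} := h.1
  rw [insert_outNeighbors, insert_outNeighbors] at h1
  exact congrArg Set.ncard h1

/-- `R₁(G)`: closed twins of `CDPow(G)` are identified. -/
noncomputable def reductionOne (G : Type*) [Group G] : ColoredDigraph (TwinClass G) where
  Adj A B := ∃ a b : G, twinClass a = A ∧ twinClass b = B ∧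
    (coloredDirectedPowerGraph G).Adj a b
  color := Quotient.lift (coloredDirectedPowerGraph G).color (color_eq_of_closedTwins G)

/-- `R₂(G)`: self-loops are deleted, then all transitive edges are deleted. -/
noncomputable def reductionTwo (G : Type*) [Group G] : ColoredDigraph (TwinClass G) where
  Adj A C := (A ≠ C ∧ (reductionOne G).Adj A C) ∧
    ¬ ∃ B, (A ≠ B ∧ (reductionOne G).Adj A B) ∧ (B ≠ C ∧ (reductionOne G).Adj B C)
  color := (reductionOne G).color

/-- `R₃(G)`: the directions of the edges are removed. -/
noncomputable def reductionThree (G : Type*) [Group G] : ColoredGraph (TwinClass G) where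
  toSimpleGraph := SimpleGraph.fromRel (reductionTwo G).Adj
  color := (reductionTwo G).color

/-- `Des(u)`: the vertices reachable from `u` along paths with strictly decreasing colours. -/
def ColoredGraph.Des {V : Type*} (X : ColoredGraph V) (u : V) : Set V :=
  {v | Relation.ReflTransGen (fun a b => X.Adj a b ∧ X.color b < X.color a) u v}

/-- The vertices of `R₃(G)` that come from CC-generators of `G`. -/
def CCVertex (G : Type*) [Group G] : Type _ :=
  {A : TwinClass G // ∃ g : G, IsCCGenerator g ∧ twinClass g = A}

/-- The vertices of `R₄(G)`: the vertices `gᵢ`, and one vertex `I(i, j)` for each unordered pair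
of distinct `gᵢ, gⱼ`. -/
def ReductionFourVertex (G : Type*) [Group G] : Type _ :=
  CCVertex G ⊕ {e : Sym2 (CCVertex G) // ¬ e.IsDiag}

/-- `R₄(G)`: `I(i, j)` is adjacent to `gᵢ` and `gⱼ`; its colour is the largest colour of a vertex
of `R₃(G)` in `Des(gᵢ) ∩ Des(gⱼ)`; the `gᵢ` keep their colours. -/
noncomputable def reductionFour (G : Type*) [Group G] :
    ColoredGraph (ReductionFourVertex G) where
  toSimpleGraph := SimpleGraph.fromRel fun x y =>
    match x, y with
    | Sum.inl g, Sum.inr e => g ∈ e.1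
    | _, _ => False
  color
    | Sum.inl g => (reductionThree G).color g.1
    | Sum.inr e => sSup {c | ∃ v, (∀ g ∈ e.1, v ∈ (reductionThree G).Des g.1) ∧
        c = (reductionThree G).color v}

/-! ## The machine model

A random access machine with finitely many registers and finitely many arrays that hold natural
numbers (a program mentions only finitely many of each; array cells are addressed by computed
indices). Programs are in structured form, the arithmetic operations are addition and truncated
subtraction, and every executed operation costs one unit. There is no multiplication or shift, so
the bit lengths of the numbers grow by at most a constant in each step, and the running time is
polynomially related to that of a Turing machine. -/

/-- Expressions. -/
inductive RamExpr : Type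
  /-- A numerical constant. -/
  | const (c : ℕ)
  /-- The content of a register. -/
  | reg (i : ℕ)
  /-- The content of cell `ix` of array `a`. -/
  | load (a : ℕ) (ix : RamExpr)
  /-- Sum. -/
  | add (e f : RamExpr)
  /-- Truncated difference. -/
  | sub (e f : RamExpr)

/-- Programs. -/
inductive RamProg : Type
  | skip
  /-- Write the value of `e` to register `i`. -/
  | assign (i : ℕ) (e : RamExpr)
  /-- Write the value of `e` to cell `ix` of array `a`. -/
  | store (a : ℕ) (ix e : RamExpr)
  | seq (P Q : RamProg)
  /-- Run `P` if the value of `e` is nonzero, and `Q` otherwise. -/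
  | cond (e : RamExpr) (P Q : RamProg)
  /-- Run `P` as long as the value of `e` is nonzero. -/
  | loop (e : RamExpr) (P : RamProg)

/-- The contents of the registers and of the arrays. -/
@[ext]
structure RamState where
  reg : ℕ → ℕ
  arr : ℕ → ℕ → ℕ

namespace RamExpr

/-- The value of an expression. -/
def eval (s : RamState) : RamExpr → ℕ
  | const c => c
  | reg i => s.reg i
  | load a ix => s.arr a (ix.eval s)
  | add e f => e.eval s + f.eval s
  | sub e f => e.eval s - f.eval s

/-- The number of operations in an expression. -/
def cost : RamExpr → ℕ
  | const _ => 1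
  | reg _ => 1
  | load _ ix => ix.cost + 1
  | add e f => e.cost + f.cost + 1
  | sub e f => e.cost + f.cost + 1

end RamExpr

/-- Write `x` to register `i`. -/
def RamState.setReg (s : RamState) (i x : ℕ) : RamState :=
  { s with reg := Function.update s.reg i x }

/-- Write `x` to cell `k` of array `a`. -/
def RamState.setCell (s : RamState) (a k x : ℕ) : RamState :=
  { s with arr := Function.update s.arr a (Function.update (s.arr a) k x) }

/-- `Runs P s t s'`: started in state `s`, the program `P` halts in state `s'` after exactly `t`
steps. -/
inductive Runs : RamProg → RamState → ℕ → RamState → Prop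
  | skip (s : RamState) : Runs .skip s 1 s
  | assign (i : ℕ) (e : RamExpr) (s : RamState) :
      Runs (.assign i e) s (e.cost + 1) (s.setReg i (e.eval s))
  | store (a : ℕ) (ix e : RamExpr) (s : RamState) :
      Runs (.store a ix e) s (ix.cost + e.cost + 1) (s.setCell a (ix.eval s) (e.eval s))
  | seq {P Q : RamProg} {s s' s'' : RamState} {t t' : ℕ}
      (hP : Runs P s t s') (hQ : Runs Q s' t' s'') : Runs (.seq P Q) s (t + t') s''
  | cond_true {e : RamExpr} {P Q : RamProg} {s s' : RamState} {t : ℕ}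
      (he : e.eval s ≠ 0) (hP : Runs P s t s') : Runs (.cond e P Q) s (e.cost + t + 1) s'
  | cond_false {e : RamExpr} {P Q : RamProg} {s s' : RamState} {t : ℕ}
      (he : e.eval s = 0) (hQ : Runs Q s t s') : Runs (.cond e P Q) s (e.cost + t + 1) s'
  | loop_exit {e : RamExpr} {P : RamProg} {s : RamState}
      (he : e.eval s = 0) : Runs (.loop e P) s (e.cost + 1) s
  | loop_step {e : RamExpr} {P : RamProg} {s s' s'' : RamState} {t t' : ℕ}
      (he : e.eval s ≠ 0) (hP : Runs P s t s') (hL : Runs (.loop e P) s' t' s'') :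
      Runs (.loop e P) s (e.cost + t + 1 + t') s''

/-- The initial state on an input that consists of finitely many words of numbers: the `a`-th word
is written into array `a`, and everything else is zero. -/
def RamState.init (input : List (List ℕ)) : RamState where
  reg _ := 0
  arr a k := (input.getD a []).getD k 0

/-- The `a`-th word of `output` stands at the beginning of array `a`. -/
def RamState.Holds (s : RamState) (output : List (List ℕ)) : Prop :=
  ∀ a k : ℕ, ∀ w : List ℕ, output[a]? = some w → ∀ x : ℕ, w[k]? = some x → s.arr a k = x

/-- On the given input, `P` halts within `T` steps with an output that satisfies `ok`. -/
def RamProg.Computes (P : RamProg) (input : List (List ℕ)) (T : ℕ)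
    (ok : List (List ℕ) → Prop) : Prop :=
  ∃ t ≤ T, ∃ s : RamState, Runs P (RamState.init input) t s ∧
    ∃ output : List (List ℕ), s.Holds output ∧ ok output

/-! ## Encodings

A graph on `Fin n` is given by the number `n` and its adjacency matrix; a graph with a marked set
of vertices, or with a vertex colouring, has one further word. -/

open Classical in
/-- The adjacency matrix of a relation, row by row. -/
noncomputable def matrixWord {n : ℕ} (r : Fin n → Fin n → Prop) : List ℕ :=
  List.flatten (List.ofFn fun i : Fin n => List.ofFn fun j : Fin n => if r i j then 1 else 0)

/-- A graph without colours. -/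
noncomputable def encodeGraph {n : ℕ} (X : SimpleGraph (Fin n)) : List (List ℕ) :=
  [[n], matrixWord X.Adj]

/-- A directed graph without colours. -/
noncomputable def encodeDigraph {n : ℕ} (D : Digraph (Fin n)) : List (List ℕ) :=
  [[n], matrixWord D.Adj]

open Classical in
/-- The indicator word of a set of vertices. -/
noncomputable def setWord {n : ℕ} (S : Set (Fin n)) : List ℕ :=
  List.ofFn fun i : Fin n => if i ∈ S then 1 else 0

/-- A graph with a marked set of vertices. -/
noncomputable def encodeMarkedGraph {n : ℕ} (X : SimpleGraph (Fin n)) (S : Set (Fin n)) :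
    List (List ℕ) :=
  [[n], matrixWord X.Adj, setWord S]

/-- A coloured graph. -/
noncomputable def encodeColoredGraph {n : ℕ} (X : ColoredGraph (Fin n)) : List (List ℕ) :=
  [[n], matrixWord X.Adj, List.ofFn X.color]

open Classical in
/-- The answer to a decision problem: `1` for yes and `0` for no. -/
noncomputable def encodeAnswer (p : Prop) : List (List ℕ) :=
  [[if p then 1 else 0]]

/-! ## The algorithmic tasks

`K` stands for `powerGraph` or `enhancedPowerGraph`. Inputs are graphs on `Fin n` (their vertices
carry no information on the group), and the output has to be right for every finite group that the
input may come from. Each task is solved by one program for all inputs, with running time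
bounded by a polynomial in the order of the group. Every finite group is isomorphic to one in
`Type`. -/

/-- From a graph isomorphic to `K G`, find a CCG-set of `G`, up to closed twins in the graph. -/
def FindsCCGSetInPolyTime (K : (G : Type) → [Group G] → SimpleGraph G) : Prop :=
  ∃ (P : RamProg) (p : ℕ[X]), ∀ (n : ℕ) (X : SimpleGraph (Fin n))
    (G : Type) [Group G] [Finite G] (f : X ≃g K G),
    P.Computes (encodeGraph X) (p.eval (Nat.card G)) fun output =>
      ∃ S : Set (Fin n), output = [setWord S] ∧ IsCCGSetUpToTwins (K G) (f '' S)

/-- From a graph isomorphic to `K G` with a CCG-set of `G` (up to closed twins), construct a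
coloured graph isomorphic to `R₄(G)`. -/
def ConstructsReductionFourInPolyTime (K : (G : Type) → [Group G] → SimpleGraph G) : Prop :=
  ∃ (P : RamProg) (p : ℕ[X]), ∀ (n : ℕ) (X : SimpleGraph (Fin n)) (S : Set (Fin n))
    (G : Type) [Group G] [Finite G] (f : X ≃g K G), IsCCGSetUpToTwins (K G) (f '' S) →
    P.Computes (encodeMarkedGraph X S) (p.eval (Nat.card G)) fun output =>
      ∃ (k : ℕ) (Y : ColoredGraph (Fin k)), output = encodeColoredGraph Y ∧
        Y.IsIso (reductionFour G)

/-- From a coloured graph isomorphic to `R₄(G)`, construct one isomorphic to `R₃(G)`. -/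
def RestoresReductionThreeInPolyTime : Prop :=
  ∃ (P : RamProg) (p : ℕ[X]), ∀ (n : ℕ) (X : ColoredGraph (Fin n))
    (G : Type) [Group G] [Finite G], X.IsIso (reductionFour G) →
    P.Computes (encodeColoredGraph X) (p.eval (Nat.card G)) fun output =>
      ∃ (k : ℕ) (Y : ColoredGraph (Fin k)), output = encodeColoredGraph Y ∧
        Y.IsIso (reductionThree G)

/-- From a coloured graph isomorphic to `R₃(G)`, construct a digraph isomorphic to `DPow(G)`. -/
def RestoresDirectedPowerGraphInPolyTime : Prop :=
  ∃ (P : RamProg) (p : ℕ[X]), ∀ (n : ℕ) (X : ColoredGraph (Fin n))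
    (G : Type) [Group G] [Finite G], X.IsIso (reductionThree G) →
    P.Computes (encodeColoredGraph X) (p.eval (Nat.card G)) fun output =>
      ∃ (k : ℕ) (D : Digraph (Fin k)), output = encodeDigraph D ∧
        D.IsIso (directedPowerGraph G)

/-- From a graph isomorphic to `K G`, construct a digraph isomorphic to `DPow(G)`. -/
def ReconstructsDirectedPowerGraphInPolyTime
    (K : (G : Type) → [Group G] → SimpleGraph G) : Prop :=
  ∃ (P : RamProg) (p : ℕ[X]), ∀ (n : ℕ) (X : SimpleGraph (Fin n))
    (G : Type) [Group G] [Finite G], Nonempty (X ≃g K G) →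
    P.Computes (encodeGraph X) (p.eval (Nat.card G)) fun output =>
      ∃ (k : ℕ) (D : Digraph (Fin k)), output = encodeDigraph D ∧
        D.IsIso (directedPowerGraph G)

/-- From a digraph isomorphic to `DPow(G)`, construct `EPow(G)` on the same vertices. -/
def ConstructsEnhancedFromDirectedInPolyTime : Prop :=
  ∃ (P : RamProg) (p : ℕ[X]), ∀ (n : ℕ) (D : Digraph (Fin n))
    (G : Type) [Group G] [Finite G] (f : D.Adj ≃r (directedPowerGraph G).Adj),
    P.Computes (encodeDigraph D) (p.eval (Nat.card G)) fun output =>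
      output = encodeGraph ((enhancedPowerGraph G).comap f)

/-- From a graph isomorphic to `Pow(G)`, construct a graph isomorphic to `EPow(G)`. -/
def ConstructsEnhancedFromPowerInPolyTime : Prop :=
  ∃ (P : RamProg) (p : ℕ[X]), ∀ (n : ℕ) (X : SimpleGraph (Fin n))
    (G : Type) [Group G] [Finite G], Nonempty (X ≃g powerGraph G) →
    P.Computes (encodeGraph X) (p.eval (Nat.card G)) fun output =>
      ∃ (k : ℕ) (Y : SimpleGraph (Fin k)), output = encodeGraph Y ∧
        Nonempty (Y ≃g enhancedPowerGraph G)

/-- Given graphs isomorphic to `K G` and `K H` for nilpotent `G` and `H`, decide whether the two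
graphs are isomorphic. -/
def DecidesNilpotentIsoInPolyTime (K : (G : Type) → [Group G] → SimpleGraph G) : Prop :=
  ∃ (P : RamProg) (p : ℕ[X]), ∀ (n m : ℕ) (X : SimpleGraph (Fin n)) (Y : SimpleGraph (Fin m))
    (G H : Type) [Group G] [Finite G] [Group.IsNilpotent G]
    [Group H] [Finite H] [Group.IsNilpotent H],
    Nonempty (X ≃g K G) → Nonempty (Y ≃g K H) →
    P.Computes (encodeGraph X ++ encodeGraph Y) (p.eval (Nat.card G + Nat.card H))
      fun output => output = encodeAnswer (Nonempty (X ≃g Y))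

/-! The vertices of the reductions are the cyclic subgroups of `G`, and the minimal cyclic cover
consists of the maximal ones (`isMinimalCyclicCover_iff`). In both graphs the closed neighbourhood
of a generator of a maximal cyclic subgroup is that subgroup, so a CCG-set up to twins is a
transversal of the closed twin classes of such generators. The work is to recognise these classes.

In the enhanced power graph they are the vertices whose closed neighbourhood is a clique. In the
power graph the edges have to be directed first (`powerGraph_above_iff`). If x generates a proper
subgroup of ⟨y⟩, x and y are not twins and x does not dominate, let z be the twin of x of largest
order. Then x has fewer than 2φ(o(z)) twins and y at least φ(o(y)), which decides the direction by
counting, unless o(y) = 2 o(z) with o(z) odd. In that case the involution of ⟨y⟩ is a vertex without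
twins that is adjacent to y and not to x (`twinCard_lt`). Cyclic groups are told apart by the number
of dominating vertices (`powerGraph_cyclic_iff`).

The order of the intersection of two maximal cyclic subgroups is the number of common closed
neighbours, which gives R₄. Conversely, a cyclic subgroup is a maximal cyclic A with a divisor d of
|A|, where (A, d) lies in B exactly when d divides |A ∩ B|; choosing the first possible A makes the
name unique, and inclusion becomes divisibility. This gives R₃ from R₄. In R₃ the orders direct the
edges, reachability is inclusion, and a class of order d has φ(d) elements, which gives DPow.
Enhanced adjacency is the existence of a common in-neighbour.

In a nilpotent group elements of coprime orders commute. So a cyclic subgroup amounts to a nonempty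
down-closed set of cyclic subgroups of prime power order, any two of which are coprime or comparable
(`TwinClass.exists_primary_iff_mem`), and DPow is determined by the subgroups of prime power order
(`PrimaryClass.directedPowerGraph_isIso`). These form a rooted tree under inclusion. Tree
isomorphism is decided by colour refinement of the disjoint union of the two graphs R₃.

On the machine side no algorithm is programmed by hand. Functions built from arithmetic, array
reads, case distinctions and bounded sums are `Evaluable`; bounded quantifiers and counting reduce
to sums. Each algorithm is thus a bounded formula, compiled by instance search, at most iterated
(`Realizable.iterate`). Its correctness is the translation of the formula along a numbering of the
vertices (`World.Reads`). All loops run to a common bound, the fourth power of a stride exceeding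
all vertex numbers and colours. -/

/-- What a program can see: a bound for its loops, a stride for pairs, and ten arrays. -/
structure World where
  size : ℕ
  base : ℕ
  arr : ℕ → ℕ → ℕ

/-- The state `s` shows the world `w`. -/
def Represents (s : RamState) (w : World) : Prop :=
  s.reg 0 = w.size ∧ s.reg 1 = w.base ∧ ∀ a < 10, s.arr a = w.arr a

theorem Represents.congr {s s' : RamState} {w : World} (h : Represents s w)
    (h0 : s'.reg 0 = s.reg 0) (h1 : s'.reg 1 = s.reg 1) (ha : ∀ a < 10, s'.arr a = s.arr a) :
    Represents s' w :=
  ⟨h0.trans h.1, h1.trans h.2.1, fun a i => (ha a i).trans (h.2.2 a i)⟩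

theorem Polynomial.eval_mono_nat (p : ℕ[X]) {a b : ℕ} (h : a ≤ b) : p.eval a ≤ p.eval b := by
  rw [eval_eq_sum, eval_eq_sum]
  exact Finset.sum_le_sum fun i _ => Nat.mul_le_mul_left _ (Nat.pow_le_pow_left h i)

/-! ### Counting loops -/

/-- The counting loop: register `x` runs from its start value `0` to `N`, the content of
register `0`. -/
def RamProg.count (x : ℕ) (P : RamProg) : RamProg :=
  .seq (.assign x (.const 0))
    (.loop (.sub (.reg 0) (.reg x)) (.seq P (.assign x (.add (.reg x) (.const 1)))))

/-- Loop rule with invariant `I`. The invariant is demanded after the increment of the counter, so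
it may also speak of registers in general. The 8 per round is the guard with its test (4) and the
increment (4); the final 6 is the initialisation (2) and the exit (4). -/
theorem Runs.count {x : ℕ} {P : RamProg} {N T : ℕ} (I : ℕ → RamState → Prop) (hx : x ≠ 0)
    (step : ∀ k < N, ∀ s, I k s → s.reg x = k → s.reg 0 = N → ∃ t ≤ T, ∃ s', Runs P s t s' ∧
      s'.reg x = k ∧ s'.reg 0 = N ∧ I (k + 1) (s'.setReg x (k + 1)))
    (s : RamState) (h0 : I 0 (s.setReg x 0)) (hN : s.reg 0 = N) :
    ∃ t ≤ N * (T + 8) + 6, ∃ s', Runs (RamProg.count x P) s t s' ∧ I N s' := by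
  have key : ∀ m k, k + m = N → ∀ s : RamState, I k s → s.reg x = k → s.reg 0 = N →
      ∃ t ≤ m * (T + 8) + 4, ∃ s', Runs (.loop (.sub (.reg 0) (.reg x))
        (.seq P (.assign x (.add (.reg x) (.const 1))))) s t s' ∧ I N s' := by
    intro m
    induction m with
    | zero =>
      intro k hk s hI hsx hs0
      obtain rfl : k = N := by omega
      exact ⟨_, by simp [RamExpr.cost], s, .loop_exit (by simp [RamExpr.eval, hsx, hs0]), hI⟩
    | succ m ih =>
      intro k hk s hI hsx hs0
      obtain ⟨t, ht, s', hr, h1, h2, h3⟩ := step k (by omega) s hI hsx hs0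
      have e : RamExpr.eval s' (.add (.reg x) (.const 1)) = k + 1 := by simp [RamExpr.eval, h1]
      obtain ⟨t', ht', s'', hr', h'⟩ := ih (k + 1) (by omega) (s'.setReg x (k + 1)) h3
        (by simp [RamState.setReg]) (by simp [RamState.setReg, hx.symm, h2])
      refine ⟨_, ?_, s'', .loop_step (by simp [RamExpr.eval, hsx, hs0]; omega)
        (.seq hr (.assign _ _ _)) (by rw [e]; exact hr'), h'⟩
      simp only [RamExpr.cost]
      nlinarith
  obtain ⟨t, ht, s', hr, h⟩ := key N 0 (by omega) (s.setReg x 0) h0 (by simp [RamState.setReg])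
    (by simp [RamState.setReg, hx.symm, hN])
  exact ⟨_, by simp only [RamExpr.cost]; omega, s', .seq (.assign _ _ _) hr, h⟩

/-! ### Compiling functions and predicates -/

/-- `F`, a function of the world and of finitely many variables, can be computed by a program whose
running time is bounded by a polynomial in the size of the world. The variables stand in the
registers `V i < r`; the registers below `r` are not changed, and the value is put into
register `r`. -/
class Evaluable (F : World → (ℕ → ℕ) → ℕ) : Prop where
  out : ∀ (V : ℕ → ℕ) (r : ℕ), 1 < r → (∀ i, V i < r) → ∃ (P : RamProg) (p : ℕ[X]),
    ∀ (s : RamState) (w : World), Represents s w → ∃ t ≤ p.eval w.size, ∃ s' : RamState,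
      Runs P s t s' ∧ s'.arr = s.arr ∧ (∀ j < r, s'.reg j = s.reg j) ∧
      s'.reg r = F w (fun i => s.reg (V i))

namespace Evaluable

variable {F G H : World → (ℕ → ℕ) → ℕ}

theorem ofExpr {E : (ℕ → ℕ) → RamExpr}
    (h : ∀ (V : ℕ → ℕ) (s : RamState) (w : World), Represents s w →
      (E V).eval s = F w (fun i => s.reg (V i))) : Evaluable F :=
  ⟨fun V r _ _ => ⟨.assign r (E V), C ((E V).cost + 1), fun s w hw => ⟨_, by simp, _,
    .assign _ _ _, rfl, fun j hj => by simp [RamState.setReg, hj.ne],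
    by simp [RamState.setReg, h V s w hw]⟩⟩⟩

instance const (c : ℕ) : Evaluable fun _ _ => c :=
  ofExpr (E := fun _ => .const c) fun _ _ _ _ => rfl

instance var (i : ℕ) : Evaluable fun _ e => e i :=
  ofExpr (E := fun V => .reg (V i)) fun _ _ _ _ => rfl

instance size : Evaluable fun w _ => w.size :=
  ofExpr (E := fun _ => .reg 0) fun _ _ _ h => h.1

instance base : Evaluable fun w _ => w.base :=
  ofExpr (E := fun _ => .reg 1) fun _ _ _ h => h.2.1

/-- A let-binding with de Bruijn indices. The value of `F` stays in register `r` and becomes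
variable `0` of the body, whose other variables are shifted; the body works from register `r + 1`
on, and its result is finally moved to `r`. -/
theorem bind (hF : Evaluable F) {F' : World → (ℕ → ℕ) → ℕ → ℕ}
    (h : Evaluable fun w e => F' w (fun i => e (i + 1)) (e 0)) :
    Evaluable fun w e => F' w e (F w e) := by
  refine ⟨fun V r hr hV => ?_⟩
  obtain ⟨P, p, hP⟩ := hF.out V r hr hV
  obtain ⟨Q, q, hQ⟩ := h.out (fun i => Nat.casesOn i r V) (r + 1) (by omega) (fun i => by
    cases i with
    | zero => simp
    | succ i => exact (hV i).trans (by simp))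
  refine ⟨.seq P (.seq Q (.assign r (.reg (r + 1)))), p + (q + 2), fun s w hw => ?_⟩
  obtain ⟨t, ht, s', h1, h2, h3, h4⟩ := hP s w hw
  obtain ⟨t', ht', s'', k1, k2, k3, k4⟩ := hQ s' w
    (hw.congr (h3 _ (by omega)) (h3 _ (by omega)) fun _ _ => by rw [h2])
  refine ⟨_, ?_, _, .seq h1 (.seq k1 (.assign _ _ _)), k2.trans h2, fun j hj => ?_, ?_⟩
  · simp [RamExpr.cost]; omega
  · simp [RamState.setReg, hj.ne, k3 j (by omega), h3 j hj]
  · simp only [RamState.setReg, RamExpr.eval, Function.update_self, k4]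
    congr 1
    · funext i; exact h3 _ (hV i)

theorem rename (hF : Evaluable F) (g : ℕ → ℕ) : Evaluable fun w e => F w (fun i => e (g i)) :=
  ⟨fun V r hr hV => hF.out (fun i => V (g i)) r hr fun i => hV (g i)⟩

theorem comp₁ {f : World → ℕ → ℕ} (hf : Evaluable fun w e => f w (e 0)) (hF : Evaluable F) :
    Evaluable fun w e => f w (F w e) :=
  hF.bind (F' := fun w _ x => f w x) hf

theorem comp₂ {f : World → ℕ → ℕ → ℕ} (hf : Evaluable fun w e => f w (e 0) (e 1))
    (hF : Evaluable F) (hG : Evaluable G) : Evaluable fun w e => f w (F w e) (G w e) :=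
  hF.bind (F' := fun w e x => f w x (G w e)) <|
    (hG.rename fun i => i + 1).bind (F' := fun w e y => f w (e 0) y) <|
      -- After two bindings variable `0` holds the second argument and variable `1` the first; the
      -- renaming swaps them.
      hf.rename fun i => 1 - i

theorem ofExpr₂ {f : ℕ → ℕ → ℕ} {E : RamExpr → RamExpr → RamExpr}
    (h : ∀ a b s, (E a b).eval s = f (a.eval s) (b.eval s)) (hF : Evaluable F) (hG : Evaluable G) :
    Evaluable fun w e => f (F w e) (G w e) :=
  comp₂ (f := fun _ => f)
    (ofExpr (E := fun V => E (.reg (V 0)) (.reg (V 1))) fun _ _ _ _ => h _ _ _) hF hG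

instance add [hF : Evaluable F] [hG : Evaluable G] : Evaluable fun w e => F w e + G w e :=
  ofExpr₂ (f := (· + ·)) (E := .add) (fun _ _ _ => rfl) hF hG

instance sub [hF : Evaluable F] [hG : Evaluable G] : Evaluable fun w e => F w e - G w e :=
  ofExpr₂ (f := (· - ·)) (E := .sub) (fun _ _ _ => rfl) hF hG

theorem load {a : ℕ} (ha : a < 10) (hF : Evaluable F) : Evaluable fun w e => w.arr a (F w e) :=
  comp₁ (f := fun w => w.arr a) (ofExpr (E := fun V => .load a (.reg (V 0))) fun V s w h => by
    simp [RamExpr.eval, h.2.2 a ha]) hF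

instance load0 [hF : Evaluable F] : Evaluable fun w e => w.arr 0 (F w e) := load (by simp) hF
instance load1 [hF : Evaluable F] : Evaluable fun w e => w.arr 1 (F w e) := load (by simp) hF
instance load2 [hF : Evaluable F] : Evaluable fun w e => w.arr 2 (F w e) := load (by simp) hF
instance load3 [hF : Evaluable F] : Evaluable fun w e => w.arr 3 (F w e) := load (by simp) hF
instance load4 [hF : Evaluable F] : Evaluable fun w e => w.arr 4 (F w e) := load (by simp) hF
instance load5 [hF : Evaluable F] : Evaluable fun w e => w.arr 5 (F w e) := load (by simp) hF

/-- The only loop that formulas need. The accumulator is register `r`, the summation variable is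
register `r + 1` and appears as variable `0` of the summand, and the summand is computed in register
`r + 2`. -/
instance sum {F : World → (ℕ → ℕ) → ℕ → ℕ}
    [h : Evaluable fun w e => F w (fun i => e (i + 1)) (e 0)] :
    Evaluable fun w e => ∑ x ∈ Finset.range w.size, F w e x := by
  refine ⟨fun V r hr hV => ?_⟩
  obtain ⟨Q, q, hQ⟩ := h.out (fun i => Nat.casesOn i (r + 1) V) (r + 2) (by omega) (fun i => by
    cases i with
    | zero => simp
    | succ i => exact (hV i).trans (by simp))
  refine ⟨.seq (.assign r (.const 0))
    (.count (r + 1) (.seq Q (.assign r (.add (.reg r) (.reg (r + 2)))))),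
    2 + (X * (q + 12) + 6), fun s w hw => ?_⟩
  obtain ⟨t, ht, s', hr', hI⟩ := Runs.count (x := r + 1)
    (P := .seq Q (.assign r (.add (.reg r) (.reg (r + 2)))))
    (N := w.size) (T := q.eval w.size + 4)
    (fun k s' => s'.arr = s.arr ∧ (∀ j < r, s'.reg j = s.reg j) ∧
      s'.reg r = ∑ x ∈ Finset.range k, F w (fun i => s.reg (V i)) x) (by omega)
    (fun k _ s' ⟨h1, h2, h3⟩ hk hN => by
      obtain ⟨t, ht, s'', k1, k2, k3, k4⟩ := hQ s' w
        (hw.congr (h2 _ (by omega)) (h2 _ (by omega)) fun _ _ => by rw [h1])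
      refine ⟨_, ?_, _, .seq k1 (.assign _ _ _), ?_, ?_, k2.trans h1, fun j hj => ?_, ?_⟩
      · simp [RamExpr.cost]; omega
      · simp [RamState.setReg, k3, hk]
      · simp [RamState.setReg, (show 0 ≠ r by omega), k3, hN]
      · simp [RamState.setReg, hj.ne, (show j ≠ r + 1 by omega), k3 j (by omega), h2 j hj]
      · simp only [RamState.setReg, RamExpr.eval]
        rw [Function.update_of_ne (by omega), Function.update_self, k4, k3 r (by omega), h3,
          Finset.sum_range_succ]
        congr 1
        exact congrArg₂ (F w) (funext fun i => h2 _ (hV i)) hk)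
    (s.setReg r 0) ⟨rfl, fun j hj => by simp [RamState.setReg, hj.ne, (show j ≠ r + 1 by omega)],
      by simp [RamState.setReg]⟩ (by simp [RamState.setReg, (show 0 ≠ r by omega), hw.1])
  refine ⟨_, ?_, s', .seq (.assign _ _ _) hr', hI⟩
  simp [RamExpr.cost]
  ring_nf at ht ⊢
  omega

end Evaluable

/-- A predicate whose indicator function is evaluable. -/
class Decides (p : World → (ℕ → ℕ) → Prop) : Prop where
  out : ∃ F, Evaluable F ∧ ∀ w e, F w e ≠ 0 ↔ p w e

/-- The test may destroy register `r`, because the branches read only variables below `r`. Only one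
branch is run, but both polynomials are added to get a bound independent of the outcome. -/
instance Evaluable.ite {p : World → (ℕ → ℕ) → Prop} {F G : World → (ℕ → ℕ) → ℕ}
    [∀ w e, Decidable (p w e)] [hp : Decides p] [hF : Evaluable F] [hG : Evaluable G] :
    Evaluable fun w e => if p w e then F w e else G w e := by
  obtain ⟨H, hH, hp⟩ := hp.out
  refine ⟨fun V r hr hV => ?_⟩
  obtain ⟨P, p', hP⟩ := hH.out V r hr hV
  obtain ⟨Q, q, hQ⟩ := hF.out V r hr hV
  obtain ⟨R, r', hR⟩ := hG.out V r hr hV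
  refine ⟨.seq P (.cond (.reg r) Q R), p' + (q + r' + 2), fun s w hw => ?_⟩
  obtain ⟨t, ht, s', h1, h2, h3, h4⟩ := hP s w hw
  have hw' : Represents s' w := hw.congr (h3 _ (by omega)) (h3 _ (by omega)) fun _ _ => by rw [h2]
  have e : (fun i => s'.reg (V i)) = fun i => s.reg (V i) := by
    funext i; exact h3 _ (hV i)
  by_cases c : p w fun i => s.reg (V i)
  · obtain ⟨t', ht', s'', k1, k2, k3, k4⟩ := hQ s' w hw'
    refine ⟨_, ?_, s'', .seq h1 (.cond_true ?_ k1), k2.trans h2,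
      fun j hj => (k3 j hj).trans (h3 j hj), by rw [k4, if_pos c, e]⟩
    · simp [RamExpr.cost]; omega
    · simp only [RamExpr.eval, h4]; exact (hp _ _).2 c
  · obtain ⟨t', ht', s'', k1, k2, k3, k4⟩ := hR s' w hw'
    refine ⟨_, ?_, s'', .seq h1 (.cond_false ?_ k1), k2.trans h2,
      fun j hj => (k3 j hj).trans (h3 j hj), by rw [k4, if_neg c, e]⟩
    · simp [RamExpr.cost]; omega
    · simp only [RamExpr.eval, h4]; exact not_not.1 (mt (hp _ _).1 c)

namespace Decides

variable {p q : World → (ℕ → ℕ) → Prop} {F G : World → (ℕ → ℕ) → ℕ}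

theorem of_iff (hp : Decides p) (h : ∀ w e, p w e ↔ q w e) : Decides q := by
  have : p = q := by funext w e; exact propext (h w e)
  exact this ▸ hp

instance not [hp : Decides p] : Decides fun w e => ¬ p w e := by
  classical
  exact ⟨_, Evaluable.ite (p := p) (F := fun _ _ => 0) (G := fun _ _ => 1), fun w e => by simp⟩

instance and [hp : Decides p] [hq : Decides q] : Decides fun w e => p w e ∧ q w e := by
  obtain ⟨F, hF, h⟩ := hp.out
  obtain ⟨G, hG, k⟩ := hq.out
  classical
  exact ⟨_, Evaluable.ite (p := p) (F := G) (G := fun _ _ => 0), fun w e => by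
    by_cases c : p w e <;> simp [c, ← k]⟩

instance or [hp : Decides p] [hq : Decides q] : Decides fun w e => p w e ∨ q w e := by
  obtain ⟨F, hF, h⟩ := hp.out
  obtain ⟨G, hG, k⟩ := hq.out
  exact ⟨_, Evaluable.add (F := F) (G := G), fun w e => by rw [← h, ← k]; omega⟩

instance imp [hp : Decides p] [hq : Decides q] : Decides fun w e => p w e → q w e :=
  (inferInstance : Decides fun w e => ¬ p w e ∨ q w e).of_iff fun _ _ => imp_iff_not_or.symm

instance iff [hp : Decides p] [hq : Decides q] : Decides fun w e => p w e ↔ q w e :=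
  (inferInstance : Decides fun w e => (p w e → q w e) ∧ (q w e → p w e)).of_iff
    fun _ _ => iff_iff_implies_and_implies.symm

instance lt [hF : Evaluable F] [hG : Evaluable G] : Decides fun w e => F w e < G w e :=
  ⟨_, Evaluable.sub (F := G) (G := F), fun w e => by omega⟩

instance le [hF : Evaluable F] [hG : Evaluable G] : Decides fun w e => F w e ≤ G w e :=
  (inferInstance : Decides fun w e => ¬ G w e < F w e).of_iff fun _ _ => not_lt

instance eq [hF : Evaluable F] [hG : Evaluable G] : Decides fun w e => F w e = G w e :=
  (inferInstance : Decides fun w e => F w e ≤ G w e ∧ G w e ≤ F w e).of_iff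
    fun _ _ => le_antisymm_iff.symm

theorem comp₁ {f : World → ℕ → Prop} (hf : Decides fun w e => f w (e 0)) (hF : Evaluable F) :
    Decides fun w e => f w (F w e) := by
  classical
  have : Evaluable fun w e => if f w (F w e) then 1 else 0 :=
    .comp₁ (f := fun w x => if f w x then 1 else 0) inferInstance hF
  exact ⟨_, this, fun w e => by simp⟩

theorem comp₂ {f : World → ℕ → ℕ → Prop} (hf : Decides fun w e => f w (e 0) (e 1))
    (hF : Evaluable F) (hG : Evaluable G) : Decides fun w e => f w (F w e) (G w e) := by
  classical
  have : Evaluable fun w e => if f w (F w e) (G w e) then 1 else 0 :=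
    .comp₂ (f := fun w x y => if f w x y then 1 else 0) inferInstance hF hG
  exact ⟨_, this, fun w e => by simp⟩

end Decides

/-! ### Bounded sums, counting and quantifiers -/

namespace World

open Classical in
/-- The sum of `f x` for `x < b`. -/
noncomputable def sum (w : World) (b : ℕ) (f : ℕ → ℕ) : ℕ :=
  ∑ x ∈ Finset.range w.size, if x < b then f x else 0

open Classical in
/-- The number of all `x < b` that satisfy `q`. -/
noncomputable def count (w : World) (b : ℕ) (q : ℕ → Prop) : ℕ :=
  w.sum b fun x => if q x then 1 else 0

/-- Some `x < b` satisfies `q`. -/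
def Ex (w : World) (b : ℕ) (q : ℕ → Prop) : Prop := w.count b q ≠ 0

/-- All `x < b` satisfy `q`. -/
def All (w : World) (b : ℕ) (q : ℕ → Prop) : Prop := ¬ w.Ex b fun x => ¬ q x

variable {w : World} {b : ℕ}

/-- Loops always run over the numbers below the size of the world, so sums, counts and quantifiers
have their intended meaning only up to that bound. Hence the side conditions of this kind in all
later correctness lemmas. -/
theorem sum_eq (h : b ≤ w.size) (f : ℕ → ℕ) : w.sum b f = ∑ x ∈ Finset.range b, f x := by
  rw [sum, ← Finset.sum_filter]
  congr 1
  ext x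
  simp only [Finset.mem_filter, Finset.mem_range]
  omega

open Classical in
theorem count_eq (h : b ≤ w.size) (q : ℕ → Prop) :
    w.count b q = ((Finset.range b).filter q).card := by
  rw [count, sum_eq h, Finset.card_filter]

theorem ex_iff (h : b ≤ w.size) (q : ℕ → Prop) : w.Ex b q ↔ ∃ x < b, q x := by
  classical
  rw [Ex, count_eq h, Finset.card_ne_zero]
  simp [Finset.Nonempty]

theorem all_iff (h : b ≤ w.size) (q : ℕ → Prop) : w.All b q ↔ ∀ x < b, q x := by
  rw [All, ex_iff h]
  push Not
  rfl

end World

/-- With these instances a language with bounded sums, counting and quantifiers is available, and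
`unfold` followed by `infer_instance` acts as its compiler. The bound variable is variable `0`; the
outer variables are shifted by one. -/
instance Evaluable.sum' {F : World → (ℕ → ℕ) → ℕ} {f : World → (ℕ → ℕ) → ℕ → ℕ}
    [hF : Evaluable F] [hf : Evaluable fun w e => f w (fun i => e (i + 1)) (e 0)] :
    Evaluable fun w e => w.sum (F w e) (f w e) := by
  have : Evaluable fun w e => F w (fun i => e (i + 1)) := hF.rename fun i => i + 1
  unfold World.sum
  infer_instance

instance Evaluable.count {F : World → (ℕ → ℕ) → ℕ} {q : World → (ℕ → ℕ) → ℕ → Prop}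
    [hF : Evaluable F] [hq : Decides fun w e => q w (fun i => e (i + 1)) (e 0)] :
    Evaluable fun w e => w.count (F w e) (q w e) := by
  unfold World.count
  infer_instance

instance Decides.ex {F : World → (ℕ → ℕ) → ℕ} {q : World → (ℕ → ℕ) → ℕ → Prop}
    [hF : Evaluable F] [hq : Decides fun w e => q w (fun i => e (i + 1)) (e 0)] :
    Decides fun w e => w.Ex (F w e) (q w e) := by
  unfold World.Ex
  infer_instance

instance Decides.all {F : World → (ℕ → ℕ) → ℕ} {q : World → (ℕ → ℕ) → ℕ → Prop}
    [hF : Evaluable F] [hq : Decides fun w e => q w (fun i => e (i + 1)) (e 0)] :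
    Decides fun w e => w.All (F w e) (q w e) := by
  unfold World.All
  infer_instance

namespace World

/-- `x * y`, as long as `x` is at most the size of the world. -/
noncomputable def mul (w : World) (x y : ℕ) : ℕ := w.sum x fun _ => y

theorem mul_eq {w : World} {x : ℕ} (h : x ≤ w.size) (y : ℕ) : w.mul x y = x * y := by
  simp [mul, sum_eq h]

end World

/-- The pattern for every derived notion: it is unfolded once for plain variables, and an instance
for arbitrary arguments follows by substitution. This keeps the notion folded in later instance
searches. -/
theorem Evaluable.mul_base : Evaluable fun w e => w.mul (e 0) (e 1) := by
  unfold World.mul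
  infer_instance

instance Evaluable.mul {F G : World → (ℕ → ℕ) → ℕ} [hF : Evaluable F] [hG : Evaluable G] :
    Evaluable fun w e => w.mul (F w e) (G w e) := comp₂ mul_base hF hG

/-! ### Transformations of the world -/

/-- The world with the beginning of array `a` overwritten by the values of `f`. -/
def World.write (w : World) (a : ℕ) (f : ℕ → ℕ) : World :=
  { w with arr := Function.update w.arr a fun k => if k < w.size then f k else w.arr a k }

/-- The world with the first three arrays overwritten. -/
def World.write₃ (w : World) (f g h : ℕ → ℕ) : World :=
  ((w.write 0 f).write 1 g).write 2 h

/-- `Φ` can be carried out by a program in time polynomial in the size of the world. The arrays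
from `m` on are not changed. -/
structure Realizable (m : ℕ) (Φ : World → World) : Prop where
  size_eq : ∀ w, (Φ w).size = w.size
  out : ∃ (P : RamProg) (p : ℕ[X]), ∀ (s : RamState) (w : World), Represents s w →
    ∃ t ≤ p.eval w.size, ∃ s', Runs P s t s' ∧ Represents s' (Φ w) ∧
      ∀ a, m ≤ a → s'.arr a = s.arr a

/-- The values go to a scratch array `b ≥ 10`, outside the arrays a world consists of, because `f`
reads those arrays and must find them unchanged until all values have been computed. -/
theorem exists_fill (b : ℕ) (hb : 10 ≤ b) (f : World → ℕ → ℕ)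
    (hf : Evaluable fun w e => f w (e 0)) : ∃ (P : RamProg) (p : ℕ[X]),
    ∀ (s : RamState) (w : World), Represents s w → ∃ t ≤ p.eval w.size, ∃ s', Runs P s t s' ∧
      Represents s' w ∧ (∀ a, a ≠ b → s'.arr a = s.arr a) ∧
      ∀ k < w.size, s'.arr b k = f w k := by
  obtain ⟨P, p, hP⟩ := hf.out (fun _ => 2) 3 (by omega) (by simp)
  refine ⟨.count 2 (.seq P (.store b (.reg 2) (.reg 3))), X * (p + 11) + 6, fun s w hw => ?_⟩
  obtain ⟨t, ht, s', hr, h1, h2, h3, h4⟩ := Runs.count (x := 2)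
    (P := .seq P (.store b (.reg 2) (.reg 3))) (N := w.size) (T := p.eval w.size + 3)
    (fun k s' => s'.reg 0 = s.reg 0 ∧ s'.reg 1 = s.reg 1 ∧ (∀ a, a ≠ b → s'.arr a = s.arr a) ∧
      ∀ j < k, s'.arr b j = f w j) (by simp)
    (fun k _ s' ⟨h1, h2, h3, h4⟩ hk hN => by
      obtain ⟨t, ht, s'', k1, k2, k3, k4⟩ := hP s' w
        (hw.congr h1 h2 fun a ha => h3 a (by omega))
      refine ⟨_, by simp [RamExpr.cost]; omega, _, .seq k1 (.store _ _ _ _), ?_, ?_, ?_, ?_,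
        fun a ha => ?_, fun j hj => ?_⟩
      · simp [RamState.setCell, k3, hk]
      · simp [RamState.setCell, k3, hN]
      · simp [RamState.setCell, RamState.setReg, k3, h1]
      · simp [RamState.setCell, RamState.setReg, k3, h2]
      · simp [RamState.setCell, RamState.setReg, ha, k2, h3]
      · simp only [RamState.setCell, RamState.setReg, RamExpr.eval, Function.update_self, k4,
          k3 2 (by simp), hk, k2]
        by_cases e : j = k
        · simp [e]
        · rw [Function.update_of_ne e, h4 j (by omega)])
    s (by simp [RamState.setReg]) hw.1
  exact ⟨t, by simp; ring_nf at ht ⊢; omega, s', hr, hw.congr h1 h2 fun a ha => h3 a (by omega),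
    h3, h4⟩

/-- The program that copies the beginning of array `b` to array `a`. -/
def RamProg.copy (b a : ℕ) : RamProg := .count 2 (.store a (.reg 2) (.load b (.reg 2)))

theorem Runs.copy {a b : ℕ} (hab : a ≠ b) (s : RamState) :
    ∃ t ≤ (X * 12 + 6 : ℕ[X]).eval (s.reg 0), ∃ s', Runs (.copy b a) s t s' ∧
      s'.reg 0 = s.reg 0 ∧ s'.reg 1 = s.reg 1 ∧ s'.arr =
        Function.update s.arr a fun k => if k < s.reg 0 then s.arr b k else s.arr a k := by
  obtain ⟨t, ht, s', hr, h1, h2, h3⟩ := Runs.count (x := 2)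
    (P := .store a (.reg 2) (.load b (.reg 2))) (N := s.reg 0) (T := 4)
    (fun k s' => s'.reg 0 = s.reg 0 ∧ s'.reg 1 = s.reg 1 ∧ s'.arr =
        Function.update s.arr a fun j => if j < k then s.arr b j else s.arr a j) (by simp)
    (fun k _ s' ⟨h1, h2, h3⟩ hk hN => by
      refine ⟨_, by simp [RamExpr.cost], _, .store _ _ _ _, hk, hN, h1, h2, ?_⟩
      simp only [RamState.setCell, RamState.setReg, RamExpr.eval, hk, h3]
      funext a' j
      by_cases ha : a' = a
      · subst ha
        rw [Function.update_self, Function.update_self, Function.update_self,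
          Function.update_of_ne hab.symm]
        by_cases e : j = k
        · simp [e]
        · rw [Function.update_of_ne e]
          simp only [show (j < k + 1) = (j < k) by simp; omega]
      · simp [ha])
    s (by simp [RamState.setReg]) rfl
  exact ⟨t, by simpa using ht, s', hr, h1, h2, h3⟩

namespace Realizable

variable {m : ℕ} {Φ Ψ : World → World}

theorem id : Realizable m fun w => w :=
  ⟨fun _ => rfl, .skip, 1, fun s _ h => ⟨1, by simp, s, .skip s, h, fun _ _ => rfl⟩⟩

theorem mono {m' : ℕ} (hm : m ≤ m') (h : Realizable m Φ) : Realizable m' Φ := by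
  obtain ⟨P, p, hP⟩ := h.out
  refine ⟨h.size_eq, P, p, fun s w hw => ?_⟩
  obtain ⟨t, ht, s', h1, h2, h3⟩ := hP s w hw
  exact ⟨t, ht, s', h1, h2, fun a ha => h3 a (hm.trans ha)⟩

theorem comp (hΨ : Realizable m Ψ) (hΦ : Realizable m Φ) : Realizable m fun w => Ψ (Φ w) := by
  obtain ⟨P, p, hP⟩ := hΦ.out
  obtain ⟨Q, q, hQ⟩ := hΨ.out
  refine ⟨fun w => (hΨ.size_eq _).trans (hΦ.size_eq w), .seq P Q, p + q, fun s w hw => ?_⟩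
  obtain ⟨t, ht, s', h1, h2, h3⟩ := hP s w hw
  obtain ⟨t', ht', s'', k1, k2, k3⟩ := hQ s' _ h2
  rw [hΦ.size_eq] at ht'
  exact ⟨t + t', by simp; omega, s'', .seq h1 k1, k2, fun a ha => (k3 a ha).trans (h3 a ha)⟩

theorem write {f : World → ℕ → ℕ} {a : ℕ} (ha : a < 10) (hf : Evaluable fun w e => f w (e 0)) :
    Realizable 13 fun w => w.write a (f w) := by
  obtain ⟨P, p, hP⟩ := exists_fill 10 (by simp) f hf
  refine ⟨fun _ => rfl, .seq P (.copy 10 a), p + (X * 12 + 6), fun s w hw => ?_⟩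
  obtain ⟨t, ht, s', h1, h2, h3, h4⟩ := hP s w hw
  obtain ⟨t', ht', s'', k1, k2, k3, k4⟩ := Runs.copy (show a ≠ 10 by omega) s'
  rw [h2.1] at ht'
  refine ⟨_, by rw [eval_add]; exact add_le_add ht ht', s'', .seq h1 k1,
    ⟨k2.trans h2.1, k3.trans h2.2.1, fun c hc => ?_⟩, fun c hc => ?_⟩
  · rw [k4]
    by_cases e : c = a
    · subst e
      funext k
      simp only [Function.update_self, World.write, h2.1, h2.2.2 c hc]
      split_ifs with h
      · exact h4 k h
      · rfl
    · simp [World.write, e, h2.2.2 c hc]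
  · rw [k4, Function.update_of_ne (by omega), h3 c (by omega)]

/-- All three words are computed into the scratch arrays 10, 11 and 12 before anything is copied
back, so that `f`, `g` and `h` see the same old world. -/
theorem write₃ {f g h : World → ℕ → ℕ} (hf : Evaluable fun w e => f w (e 0))
    (hg : Evaluable fun w e => g w (e 0)) (hh : Evaluable fun w e => h w (e 0)) :
    Realizable 13 fun w => w.write₃ (f w) (g w) (h w) := by
  obtain ⟨P, p, hP⟩ := exists_fill 10 (by simp) f hf
  obtain ⟨Q, q, hQ⟩ := exists_fill 11 (by simp) g hg
  obtain ⟨R, r, hR⟩ := exists_fill 12 (by simp) h hh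
  refine ⟨fun _ => rfl, .seq P (.seq Q (.seq R (.seq (.copy 10 0) (.seq (.copy 11 1)
    (.copy 12 2))))), p + (q + (r + ((X * 12 + 6) + ((X * 12 + 6) + (X * 12 + 6))))),
    fun s w hw => ?_⟩
  obtain ⟨t1, ht1, s1, r1, w1, o1, v1⟩ := hP s w hw
  obtain ⟨t2, ht2, s2, r2, w2, o2, v2⟩ := hQ s1 w w1
  obtain ⟨t3, ht3, s3, r3, w3, o3, v3⟩ := hR s2 w w2
  obtain ⟨t4, ht4, s4, r4, b4, c4, a4⟩ := Runs.copy (show 0 ≠ 10 by omega) s3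
  obtain ⟨t5, ht5, s5, r5, b5, c5, a5⟩ := Runs.copy (show 1 ≠ 11 by omega) s4
  obtain ⟨t6, ht6, s6, r6, b6, c6, a6⟩ := Runs.copy (show 2 ≠ 12 by omega) s5
  rw [w3.1] at ht4
  rw [b4, w3.1] at ht5
  rw [b5, b4, w3.1] at ht6
  refine ⟨_, ?_, s6, .seq r1 (.seq r2 (.seq r3 (.seq r4 (.seq r5 r6)))),
    ⟨b6.trans (b5.trans (b4.trans w3.1)), c6.trans (c5.trans (c4.trans w3.2.1)), fun a ha => ?_⟩,
    fun a ha => ?_⟩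
  · simp only [eval_add] at *
    omega
  · rw [a6, a5, a4, b5, b4, w3.1]
    obtain rfl | rfl | rfl | h3 : a = 0 ∨ a = 1 ∨ a = 2 ∨ 2 < a := by omega
    · funext k
      simp [World.write₃, World.write, w3.2.2 0]
      split_ifs with hk
      · rw [o3 10 (by simp), o2 10 (by simp), v1 k hk]
      · rfl
    · funext k
      simp [World.write₃, World.write, w3.2.2 1]
      split_ifs with hk
      · rw [o3 11 (by simp), v2 k hk]
      · rfl
    · funext k
      simp [World.write₃, World.write, w3.2.2 2]
      split_ifs with hk
      · rw [v3 k hk]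
      · rfl
    · simp [World.write₃, World.write, show a ≠ 0 by omega, show a ≠ 1 by omega,
        show a ≠ 2 by omega, w3.2.2 a ha]
  · rw [a6, a5, a4, Function.update_of_ne (by omega), Function.update_of_ne (by omega),
      Function.update_of_ne (by omega), o3 a (by omega), o2 a (by omega), o1 a (by omega)]

/-- As many repetitions as the size of the world. -/
theorem iterate (hm : 10 ≤ m) (h : Realizable m Φ) :
    Realizable (m + 1) fun w => Φ^[w.size] w := by
  obtain ⟨P, p, hP⟩ := h.out
  have hsize : ∀ k w, (Φ^[k] w).size = w.size := fun k w => by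
    induction k with
    | zero => rfl
    | succ k ih => rw [Function.iterate_succ_apply', h.size_eq, ih]
  -- The round counter is cell `0` of array `m`, which the body leaves alone; registers other than 0
  -- and 1 offer no such guarantee. This is why the iteration uses up one more array.
  refine ⟨fun w => hsize _ w, .seq (.store m (.const 0) (.const 0))
    (.loop (.sub (.reg 0) (.load m (.const 0)))
      (.seq P (.store m (.const 0) (.add (.load m (.const 0)) (.const 1))))),
    X * (p + 11) + 8, fun s w hw => ?_⟩
  have key : ∀ j k, k + j = w.size → ∀ s : RamState, Represents s (Φ^[k] w) → s.arr m 0 = k →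
      ∃ t ≤ j * (p.eval w.size + 11) + 5, ∃ s',
        Runs (.loop (.sub (.reg 0) (.load m (.const 0)))
          (.seq P (.store m (.const 0) (.add (.load m (.const 0)) (.const 1))))) s t s' ∧
        Represents s' (Φ^[w.size] w) ∧ ∀ a, m + 1 ≤ a → s'.arr a = s.arr a := by
    intro j
    induction j with
    | zero =>
      intro k hk s hs hc
      obtain rfl : k = w.size := by omega
      exact ⟨_, by simp [RamExpr.cost], s,
        .loop_exit (by simp [RamExpr.eval, hc, hs.1, hsize]), hs, fun _ _ => rfl⟩
    | succ j ih =>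
      intro k hk s hs hc
      obtain ⟨t, ht, s', h1, h2, h3⟩ := hP s _ hs
      rw [hsize] at ht
      have e : RamExpr.eval s' (.add (.load m (.const 0)) (.const 1)) = k + 1 := by
        simp [RamExpr.eval, h3, hc]
      obtain ⟨t', ht', s'', k1, k2, k3⟩ := ih (k + 1) (by omega) (s'.setCell m 0 (k + 1))
        (by
          rw [Function.iterate_succ_apply']
          exact h2.congr rfl rfl fun a ha => by simp [RamState.setCell, show a ≠ m by omega])
        (by simp [RamState.setCell])
      refine ⟨_, ?_, s'', .loop_step (by simp [RamExpr.eval, hs.1, hsize, hc]; omega)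
        (.seq h1 (.store _ _ _ _)) (by rw [e]; exact k1), k2, fun a ha => ?_⟩
      · simp only [RamExpr.cost]
        nlinarith
      · rw [k3 a ha, ← h3 a (by omega)]
        simp [RamState.setCell, show a ≠ m by omega]
  obtain ⟨t, ht, s', h1, h2, h3⟩ := key w.size 0 (by omega) (s.setCell m 0 0)
    (hw.congr rfl rfl fun a ha => by simp [RamState.setCell, show a ≠ m by omega])
    (by simp [RamState.setCell])
  refine ⟨_, ?_, s', .seq (.store _ _ _ _) h1, h2, fun a ha => ?_⟩
  · simp [RamExpr.cost]; omega
  · rw [h3 a ha]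
    simp [RamState.setCell, show a ≠ m by omega]

end Realizable

/-- A program that first computes the stride `b` of the world from the content of the arrays, takes
`b ^ 4` for the size, and then carries out `Φ`. -/
theorem Realizable.exists_run {m : ℕ} {Φ : World → World} (hΦ : Realizable m Φ) (E : RamExpr)
    (f : World → ℕ) (hf : Evaluable fun w _ => f w) : ∃ (P : RamProg) (p : ℕ[X]),
    ∀ s : RamState, ∀ w₀ : World, w₀ = ⟨E.eval s, 0, s.arr⟩ → w₀.size ≤ f w₀ →
      ∃ t ≤ p.eval (f w₀), ∃ s', Runs P s t s' ∧
        Represents s' (Φ ⟨f w₀ ^ 4, f w₀, s.arr⟩) ∧ ∀ a, m ≤ a → s'.arr a = s.arr a := by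
  obtain ⟨P, p, hP⟩ := hf.out (fun _ => 0) 2 (by simp) (by simp)
  -- Without multiplication, the fourth power is obtained by counting quadruples. Three worlds occur
  -- in turn: one just large enough to evaluate `f`, one of size `f w₀` for this count, and the
  -- final one of size `f w₀ ^ 4`.
  have h4 : Evaluable fun w _ => ∑ _x ∈ Finset.range w.size, ∑ _x ∈ Finset.range w.size,
    ∑ _x ∈ Finset.range w.size, ∑ _x ∈ Finset.range w.size, 1 := inferInstance
  obtain ⟨Q, q, hQ⟩ := h4.out (fun _ => 0) 2 (by simp) (by simp)
  obtain ⟨R, r, hR⟩ := hΦ.out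
  refine ⟨.seq (.assign 0 E) (.seq (.assign 1 (.const 0)) (.seq P (.seq (.assign 0 (.reg 2))
    (.seq (.assign 1 (.reg 2)) (.seq Q (.seq (.assign 0 (.reg 2)) R)))))),
    C (E.cost + 1) + (2 + (p + (2 + (2 + (q + (2 + r.comp (X ^ 4))))))), ?_⟩
  rintro s w₀ hw₀ hle
  let s0 := (s.setReg 0 (E.eval s)).setReg 1 0
  obtain ⟨t1, ht1, s1, r1, a1, b1, c1⟩ := hP s0 w₀ (by
    subst hw₀; exact ⟨rfl, rfl, fun _ _ => rfl⟩)
  let s2 := (s1.setReg 0 (s1.reg 2)).setReg 1 (s1.reg 2)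
  obtain ⟨t3, ht3, s3, r3, a3, b3, c3⟩ := hQ s2 ⟨f w₀, f w₀, s.arr⟩
    ⟨c1, c1, fun a _ => by simp [s2, s0, RamState.setReg, a1]⟩
  obtain ⟨t4, ht4, s4, r4, a4, b4⟩ := hR (s3.setReg 0 (s3.reg 2)) ⟨f w₀ ^ 4, f w₀, s.arr⟩
    ⟨by simp [RamState.setReg, c3]; ring, by
      simp [RamState.setReg, b3, s2, c1], fun a _ => by
      simp [s2, s0, RamState.setReg, a1, a3]⟩
  refine ⟨_, ?_, s4, .seq (.assign _ _ _) (.seq (.assign _ _ _) (.seq r1 (.seq (.assign _ _ _)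
    (.seq (.assign _ _ _) (.seq r3 (.seq (.assign _ _ _) r4)))))), a4, fun a ha => ?_⟩
  · have := p.eval_mono_nat hle
    simp [RamExpr.cost] at *
    omega
  · rw [b4 a ha]
    simp [s2, s0, RamState.setReg, a1, a3]

/-! ### Specifications of programs and their composition -/

/-- From every state that holds the input, `P` reaches within time `p.eval B` a state that holds a
correct output. The arrays from `20` on are not changed. -/
def RamProg.Solves (P : RamProg) (p : ℕ[X]) (B : ℕ) (input : List (List ℕ))
    (ok : List (List ℕ) → Prop) : Prop :=
  ∀ s : RamState, s.Holds input → ∃ t ≤ p.eval B, ∃ s', Runs P s t s' ∧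
    (∀ a, 20 ≤ a → s'.arr a = s.arr a) ∧ ∃ output, s'.Holds output ∧ ok output

theorem RamState.holds_init (input : List (List ℕ)) : (RamState.init input).Holds input := by
  intro a k w hw x hx
  simp [RamState.init, List.getD_eq_getElem?_getD, hw, hx]

theorem RamProg.Solves.computes {P : RamProg} {p : ℕ[X]} {B : ℕ} {input : List (List ℕ)}
    {ok : List (List ℕ) → Prop} (h : P.Solves p B input ok) :
    P.Computes input (p.eval B) ok := by
  obtain ⟨t, ht, s, h1, -, h2⟩ := h _ (RamState.holds_init input)
  exact ⟨t, ht, s, h1, h2⟩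

theorem RamProg.Solves.mono {P : RamProg} {p : ℕ[X]} {B : ℕ} {input : List (List ℕ)}
    {ok ok' : List (List ℕ) → Prop} (h : P.Solves p B input ok) (hok : ∀ o, ok o → ok' o) :
    P.Solves p B input ok' := fun s hs => by
  obtain ⟨t, ht, s, h1, h2, o, h3, h4⟩ := h s hs
  exact ⟨t, ht, s, h1, h2, o, h3, hok o h4⟩

/-- Programs compose because `Solves` allows any start state that holds the input, whatever other
data earlier programs have left behind. Both running times are measured by the same `B`, in practice
the order of the group. -/
theorem RamProg.Solves.seq {P Q : RamProg} {p q : ℕ[X]} {B : ℕ} {input : List (List ℕ)}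
    {ok ok' : List (List ℕ) → Prop} (h : P.Solves p B input ok)
    (h' : ∀ o, ok o → Q.Solves q B o ok') : (RamProg.seq P Q).Solves (p + q) B input ok' := by
  intro s hs
  obtain ⟨t, ht, s', h1, h2, o, h3, h4⟩ := h s hs
  obtain ⟨t', ht', s'', k1, k2, k3⟩ := h' o h4 s' h3
  exact ⟨t + t', by simp; omega, s'', .seq h1 k1, fun a ha => (k2 a ha).trans (h2 a ha), k3⟩

/-! ## Words in arrays -/

/-- The word `l` stands at the beginning of the array `f`. -/
def HoldsWord (f : ℕ → ℕ) (l : List ℕ) : Prop := ∀ k x, l[k]? = some x → f k = x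

theorem holdsWord_singleton {f : ℕ → ℕ} {n : ℕ} : HoldsWord f [n] ↔ f 0 = n := by
  refine ⟨fun h => h 0 n rfl, fun h k x hx => ?_⟩
  cases k with
  | zero => simpa [h] using hx
  | succ k => simp at hx

theorem holdsWord_ofFn {f : ℕ → ℕ} {n : ℕ} {c : Fin n → ℕ} :
    HoldsWord f (List.ofFn c) ↔ ∀ i : Fin n, f i = c i := by
  constructor
  · intro h i
    exact h i _ (by simp)
  · intro h k x hx
    obtain ⟨hk, rfl⟩ := List.getElem?_eq_some_iff.1 hx
    simp only [List.length_ofFn] at hk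
    simp [h ⟨k, hk⟩]

open Classical in
theorem holdsWord_matrixWord {f : ℕ → ℕ} {n : ℕ} {r : Fin n → Fin n → Prop} :
    HoldsWord f (matrixWord r) ↔
      ∀ i j : Fin n, f (i * n + j) = if r i j then 1 else 0 := by
  have e : matrixWord r = List.ofFn fun k : Fin (n * n) =>
      if r (finProdFinEquiv.symm k).1 (finProdFinEquiv.symm k).2 then 1 else 0 := by
    rw [List.ofFn_mul, matrixWord]
    congr 2
    funext i
    congr 1
    funext j
    have : finProdFinEquiv.symm ⟨i * n + j, by nlinarith [i.2, j.2]⟩ = (i, j) := by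
      rw [Equiv.symm_apply_eq]
      ext
      simp [finProdFinEquiv]
      ring
    rw [this]
  rw [e, holdsWord_ofFn, finProdFinEquiv.surjective.forall, Prod.forall]
  refine forall₂_congr fun i j => ?_
  rw [Equiv.symm_apply_apply, show ((finProdFinEquiv (i, j) : Fin (n * n)) : ℕ) = i * n + j by
    simp [finProdFinEquiv]; ring]

theorem RamState.holds_iff {s : RamState} {l : List (List ℕ)} :
    s.Holds l ↔ ∀ a (h : a < l.length), HoldsWord (s.arr a) l[a] := by
  constructor
  · intro h a ha k x hx
    exact h a k _ (List.getElem?_eq_getElem ha) x hx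
  · intro h a k w hw x hx
    obtain ⟨ha, rfl⟩ := List.getElem?_eq_some_iff.1 hw
    exact h a ha k x hx

theorem RamState.holds_one {s : RamState} {u : List ℕ} : s.Holds [u] ↔ HoldsWord (s.arr 0) u := by
  rw [holds_iff]
  exact ⟨fun h => h 0 (by simp), fun h a ha => by
    obtain rfl : a = 0 := by simpa using ha
    exact h⟩

theorem RamState.holds_two {s : RamState} {u v : List ℕ} :
    s.Holds [u, v] ↔ HoldsWord (s.arr 0) u ∧ HoldsWord (s.arr 1) v := by
  rw [holds_iff]
  refine ⟨fun h => ⟨h 0 (by simp), h 1 (by simp)⟩, fun h a ha => ?_⟩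
  obtain rfl | rfl : a = 0 ∨ a = 1 := by simp at ha; omega
  exacts [h.1, h.2]

theorem RamState.holds_three {s : RamState} {u v x : List ℕ} :
    s.Holds [u, v, x] ↔
      HoldsWord (s.arr 0) u ∧ HoldsWord (s.arr 1) v ∧ HoldsWord (s.arr 2) x := by
  rw [holds_iff]
  refine ⟨fun h => ⟨h 0 (by simp), h 1 (by simp), h 2 (by simp)⟩, fun h a ha => ?_⟩
  obtain rfl | rfl | rfl : a = 0 ∨ a = 1 ∨ a = 2 := by simp at ha; omega
  exacts [h.1, h.2.1, h.2.2]

/-! ## Arithmetic in a world -/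

namespace World

/-- The quotient of `x` and `y`. -/
noncomputable def div (w : World) (x y : ℕ) : ℕ := w.count x fun q => w.mul (q + 1) y ≤ x

/-- The quotient is the number of q with (q + 1) y ≤ x, and for positive y all such q are below x.
-/
theorem div_eq {w : World} {x y : ℕ} (hx : x ≤ w.size) (hy : 0 < y) : w.div x y = x / y := by
  classical
  rw [div, count_eq hx, ← Finset.card_range (x / y)]
  congr 1
  ext q
  simp only [Finset.mem_filter, Finset.mem_range]
  have h := Nat.div_le_self x y
  have h' : q + 1 ≤ x / y ↔ (q + 1) * y ≤ x := Nat.le_div_iff_mul_le hy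
  constructor
  · rintro ⟨h1, h2⟩
    rw [mul_eq (by omega)] at h2
    exact h'.2 h2
  · intro h1
    exact ⟨by omega, by rw [mul_eq (by omega)]; exact h'.1 h1⟩

/-- The code of a pair of numbers below the stride. -/
noncomputable def pair (w : World) (i j : ℕ) : ℕ := w.mul i w.base + j

/-- The first component of a pair. -/
noncomputable def fst (w : World) (c : ℕ) : ℕ := w.div c w.base

/-- The second component of a pair. -/
noncomputable def snd (w : World) (c : ℕ) : ℕ := c - w.mul (w.fst c) w.base

/-- The number of codes of pairs. -/
noncomputable def pairs (w : World) : ℕ := w.mul w.base w.base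

/-- The size of the world allows for all computations with numbers and pairs below the stride. -/
structure Roomy (w : World) : Prop where
  one_lt : 1 < w.base
  size_eq : w.size = w.base ^ 4

variable {w : World}

theorem Roomy.base_le (h : w.Roomy) : w.base ≤ w.size := by
  rw [h.size_eq]; exact Nat.le_self_pow (by simp) _

theorem Roomy.sq_le (h : w.Roomy) : w.base ^ 2 ≤ w.size := by
  rw [h.size_eq]; exact Nat.pow_le_pow_right (by have := h.one_lt; omega) (by simp)

theorem Roomy.pairs_eq (h : w.Roomy) : w.pairs = w.base ^ 2 := by
  rw [pairs, mul_eq h.base_le, sq]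

theorem Roomy.pair_eq (h : w.Roomy) {i j : ℕ} (hi : i < w.base) :
    w.pair i j = i * w.base + j := by
  rw [pair, mul_eq (by have := h.base_le; omega)]

theorem Roomy.fst_eq (h : w.Roomy) {c : ℕ} (hc : c < w.base ^ 2) : w.fst c = c / w.base :=
  div_eq (hc.le.trans h.sq_le) (by have := h.one_lt; omega)

theorem Roomy.snd_eq (h : w.Roomy) {c : ℕ} (hc : c < w.base ^ 2) : w.snd c = c % w.base := by
  rw [snd, h.fst_eq hc, mul_eq]
  · have := Nat.div_add_mod' c w.base
    omega
  · exact (Nat.div_le_self _ _).trans (hc.le.trans h.sq_le)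

theorem Roomy.pair_lt (h : w.Roomy) {i j : ℕ} (hi : i < w.base) (hj : j < w.base) :
    w.pair i j < w.base ^ 2 := by
  rw [h.pair_eq hi]; nlinarith

theorem Roomy.fst_pair (h : w.Roomy) {i j : ℕ} (hi : i < w.base) (hj : j < w.base) :
    w.fst (w.pair i j) = i := by
  rw [h.fst_eq (h.pair_lt hi hj), h.pair_eq hi, mul_comm, Nat.mul_add_div (by omega),
    Nat.div_eq_of_lt hj, add_zero]

theorem Roomy.snd_pair (h : w.Roomy) {i j : ℕ} (hi : i < w.base) (hj : j < w.base) :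
    w.snd (w.pair i j) = j := by
  rw [h.snd_eq (h.pair_lt hi hj), h.pair_eq hi, mul_comm, Nat.mul_add_mod, Nat.mod_eq_of_lt hj]

theorem Roomy.exists_pair (h : w.Roomy) {c : ℕ} (hc : c < w.base ^ 2) :
    ∃ i < w.base, ∃ j < w.base, c = w.pair i j := by
  have hi : c / w.base < w.base := Nat.div_lt_of_lt_mul (by rwa [sq] at hc)
  refine ⟨_, hi, c % w.base, Nat.mod_lt _ (by have := h.one_lt; omega), ?_⟩
  rw [h.pair_eq hi, Nat.div_add_mod']

open Classical in
/-- The element of `R` that has exactly `a` predecessors in `R`. -/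
noncomputable def nth (w : World) (R : ℕ → Prop) (a : ℕ) : ℕ :=
  w.sum w.pairs fun c => if R c ∧ w.count c R = a then c else 0

open Classical in
/-- The graph on the elements of `R` with adjacency `r` and colours `col` is written into the first
three arrays. -/
noncomputable def emit (w : World) (R : ℕ → Prop) (r : ℕ → ℕ → Prop) (col : ℕ → ℕ) : World :=
  w.write₃ (fun _ => w.count w.pairs R)
    (fun c => if r (w.nth R (w.div c (w.count w.pairs R)))
      (w.nth R (c - w.mul (w.div c (w.count w.pairs R)) (w.count w.pairs R))) then 1 else 0)
    (fun c => col (w.nth R c))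

theorem Roomy.nth_eq (h : w.Roomy) {R : ℕ → Prop} {c : ℕ} (hc : c < w.base ^ 2) (hR : R c) :
    w.nth R (w.count c R) = c := by
  classical
  rw [nth, h.pairs_eq, sum_eq h.sq_le]
  rw [Finset.sum_eq_single c]
  · simp [hR]
  · intro d hd hdc
    rw [if_neg]
    rintro ⟨hRd, hcount⟩
    rw [Finset.mem_range] at hd
    have h1 : ∀ {x}, x < w.base ^ 2 → w.count x R = Nat.count R x := fun hx => by
      rw [count_eq (hx.le.trans h.sq_le), Nat.count_eq_card_filter_range]
    rw [h1 hd, h1 hc] at hcount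
    exact hdc (Nat.count_injective hRd hR hcount)
  · intro hc'
    exact absurd (Finset.mem_range.2 hc) hc'

/-- Vertex number i of the output is the i-th element of `R` in increasing order. The bijection is
prescribed by `R` alone; two structures coded on the same `R` are therefore matched with the same
output. -/
theorem Roomy.exists_equiv (h : w.Roomy) {R : ℕ → Prop} {α : Type*} {φ : α → ℕ}
    (hφ : Function.Injective φ) (hR : ∀ c, (∃ a, φ a = c) ↔ c < w.base ^ 2 ∧ R c) :
    ∃ σ : Fin (w.count w.pairs R) ≃ α, ∀ i, φ (σ i) = w.nth R i := by
  classical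
  have hφ' : ∀ a, φ a < w.base ^ 2 ∧ R (φ a) := fun a => (hR _).1 ⟨a, rfl⟩
  have h1 : ∀ {x}, x ≤ w.base ^ 2 → w.count x R = Nat.count R x := fun hx => by
    rw [count_eq (hx.trans h.sq_le), Nat.count_eq_card_filter_range]
  have hlt : ∀ a, w.count (φ a) R < w.count w.pairs R := fun a => by
    rw [h.pairs_eq, h1 le_rfl, h1 (hφ' a).1.le]
    exact Nat.count_strict_mono (hφ' a).2 (hφ' a).1
  let τ : α → Fin (w.count w.pairs R) := fun a => ⟨w.count (φ a) R, hlt a⟩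
  have hτ : Function.Bijective τ := by
    constructor
    · intro a b hab
      have : w.count (φ a) R = w.count (φ b) R := congrArg Fin.val hab
      rw [h1 (hφ' a).1.le, h1 (hφ' b).1.le] at this
      exact hφ (Nat.count_injective (hφ' a).2 (hφ' b).2 this)
    · rintro ⟨i, hi⟩
      have hi' := hi
      rw [h.pairs_eq, h1 le_rfl] at hi'
      have h2 : Nat.nth R i < w.base ^ 2 := Nat.nth_lt_of_lt_count hi'
      have h3 : R (Nat.nth R i) := Nat.nth_mem i fun hf => by
        refine hi'.trans_le ?_
        rw [Nat.count_eq_card_filter_range]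
        refine Finset.card_le_card fun x hx => ?_
        simp only [Finset.mem_filter] at hx
        simpa using hx.2
      obtain ⟨a, ha⟩ := (hR _).2 ⟨h2, h3⟩
      refine ⟨a, Fin.ext ?_⟩
      show w.count (φ a) R = i
      rw [ha, h1 h2.le]
      exact Nat.count_nth fun hf => by
        refine hi'.trans_le ?_
        rw [Nat.count_eq_card_filter_range]
        refine Finset.card_le_card fun x hx => ?_
        simp only [Finset.mem_filter] at hx
        simpa using hx.2
  refine ⟨(Equiv.ofBijective τ hτ).symm, fun i => ?_⟩
  obtain ⟨a, rfl⟩ := hτ.2 i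
  rw [Equiv.ofBijective_symm_apply_apply]
  exact (h.nth_eq (hφ' a).1 (hφ' a).2).symm

theorem Roomy.count_le (h : w.Roomy) (R : ℕ → Prop) : w.count w.pairs R ≤ w.base ^ 2 := by
  classical
  rw [h.pairs_eq, count_eq h.sq_le]
  exact (Finset.card_filter_le _ _).trans (by simp)

-- Codes are pairs below the stride, so an emitted graph has at most `base ^ 2` vertices and its
-- matrix at most `base ^ 4` entries: this is the origin of the exponent 4 in the size of the world.
open Classical in
theorem Roomy.holds_emit (h : w.Roomy) {R : ℕ → Prop} {r : ℕ → ℕ → Prop} {col : ℕ → ℕ}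
    {s : RamState} (hs : Represents s (w.emit R r col)) :
    s.Holds [[w.count w.pairs R],
      matrixWord fun i j : Fin (w.count w.pairs R) => r (w.nth R i) (w.nth R j),
      List.ofFn fun i : Fin (w.count w.pairs R) => col (w.nth R i)] := by
  have hk := h.count_le R
  have hsz : w.base ^ 2 * w.base ^ 2 = w.size := by rw [h.size_eq]; ring
  have h2 := h.sq_le
  have h1 := h.one_lt
  have h3 : 1 ≤ w.base ^ 2 := Nat.one_le_pow _ _ (by omega)
  rw [RamState.holds_three, holdsWord_singleton, holdsWord_matrixWord, holdsWord_ofFn,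
    hs.2.2 0 (by simp), hs.2.2 1 (by simp), hs.2.2 2 (by simp)]
  refine ⟨?_, fun i j => ?_, fun i => ?_⟩
  · simp [emit, World.write₃, World.write]
    omega
  · have hij : (i : ℕ) * (w.count w.pairs R) + j < w.size := by
      have := i.2; have := j.2
      nlinarith
    have hd : w.div ((i : ℕ) * (w.count w.pairs R) + j) (w.count w.pairs R) = i := by
      rw [div_eq hij.le (by have := i.2; omega), mul_comm, Nat.mul_add_div (by have := i.2; omega),
        Nat.div_eq_of_lt j.2, add_zero]
    have : (i : ℕ) ≤ w.size := by have := i.2; omega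
    simp only [emit, World.write₃, World.write]
    rw [Function.update_of_ne (by simp), Function.update_self, if_pos hij, hd, mul_eq this,
      Nat.add_sub_cancel_left]
  · have : (i : ℕ) < w.size := by have := i.2; omega
    simp [emit, World.write₃, World.write, this]

end World

section Instances

variable {F G : World → (ℕ → ℕ) → ℕ} [hF : Evaluable F] [hG : Evaluable G]

theorem Evaluable.div_base : Evaluable fun w e => w.div (e 0) (e 1) := by
  unfold World.div; infer_instance

instance Evaluable.div : Evaluable fun w e => w.div (F w e) (G w e) := comp₂ div_base hF hG

theorem Evaluable.pair_base : Evaluable fun w e => w.pair (e 0) (e 1) := by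
  unfold World.pair; infer_instance

instance Evaluable.pair : Evaluable fun w e => w.pair (F w e) (G w e) := comp₂ pair_base hF hG

theorem Evaluable.fst_base : Evaluable fun w e => w.fst (e 0) := by
  unfold World.fst; infer_instance

instance Evaluable.fst : Evaluable fun w e => w.fst (F w e) := comp₁ fst_base hF

theorem Evaluable.snd_base : Evaluable fun w e => w.snd (e 0) := by
  unfold World.snd; infer_instance

instance Evaluable.snd : Evaluable fun w e => w.snd (F w e) := comp₁ snd_base hF

instance Evaluable.pairs : Evaluable fun w _ => w.pairs := by
  unfold World.pairs; infer_instance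

end Instances

theorem Realizable.emit {R : World → ℕ → Prop} {r : World → ℕ → ℕ → Prop} {col : World → ℕ → ℕ}
    (hR : Decides fun w e => R w (e 0)) (hr : Decides fun w e => r w (e 0) (e 1))
    (hcol : Evaluable fun w e => col w (e 0)) :
    Realizable 13 fun w => w.emit (R w) (r w) (col w) := by
  have h1 : Evaluable fun w _ => w.count w.pairs (R w) := Evaluable.count (q := fun w _ => R w)
  have h2 : Decides fun w e => R w (e 1) := hR.comp₁ (.var 1)
  have h3 : Evaluable fun w e => w.count (e 0) (R w) := Evaluable.count (q := fun w _ => R w)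
  have h4 : Evaluable fun w e => w.nth (R w) (e 0) := by
    unfold World.nth; infer_instance
  have h5 : Decides fun w e => r w (w.nth (R w) (w.div (e 0) (w.count w.pairs (R w))))
      (w.nth (R w) (e 0 - w.mul (w.div (e 0) (w.count w.pairs (R w)))
        (w.count w.pairs (R w)))) :=
    hr.comp₂ (Evaluable.comp₁ h4 inferInstance) (Evaluable.comp₁ h4 inferInstance)
  exact Realizable.write₃ h1 inferInstance (hcol.comp₁ h4)

/-! ## Graphs in a world -/

namespace World

/-- The number of vertices of the graph in the first arrays. -/
def order (w : World) : ℕ := w.arr 0 0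

/-- Adjacency in the graph in the first arrays. -/
def Adj (w : World) (u v : ℕ) : Prop := w.arr 1 (w.mul u w.order + v) ≠ 0

/-- The third array holds the colours. -/
def color (w : World) (v : ℕ) : ℕ := w.arr 2 v

/-- The set of all `k < n` is a copy of `α`, where `n` is at most the size of the world. -/
structure Codes (w : World) (n : ℕ) {α : Type*} (code : α → ℕ) : Prop where
  le_size : n ≤ w.size
  injective : Function.Injective code
  exists_iff : ∀ k, (∃ a, code a = k) ↔ k < n

/-- The graph in the first arrays of the world is a copy of the relation `r`. -/
structure Reads (w : World) {α : Type*} (code : α → ℕ) (r : α → α → Prop) : Prop extends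
    w.Roomy where
  order_lt : w.order < w.base
  codes : w.Codes w.order code
  adj_iff : ∀ a b, w.Adj (code a) (code b) ↔ r a b

variable {w : World} {α : Type*} {code : α → ℕ} {n : ℕ}

namespace Codes

theorem lt (h : w.Codes n code) (a : α) : code a < n := (h.exists_iff _).1 ⟨a, rfl⟩

theorem ex_iff (h : w.Codes n code) (q : ℕ → Prop) : w.Ex n q ↔ ∃ a, q (code a) := by
  rw [World.ex_iff h.le_size]
  constructor
  · rintro ⟨x, hx, hq⟩
    obtain ⟨a, rfl⟩ := (h.exists_iff x).2 hx
    exact ⟨a, hq⟩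
  · rintro ⟨a, ha⟩
    exact ⟨_, h.lt a, ha⟩

theorem all_iff (h : w.Codes n code) (q : ℕ → Prop) : w.All n q ↔ ∀ a, q (code a) := by
  rw [World.All, h.ex_iff]
  push Not
  rfl

theorem count_eq (h : w.Codes n code) (q : ℕ → Prop) :
    w.count n q = Set.ncard {a | q (code a)} := by
  classical
  rw [World.count_eq h.le_size, ← Set.ncard_image_of_injective _ h.injective,
    ← Set.ncard_coe_finset]
  congr 1
  ext k
  simp only [Finset.coe_filter, Finset.mem_range, Set.mem_ofPred_eq, Set.mem_image]
  constructor
  · rintro ⟨hk, hq⟩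
    obtain ⟨a, rfl⟩ := (h.exists_iff k).2 hk
    exact ⟨a, hq, rfl⟩
  · rintro ⟨a, hq, rfl⟩
    exact ⟨h.lt a, hq⟩

theorem sum_eq_single (h : w.Codes n code) (f : ℕ → ℕ) (a : α)
    (hf : ∀ b, b ≠ a → f (code b) = 0) : w.sum n f = f (code a) := by
  rw [World.sum_eq h.le_size]
  refine Finset.sum_eq_single_of_mem _ (Finset.mem_range.2 (h.lt a)) fun k hk hne => ?_
  obtain ⟨b, rfl⟩ := (h.exists_iff k).2 (Finset.mem_range.1 hk)
  exact hf b fun e => hne (e ▸ rfl)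

theorem exists_least (h : w.Codes n code) {q : α → Prop} (hq : ∃ a, q a) :
    ∃ a, q a ∧ ∀ b, code b < code a → ¬ q b := by
  obtain ⟨a, ha, hmin⟩ := (measure code).wf.has_min {a | q a} hq
  exact ⟨a, ha, fun b hb hqb => hmin b hqb hb⟩

theorem card_eq (h : w.Codes n code) : Nat.card α = n := by
  classical
  have e := h.count_eq fun _ => True
  rw [World.count_eq h.le_size] at e
  simpa using e.symm

end Codes

open Classical in
theorem reads_of_holds {s : RamState} {n B : ℕ} {q : Fin n → Fin n → Prop} {r : α → α → Prop}
    (h0 : s.arr 0 0 = n)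
    (h1 : ∀ i j : Fin n, s.arr 1 (i * n + j) = if q i j then 1 else 0) (e : Fin n ≃ α)
    (he : ∀ i j, q i j ↔ r (e i) (e j)) (hB : n + 2 ≤ B) :
    World.Reads ⟨B ^ 4, B, s.arr⟩ (fun a => (e.symm a : ℕ)) r := by
  have hsz : B ≤ B ^ 4 := Nat.le_self_pow (by simp) _
  refine ⟨⟨by simp only; omega, rfl⟩, by simp only [order]; omega,
    ⟨by simp only [order]; omega, fun _ _ hab => e.symm.injective (Fin.ext hab), fun k => ?_⟩,
    fun a b => ?_⟩
  · simp only [order, h0]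
    exact ⟨by rintro ⟨a, rfl⟩; exact (e.symm a).2, fun hk => ⟨e ⟨k, hk⟩, by simp⟩⟩
  · rw [Adj, mul_eq (by have := (e.symm a).2; simp only; omega)]
    simp only [order, h0, h1, he, Equiv.apply_symm_apply]
    simp

end World

section Instances

variable {F G : World → (ℕ → ℕ) → ℕ} [hF : Evaluable F] [hG : Evaluable G]

instance Evaluable.order : Evaluable fun w _ => w.order := by
  unfold World.order; infer_instance

theorem Decides.adj_base : Decides fun w e => w.Adj (e 0) (e 1) := by
  unfold World.Adj; infer_instance

instance Decides.adj : Decides fun w e => w.Adj (F w e) (G w e) := comp₂ adj_base hF hG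

theorem Evaluable.color_base : Evaluable fun w e => w.color (e 0) := by
  unfold World.color; infer_instance

instance Evaluable.color : Evaluable fun w e => w.color (F w e) := comp₁ color_base hF

end Instances

theorem Realizable.exists_run_graph {m : ℕ} {Φ : World → World} (hΦ : Realizable m Φ) :
    ∃ (P : RamProg) (p : ℕ[X]), ∀ s : RamState, ∃ t ≤ p.eval (s.arr 0 0), ∃ s', Runs P s t s' ∧
      Represents s' (Φ ⟨(s.arr 0 0 + 2) ^ 4, s.arr 0 0 + 2, s.arr⟩) ∧
      ∀ a, m ≤ a → s'.arr a = s.arr a := by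
  have hf : Evaluable fun w _ => w.order + 2 := inferInstance
  obtain ⟨P, p, h⟩ := hΦ.exists_run (.load 0 (.const 0)) _ hf
  refine ⟨P, p.comp (X + 2), fun s => ?_⟩
  obtain ⟨t, ht, h⟩ := h s _ rfl (by simp [RamExpr.eval, World.order])
  exact ⟨t, by simpa [World.order] using ht, h⟩

/-- Adding up all colours gives a stride that exceeds each of them, so that a vertex and a colour
can be coded as one pair. The summand 2 makes the stride larger than 1 even for the empty graph. -/
theorem Realizable.exists_run_coloredGraph {m : ℕ} {Φ : World → World} (hΦ : Realizable m Φ) :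
    ∃ (P : RamProg) (p : ℕ[X]), ∀ s : RamState, ∀ B,
      B = s.arr 0 0 + ∑ v ∈ Finset.range (s.arr 0 0), s.arr 2 v + 2 →
      ∃ t ≤ p.eval B, ∃ s', Runs P s t s' ∧ Represents s' (Φ ⟨B ^ 4, B, s.arr⟩) ∧
      ∀ a, m ≤ a → s'.arr a = s.arr a := by
  have hf : Evaluable fun w _ => w.order + w.sum w.order (fun v => w.color v) + 2 := inferInstance
  obtain ⟨P, p, h⟩ := hΦ.exists_run (.load 0 (.const 0)) _ hf
  refine ⟨P, p, fun s B hB => ?_⟩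
  have e : (fun w : World => w.order + w.sum w.order (fun v => w.color v) + 2)
      ⟨s.arr 0 0, 0, s.arr⟩ = B := by
    rw [hB]
    exact congrArg (s.arr 0 0 + · + 2)
      (World.sum_eq (w := ⟨s.arr 0 0, 0, s.arr⟩) (b := s.arr 0 0) le_rfl _)
  have := h s ⟨s.arr 0 0, 0, s.arr⟩ rfl
  simp only [e] at this
  exact this (by omega)

/-! ## Maximal cyclic subgroups -/

section Cover

variable {G : Type*} [Group G]

/-- `g` generates a maximal cyclic subgroup. -/
def IsMaxGenerator (g : G) : Prop := ∀ h, g ∈ Subgroup.zpowers h → h ∈ Subgroup.zpowers g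

theorem mem_zpowers_trans {x y z : G} (h : x ∈ Subgroup.zpowers y)
    (h' : y ∈ Subgroup.zpowers z) : x ∈ Subgroup.zpowers z :=
  Subgroup.zpowers_le.2 h' h

theorem zpowers_eq_of_mem {x y : G} (h : x ∈ Subgroup.zpowers y)
    (h' : y ∈ Subgroup.zpowers x) : Subgroup.zpowers x = Subgroup.zpowers y :=
  le_antisymm (Subgroup.zpowers_le.2 h) (Subgroup.zpowers_le.2 h')

theorem mem_zpowers_of_orderOf_le [Finite G] {x y : G} (h : x ∈ Subgroup.zpowers y)
    (h' : orderOf y ≤ orderOf x) : y ∈ Subgroup.zpowers x := by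
  rw [← Subgroup.zpowers_le]
  refine (Subgroup.eq_of_le_of_card_ge (Subgroup.zpowers_le.2 h) ?_).ge
  rwa [Nat.card_zpowers, Nat.card_zpowers]

theorem exists_isMaxGenerator [Finite G] (x : G) :
    ∃ g : G, IsMaxGenerator g ∧ x ∈ Subgroup.zpowers g := by
  obtain ⟨g, hg, hmax⟩ := Set.exists_max_image {g : G | x ∈ Subgroup.zpowers g} orderOf
    (Set.toFinite _) ⟨x, Subgroup.mem_zpowers x⟩
  exact ⟨g, fun h hh => mem_zpowers_of_orderOf_le hh (hmax h (mem_zpowers_trans hg hh)), hg⟩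

/-- If a member ⟨g⟩ lay properly in some ⟨h⟩, the member covering h would be a different one
containing ⟨g⟩, and ⟨g⟩ could be omitted. Conversely, a member that contains the generator of a
maximal cyclic subgroup is equal to that subgroup, so none of these can be missing. In particular
the minimal cover exists and is unique. -/
theorem isMinimalCyclicCover_iff [Finite G] {C : Set (Subgroup G)} :
    IsMinimalCyclicCover C ↔ C = {H | ∃ g, IsMaxGenerator g ∧ H = Subgroup.zpowers g} := by
  constructor
  · rintro ⟨h1, h2, h3⟩
    ext H
    constructor
    · intro hH
      obtain ⟨g, rfl⟩ := h1 H hH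
      refine ⟨g, fun h hg => ?_, rfl⟩
      by_contra hne
      refine h3 _ hH fun x => ?_
      obtain ⟨K, hK, hx⟩ := h2 x
      obtain ⟨K', hK', hh⟩ := h2 h
      have hne' : K' ≠ Subgroup.zpowers g := fun e => hne (e ▸ hh)
      by_cases e : K = Subgroup.zpowers g
      · exact ⟨K', hK', hne', Subgroup.zpowers_le.2 hh (Subgroup.zpowers_le.2 hg (e ▸ hx))⟩
      · exact ⟨K, hK, e, hx⟩
    · rintro ⟨g, hg, rfl⟩
      obtain ⟨K, hK, hx⟩ := h2 g
      obtain ⟨k, rfl⟩ := h1 K hK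
      rwa [zpowers_eq_of_mem hx (hg k hx)]
  · rintro rfl
    refine ⟨fun H ⟨g, _, hH⟩ => ⟨g, hH⟩, fun x => ?_, ?_⟩
    · obtain ⟨g, hg, hx⟩ := exists_isMaxGenerator x
      exact ⟨_, ⟨g, hg, rfl⟩, hx⟩
    · rintro _ ⟨g, hg, rfl⟩ h
      obtain ⟨_, ⟨k, hk, rfl⟩, hne, hx⟩ := h g
      exact hne (zpowers_eq_of_mem (hg k hx) hx)

theorem isCCGenerator_iff [Finite G] {g : G} : IsCCGenerator g ↔ IsMaxGenerator g := by
  constructor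
  · rintro ⟨C, hC, hg⟩
    rw [isMinimalCyclicCover_iff] at hC
    subst hC
    obtain ⟨k, hk, e⟩ := hg
    intro h hh
    have : k ∈ Subgroup.zpowers g := by rw [e]; exact Subgroup.mem_zpowers k
    rw [e]
    exact hk h (mem_zpowers_trans this hh)
  · exact fun h => ⟨_, isMinimalCyclicCover_iff.2 rfl, g, h, rfl⟩

end Cover

/-! ### Closed neighbourhoods and twins of maximal generators -/

section ClosedNeighbors

variable {V : Type*}

/-- `v` lies in the closed neighbourhood of `u`. -/
def SimpleGraph.ClosedAdj (X : SimpleGraph V) (u v : V) : Prop := u = v ∨ X.Adj u v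

theorem SimpleGraph.ClosedAdj.refl (X : SimpleGraph V) (u : V) : X.ClosedAdj u u := Or.inl rfl

theorem SimpleGraph.ClosedAdj.symm {X : SimpleGraph V} {u v : V} (h : X.ClosedAdj u v) :
    X.ClosedAdj v u := h.imp Eq.symm fun h => h.symm

theorem SimpleGraph.closedTwins_iff {X : SimpleGraph V} {u v : V} :
    X.ClosedTwins u v ↔ ∀ x, X.ClosedAdj u x ↔ X.ClosedAdj v x := by
  simp [ClosedTwins, Set.ext_iff, ClosedAdj, eq_comm]

theorem SimpleGraph.ClosedTwins.closedAdj {X : SimpleGraph V} {u v : V}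
    (h : X.ClosedTwins u v) : X.ClosedAdj u v :=
  (closedTwins_iff.1 h v).2 (.refl X v)

theorem SimpleGraph.ClosedTwins.symm {X : SimpleGraph V} {u v : V}
    (h : X.ClosedTwins u v) : X.ClosedTwins v u := Eq.symm h

theorem SimpleGraph.ClosedTwins.trans {X : SimpleGraph V} {u v x : V}
    (h : X.ClosedTwins u v) (h' : X.ClosedTwins v x) : X.ClosedTwins u x := Eq.trans h h'

variable {G : Type*} [Group G]

theorem directedPowerGraph_adj {x y : G} :
    (directedPowerGraph G).Adj x y ↔ y ∈ Subgroup.zpowers x := by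
  simp [directedPowerGraph, Subgroup.mem_zpowers_iff, eq_comm]

theorem powerGraph_closedAdj {x y : G} : (powerGraph G).ClosedAdj x y ↔
    x ∈ Subgroup.zpowers y ∨ y ∈ Subgroup.zpowers x := by
  simp only [SimpleGraph.ClosedAdj, powerGraph, directedPowerGraph_adj]
  by_cases e : x = y
  · subst e; simp
  · simp [e, or_comm]

theorem enhancedPowerGraph_closedAdj {x y : G} : (enhancedPowerGraph G).ClosedAdj x y ↔
    ∃ z, x ∈ Subgroup.zpowers z ∧ y ∈ Subgroup.zpowers z := by
  simp only [SimpleGraph.ClosedAdj, enhancedPowerGraph]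
  by_cases e : x = y
  · subst e; simpa using ⟨x, Subgroup.mem_zpowers x⟩
  · simp [e]

/-- The closed neighbourhood of a generator of a maximal cyclic subgroup is this subgroup. -/
def SimpleGraph.DetectsMaxCyclic (X : SimpleGraph G) : Prop :=
  ∀ g, IsMaxGenerator g → ∀ x, X.ClosedAdj g x ↔ x ∈ Subgroup.zpowers g

theorem powerGraph_detects : (powerGraph G).DetectsMaxCyclic := fun g hg x => by
  rw [powerGraph_closedAdj]
  exact ⟨fun h => h.elim (hg x) id, Or.inr⟩

theorem enhancedPowerGraph_detects : (enhancedPowerGraph G).DetectsMaxCyclic := fun g hg x => by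
  rw [enhancedPowerGraph_closedAdj]
  exact ⟨fun ⟨z, h, h'⟩ => mem_zpowers_trans h' (hg z h), fun h => ⟨g, Subgroup.mem_zpowers g, h⟩⟩

/-- One representative of each closed twin class that contains a generator of a maximal cyclic
subgroup. -/
theorem isCCGSetUpToTwins_of_transversal [Finite G] {X : SimpleGraph G} (hX : X.DetectsMaxCyclic)
    {S : Set G} (h1 : ∀ v ∈ S, ∃ g, IsMaxGenerator g ∧ X.ClosedTwins v g)
    (h2 : ∀ g, IsMaxGenerator g → ∃ v ∈ S, X.ClosedTwins v g)
    (h3 : ∀ u ∈ S, ∀ v ∈ S, X.ClosedTwins u v → u = v) : IsCCGSetUpToTwins X S := by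
  classical
  -- Generators of the same maximal cyclic subgroup have the same closed neighbourhood. So members
  -- of the transversal that are not twins belong to different subgroups.
  have key : ∀ g h, IsMaxGenerator g → IsMaxGenerator h → Subgroup.zpowers g = Subgroup.zpowers h →
      X.ClosedTwins g h := fun g h hg hh e => by
    rw [SimpleGraph.closedTwins_iff]
    intro x
    rw [hX g hg, hX h hh, e]
  -- A representative that is itself a maximal generator has to be kept, not replaced by a twin.
  have h1' : ∀ v, ∃ g, v ∈ S → (IsMaxGenerator v → g = v) ∧ IsMaxGenerator g ∧
      X.ClosedTwins v g := fun v => by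
    by_cases hv : v ∈ S
    · by_cases hm : IsMaxGenerator v
      · exact ⟨v, fun _ => ⟨fun _ => rfl, hm, rfl⟩⟩
      · obtain ⟨g, hg⟩ := h1 v hv
        exact ⟨g, fun _ => ⟨fun h => absurd h hm, hg⟩⟩
    · exact ⟨v, fun h => absurd h hv⟩
  choose f hf using h1'
  refine ⟨f, fun v hv => ?_, fun u hu v hv e => ?_, ?_, ?_⟩
  · rw [isCCGenerator_iff, isCCGenerator_iff]
    exact ⟨(hf v hv).1, fun _ => (hf v hv).2⟩
  · exact h3 u hu v hv ((hf u hu).2.2.trans (e ▸ (hf v hv).2.2.symm))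
  · rintro _ ⟨u, hu, rfl⟩ _ ⟨v, hv, rfl⟩ e
    rw [h3 u hu v hv ((hf u hu).2.2.trans ((key _ _ (hf u hu).2.1 (hf v hv).2.1 e).trans
      (hf v hv).2.2.symm))]
  · rw [isMinimalCyclicCover_iff]
    ext H
    constructor
    · rintro ⟨_, ⟨u, hu, rfl⟩, rfl⟩
      exact ⟨_, (hf u hu).2.1, rfl⟩
    · rintro ⟨g, hg, rfl⟩
      obtain ⟨v, hv, ht⟩ := h2 g hg
      refine ⟨_, ⟨v, hv, rfl⟩, ?_⟩
      have e := SimpleGraph.closedTwins_iff.1 ((hf v hv).2.2.symm.trans ht)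
      exact zpowers_eq_of_mem ((hX g hg _).1 ((e _).1 (.refl X _)))
        ((hX _ (hf v hv).2.1 _).1 ((e _).2 (.refl X _)))

/-- In the enhanced power graph, the closed neighbourhood of `v` is a clique exactly when `v` is a
closed twin of a generator of a maximal cyclic subgroup. -/
theorem enhancedPowerGraph_clique_iff [Finite G] {v : G} :
    (∀ x, (enhancedPowerGraph G).ClosedAdj v x → ∀ y, (enhancedPowerGraph G).ClosedAdj v y →
      (enhancedPowerGraph G).ClosedAdj x y) ↔
    ∃ g, IsMaxGenerator g ∧ (enhancedPowerGraph G).ClosedTwins v g := by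
  constructor
  · intro h
    obtain ⟨g, hg, hv⟩ := exists_isMaxGenerator v
    have hvg : (enhancedPowerGraph G).ClosedAdj v g :=
      enhancedPowerGraph_closedAdj.2 ⟨g, hv, Subgroup.mem_zpowers g⟩
    refine ⟨g, hg, SimpleGraph.closedTwins_iff.2 fun x => ⟨fun hx => h _ hvg _ hx, fun hx => ?_⟩⟩
    exact enhancedPowerGraph_closedAdj.2 ⟨g, hv, (enhancedPowerGraph_detects g hg x).1 hx⟩
  · rintro ⟨g, hg, ht⟩ x hx y hy
    rw [SimpleGraph.closedTwins_iff] at ht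
    rw [ht, enhancedPowerGraph_detects g hg] at hx hy
    exact enhancedPowerGraph_closedAdj.2 ⟨g, hx, hy⟩

end ClosedNeighbors

/-! ## Cyclic subgroups of a cyclic group -/

section Cyclic

variable {G : Type*} [Group G] [Finite G]

/-- In the cyclic group ⟨x⟩ the equation cⁿ = 1 has at most n solutions. For n = o(b) the n elements
of ⟨b⟩ already are solutions, so every solution, in particular a, lies in ⟨b⟩. -/
theorem mem_zpowers_of_orderOf_dvd {x a b : G} (ha : a ∈ Subgroup.zpowers x)
    (hb : b ∈ Subgroup.zpowers x) (h : orderOf a ∣ orderOf b) : a ∈ Subgroup.zpowers b := by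
  classical
  have := Fintype.ofFinite G
  let a' : Subgroup.zpowers x := ⟨a, ha⟩
  let b' : Subgroup.zpowers x := ⟨b, hb⟩
  have hab : orderOf a' ∣ orderOf b' := by rwa [← Subgroup.orderOf_coe, ← Subgroup.orderOf_coe]
  have hle : (Finset.univ.filter fun c : Subgroup.zpowers x => c ^ orderOf b' = 1).card ≤
      orderOf b' := IsCyclic.card_pow_eq_one_le (orderOf_pos b')
  have hsub : Finset.univ.filter (fun c => c ∈ Subgroup.zpowers b') ⊆
      Finset.univ.filter fun c : Subgroup.zpowers x => c ^ orderOf b' = 1 := by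
    intro c hc
    simp only [Finset.mem_filter, Finset.mem_univ, true_and] at hc ⊢
    exact orderOf_dvd_iff_pow_eq_one.1 (orderOf_dvd_of_mem_zpowers hc)
  have hcard : (Finset.univ.filter (fun c => c ∈ Subgroup.zpowers b')).card = orderOf b' := by
    rw [← Nat.card_zpowers b', Nat.card_eq_fintype_card, Fintype.card_subtype]
  have := Finset.eq_of_subset_of_card_le hsub (by rw [hcard]; exact hle)
  have ha' : a' ∈ Finset.univ.filter (fun c => c ∈ Subgroup.zpowers b') := by
    rw [this]
    simpa using orderOf_dvd_iff_pow_eq_one.1 hab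
  simp only [Finset.mem_filter, Finset.mem_univ, true_and] at ha'
  obtain ⟨k, hk⟩ := Subgroup.mem_zpowers_iff.1 ha'
  exact Subgroup.mem_zpowers_iff.2 ⟨k, congrArg Subtype.val hk⟩

theorem mem_zpowers_iff_orderOf_dvd {x a b : G} (ha : a ∈ Subgroup.zpowers x)
    (hb : b ∈ Subgroup.zpowers x) : a ∈ Subgroup.zpowers b ↔ orderOf a ∣ orderOf b :=
  ⟨orderOf_dvd_of_mem_zpowers, mem_zpowers_of_orderOf_dvd ha hb⟩

theorem exists_mem_zpowers_orderOf_eq (x : G) {d : ℕ} (hd : d ∣ orderOf x) :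
    ∃ y ∈ Subgroup.zpowers x, orderOf y = d :=
  ⟨x ^ (orderOf x / d), Subgroup.npow_mem_zpowers x _,
    orderOf_pow_orderOf_div (orderOf_pos x).ne' hd⟩

theorem ncard_generators (x : G) :
    Set.ncard {y : G | Subgroup.zpowers y = Subgroup.zpowers x} = Nat.totient (orderOf x) := by
  classical
  have := Fintype.ofFinite G
  have e : {y : G | Subgroup.zpowers y = Subgroup.zpowers x} =
      Subtype.val '' {y : Subgroup.zpowers x | orderOf y = orderOf x} := by
    ext y
    simp only [Set.mem_ofPred_eq, Set.mem_image, Subtype.exists, exists_and_right, exists_eq_right]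
    constructor
    · intro h
      have hy : y ∈ Subgroup.zpowers x := h ▸ Subgroup.mem_zpowers y
      refine ⟨hy, ?_⟩
      rw [← Subgroup.orderOf_coe, ← Nat.card_zpowers, ← Nat.card_zpowers, h]
    · rintro ⟨hy, h⟩
      rw [← Subgroup.orderOf_coe] at h
      exact zpowers_eq_of_mem hy (mem_zpowers_of_orderOf_le hy h.ge)
  rw [e, Set.ncard_image_of_injective _ Subtype.val_injective, Set.ncard_eq_toFinset_card']
  have h := IsCyclic.card_orderOf_eq_totient (α := Subgroup.zpowers x) (d := orderOf x)
    (by rw [← Nat.card_eq_fintype_card, Nat.card_zpowers])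
  rw [← h]
  congr 1
  ext y
  simp

/-- A divisor, neither trivial nor the whole number, that is comparable with all divisors. -/
theorem Nat.eq_prime_pow_of_comparable {d e : ℕ} (hd : d ≠ 0) (hed : e ∣ d) (he1 : e ≠ 1)
    (hne : e ≠ d) (h : ∀ c, c ∣ d → c ∣ e ∨ e ∣ c) : ∃ p k, p.Prime ∧ d = p ^ k := by
  obtain ⟨m, rfl⟩ := hed
  have hm : m ≠ 1 := by rintro rfl; simp at hne
  obtain ⟨p, hp, hpm⟩ := Nat.exists_prime_and_dvd hm
  have hm0 : m ≠ 0 := by rintro rfl; simp at hd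
  have he0 : e ≠ 0 := by rintro rfl; simp at hd
  -- With p a prime divisor of d / e, this power of p divides d but not e, so e divides it and is a
  -- power of p itself. Every prime divisor of d is comparable with e and hence equals p.
  have h1 : p ^ (e.factorization p + 1) ∣ e * m :=
    pow_succ p _ ▸ mul_dvd_mul (Nat.ordProj_dvd e p) hpm
  have h2 : e ∣ p ^ (e.factorization p + 1) :=
    (h _ h1).resolve_left (Nat.pow_succ_factorization_not_dvd he0 hp)
  obtain ⟨b, -, hb⟩ := (Nat.dvd_prime_pow hp).1 h2
  have hb0 : b ≠ 0 := by rintro rfl; exact he1 (by simpa using hb)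
  refine ⟨p, _, hp, Nat.eq_prime_pow_of_unique_prime_dvd hd fun {q} hq hqd => ?_⟩
  rcases h q hqd with h3 | h3
  · rw [hb] at h3
    exact (Nat.prime_dvd_prime_iff_eq hq hp).1 (hq.dvd_of_dvd_pow h3)
  · exact ((Nat.prime_dvd_prime_iff_eq hp hq).1 ((dvd_pow_self p hb0).trans (hb ▸ h3))).symm

/-- Subgroups of ⟨x⟩ correspond to divisors of o(x), so this is the preceding fact on divisors. It
explains how the closed neighbourhoods of two distinct cyclic subgroups can coincide at all. -/
theorem orderOf_eq_prime_pow_of_comparable {x y : G} (h : y ∈ Subgroup.zpowers x) (h1 : y ≠ 1)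
    (hne : x ∉ Subgroup.zpowers y)
    (hc : ∀ w ∈ Subgroup.zpowers x, w ∈ Subgroup.zpowers y ∨ y ∈ Subgroup.zpowers w) :
    ∃ p k, p.Prime ∧ orderOf x = p ^ k := by
  refine Nat.eq_prime_pow_of_comparable (orderOf_pos x).ne' (orderOf_dvd_of_mem_zpowers h)
    (by rwa [Ne, orderOf_eq_one_iff]) (fun e => hne (mem_zpowers_of_orderOf_le h e.ge))
    fun c hcd => ?_
  obtain ⟨w, hw, rfl⟩ := exists_mem_zpowers_orderOf_eq x hcd
  exact (hc w hw).imp orderOf_dvd_of_mem_zpowers orderOf_dvd_of_mem_zpowers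

theorem comparable_of_orderOf_eq_prime_pow {x a b : G} {p k : ℕ} (hp : p.Prime)
    (hx : orderOf x = p ^ k) (ha : a ∈ Subgroup.zpowers x) (hb : b ∈ Subgroup.zpowers x) :
    a ∈ Subgroup.zpowers b ∨ b ∈ Subgroup.zpowers a := by
  rw [mem_zpowers_iff_orderOf_dvd ha hb, mem_zpowers_iff_orderOf_dvd hb ha]
  obtain ⟨i, -, hi⟩ := (Nat.dvd_prime_pow hp).1 (hx ▸ orderOf_dvd_of_mem_zpowers ha)
  obtain ⟨j, -, hj⟩ := (Nat.dvd_prime_pow hp).1 (hx ▸ orderOf_dvd_of_mem_zpowers hb)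
  rw [hi, hj]
  exact (le_total i j).imp (pow_dvd_pow p) (pow_dvd_pow p)

end Cyclic

/-! ## Directions of the edges of the power graph -/

section Orientation

variable {V : Type*}

/-- `v` is adjacent to all other vertices. -/
def SimpleGraph.Dominates (X : SimpleGraph V) (v : V) : Prop := ∀ x, X.ClosedAdj v x

/-- The number of closed twins. -/
noncomputable def SimpleGraph.twinCard (X : SimpleGraph V) (v : V) : ℕ :=
  Set.ncard {u | X.ClosedTwins v u}

/-- `y` has a neighbour without twins outside the closed neighbourhood of `x`. -/
def SimpleGraph.Separates (X : SimpleGraph V) (y x : V) : Prop :=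
  ∃ t, X.ClosedAdj y t ∧ ¬ X.ClosedAdj x t ∧ X.twinCard t = 1

/-- Of two adjacent vertices `x` and `y` of a power graph that are neither twins nor dominating,
this singles out the one that generates the larger cyclic subgroup. -/
def SimpleGraph.Above (X : SimpleGraph V) (y x : V) : Prop :=
  X.Separates y x ∨ (¬ X.Separates x y ∧ X.twinCard x < X.twinCard y)

variable {X : SimpleGraph V}

theorem SimpleGraph.ClosedTwins.dominates {u v : V} (h : X.ClosedTwins u v) (hu : X.Dominates u) :
    X.Dominates v := fun x => (closedTwins_iff.1 h x).1 (hu x)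

variable {G : Type*} [Group G]

theorem powerGraph_closedTwins_of_zpowers_eq {x y : G}
    (h : Subgroup.zpowers x = Subgroup.zpowers y) : (powerGraph G).ClosedTwins x y := by
  rw [SimpleGraph.closedTwins_iff]
  intro z
  rw [powerGraph_closedAdj, powerGraph_closedAdj, h, ← Subgroup.zpowers_le, h, Subgroup.zpowers_le]

theorem powerGraph_dominates_one : (powerGraph G).Dominates 1 := fun _ =>
  powerGraph_closedAdj.2 (Or.inl (one_mem _))

variable [Finite G]

theorem totient_le_twinCard (x : G) :
    Nat.totient (orderOf x) ≤ (powerGraph G).twinCard x := by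
  rw [← ncard_generators]
  exact Set.ncard_le_ncard (fun y hy => powerGraph_closedTwins_of_zpowers_eq hy.symm)
    (Set.toFinite _)

/-- A set of nontrivial elements of a cyclic group that are comparable with all its elements. -/
theorem ncard_lt_two_mul_totient {x : G} {S : Set G} (h1 : ∀ v ∈ S, v ∈ Subgroup.zpowers x)
    (h2 : ∀ v ∈ S, v ≠ 1)
    (h3 : ∀ v ∈ S, ∀ w ∈ Subgroup.zpowers x, w ∈ Subgroup.zpowers v ∨ v ∈ Subgroup.zpowers w) :
    S.ncard < 2 * Nat.totient (orderOf x) := by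
  have hpos := Nat.totient_pos.2 (orderOf_pos x)
  -- Either all members of `S` generate ⟨x⟩, and there are at most φ(o(x)) of them; or o(x) is a
  -- power of a prime p, and the absence of 1 gives |S| < o(x) ≤ 2φ(o(x)), because p ≤ 2(p - 1).
  by_cases hS : ∀ v ∈ S, x ∈ Subgroup.zpowers v
  · have : S.ncard ≤ Nat.totient (orderOf x) := by
      rw [← ncard_generators]
      exact Set.ncard_le_ncard (fun v hv => zpowers_eq_of_mem (h1 v hv) (hS v hv))
        (Set.toFinite _)
    omega
  · push Not at hS
    obtain ⟨v, hv, hne⟩ := hS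
    obtain ⟨p, k, hp, hx⟩ := orderOf_eq_prime_pow_of_comparable (h1 v hv) (h2 v hv) hne (h3 v hv)
    have hlt : S.ncard < orderOf x := by
      rw [show orderOf x = Set.ncard (Subgroup.zpowers x : Set G) from
        (Nat.card_zpowers x).symm.trans (Nat.card_coe_set_eq _)]
      exact Set.ncard_lt_ncard ⟨fun v hv => h1 v hv, fun h => h2 1 (h (one_mem _)) rfl⟩
        (Set.toFinite _)
    refine hlt.trans_le ?_
    have hk : k ≠ 0 := by
      rintro rfl
      rw [pow_zero, orderOf_eq_one_iff] at hx
      subst hx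
      exact hne (one_mem _)
    obtain ⟨k, rfl⟩ := Nat.exists_eq_succ_of_ne_zero hk
    rw [hx, Nat.totient_prime_pow_succ hp, Nat.succ_eq_add_one, pow_succ]
    have := hp.two_le
    have h4 : p ≤ 2 * (p - 1) := by omega
    nlinarith [Nat.mul_le_mul_left (p ^ k) h4]

/-- What lies between two twins is a twin of both. -/
theorem powerGraph_closedTwins_between {x y z : G} (hxy : x ∈ Subgroup.zpowers y)
    (hyz : y ∈ Subgroup.zpowers z) (h : (powerGraph G).ClosedTwins x z)
    (hx : ¬ (powerGraph G).Dominates x) : (powerGraph G).ClosedTwins x y := by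
  rw [SimpleGraph.closedTwins_iff] at h ⊢
  by_cases hz : z ∈ Subgroup.zpowers x
  · exact SimpleGraph.closedTwins_iff.1
      (powerGraph_closedTwins_of_zpowers_eq (zpowers_eq_of_mem hxy (mem_zpowers_trans hyz hz)))
  -- Its twin z being properly above it, x is comparable with everything in ⟨z⟩ and is neither
  -- trivial nor a generator. So z has prime power order and the subgroups of ⟨z⟩ form a chain.
  have hc : ∀ w ∈ Subgroup.zpowers z, w ∈ Subgroup.zpowers x ∨ x ∈ Subgroup.zpowers w :=
    fun w hw => (powerGraph_closedAdj.1 ((h w).2 (powerGraph_closedAdj.2 (Or.inr hw)))).symm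
  obtain ⟨p, k, hp, hzp⟩ := orderOf_eq_prime_pow_of_comparable (mem_zpowers_trans hxy hyz)
    (by rintro rfl; exact hx powerGraph_dominates_one) hz hc
  intro w
  constructor
  · intro hw
    rcases powerGraph_closedAdj.1 ((h w).1 hw) with h1 | h1
    · exact powerGraph_closedAdj.2 (Or.inl (mem_zpowers_trans hyz h1))
    · exact powerGraph_closedAdj.2 (comparable_of_orderOf_eq_prime_pow hp hzp hyz h1)
  · intro hw
    rcases powerGraph_closedAdj.1 hw with h1 | h1
    · exact powerGraph_closedAdj.2 (Or.inl (mem_zpowers_trans hxy h1))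
    · exact (h w).2 (powerGraph_closedAdj.2 (Or.inr (mem_zpowers_trans h1 hyz)))

/-- Suppose instead that y ∈ ⟨x⟩. A neighbour t of y that is not adjacent to x cannot lie in ⟨y⟩, so
y ∈ ⟨t⟩. As t and t⁻¹ are twins, t has order at most 2; hence y is trivial, and dominates, or
generates ⟨t⟩, and then t ∈ ⟨x⟩ after all. -/
theorem mem_zpowers_of_separates {x y : G} (h : (powerGraph G).ClosedAdj x y)
    (hy : ¬ (powerGraph G).Dominates y) (hs : (powerGraph G).Separates y x) :
    x ∈ Subgroup.zpowers y := by
  obtain ⟨t, h1, h2, h3⟩ := hs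
  refine (powerGraph_closedAdj.1 h).resolve_right fun hyx => ?_
  rw [powerGraph_closedAdj] at h1 h2
  push Not at h2
  rcases h1 with h1 | h1
  · obtain ⟨a, ha⟩ := Set.ncard_eq_one.1 h3
    have e1 : t = a := by
      have : t ∈ ({a} : Set G) := ha ▸ (rfl : (powerGraph G).ClosedTwins t t)
      exact this
    have e2 : t⁻¹ = a := by
      have : t⁻¹ ∈ ({a} : Set G) :=
        ha ▸ powerGraph_closedTwins_of_zpowers_eq Subgroup.zpowers_inv.symm
      exact this
    have e3 : t ^ 2 = 1 := by
      rw [sq, ← mul_inv_cancel t, e2, ← e1]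
    have hd : orderOf y ∣ 2 := (orderOf_dvd_of_mem_zpowers h1).trans
      (orderOf_dvd_of_pow_eq_one e3)
    rcases (Nat.dvd_prime Nat.prime_two).1 hd with h4 | h4
    · rw [orderOf_eq_one_iff] at h4
      exact hy (h4 ▸ powerGraph_dominates_one)
    · have : t ∈ Subgroup.zpowers y := mem_zpowers_of_orderOf_le h1
        (by rw [h4]; exact Nat.le_of_dvd two_pos (orderOf_dvd_of_pow_eq_one e3))
      exact h2.2 (mem_zpowers_trans this hyx)
  · exact h2.2 (mem_zpowers_trans h1 hyx)

/-- Twins are adjacent and therefore comparable, so the twin of largest order contains all others.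
-/
theorem exists_top_twin (x : G) : ∃ z, (powerGraph G).ClosedTwins x z ∧
    ∀ v, (powerGraph G).ClosedTwins x v → v ∈ Subgroup.zpowers z := by
  obtain ⟨z, hz, hmax⟩ := Set.exists_max_image {v | (powerGraph G).ClosedTwins x v} orderOf
    (Set.toFinite _) ⟨x, rfl⟩
  refine ⟨z, hz, fun v hv => ?_⟩
  rcases powerGraph_closedAdj.1 ((SimpleGraph.ClosedTwins.symm hv).trans hz).closedAdj with h | h
  · exact h
  · exact mem_zpowers_of_orderOf_le h (hmax v hv)

theorem two_mul_totient_le {d m : ℕ} (hm : 3 ≤ m) :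
    2 * Nat.totient d ≤ Nat.totient (d * m) := by
  have h1 := Nat.totient_super_multiplicative d m
  have h2 : 2 ≤ Nat.totient m := by
    have := (Nat.totient_even (by omega : 2 < m)).two_dvd
    exact Nat.le_of_dvd (Nat.totient_pos.2 (by omega)) this
  nlinarith

/-- Where separation fails to reveal the larger of two subgroups, counting twins succeeds. With z
the top twin of x, the element y lies properly above z, since anything between twins is a twin. The
number 2φ(o(z)) then separates the two twin counts. -/
theorem twinCard_lt {x y : G} (h : x ∈ Subgroup.zpowers y)
    (ht : ¬ (powerGraph G).ClosedTwins x y) (hx : ¬ (powerGraph G).Dominates x)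
    (hs : ¬ (powerGraph G).Separates y x) :
    (powerGraph G).twinCard x < (powerGraph G).twinCard y := by
  obtain ⟨z, hxz, htop⟩ := exists_top_twin x
  have hne1 : ∀ v, (powerGraph G).ClosedTwins x v → v ≠ 1 := by
    rintro v hv rfl
    exact hx (SimpleGraph.ClosedTwins.dominates hv.symm powerGraph_dominates_one)
  have hcx : ∀ w, (powerGraph G).ClosedAdj x w ↔ (powerGraph G).ClosedAdj z w :=
    SimpleGraph.closedTwins_iff.1 hxz
  have hyz : y ∉ Subgroup.zpowers z := fun hyz => ht (powerGraph_closedTwins_between h hyz hxz hx)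
  have hzy : z ∈ Subgroup.zpowers y :=
    (powerGraph_closedAdj.1 ((hcx y).1 (powerGraph_closedAdj.2 (Or.inl h)))).resolve_right hyz
  -- The twins of x are nontrivial elements of ⟨z⟩ comparable with everything in it. What remains is
  -- 2φ(o(z)) ≤ φ(o(y)), to be read off from the index m = o(y) / o(z).
  refine (ncard_lt_two_mul_totient htop hne1 fun v hv w hw => ?_).trans_le
    (le_trans ?_ (totient_le_twinCard y))
  · exact (powerGraph_closedAdj.1 ((SimpleGraph.closedTwins_iff.1 (hv.symm.trans hxz) w).2
      (powerGraph_closedAdj.2 (Or.inr hw)))).symm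
  obtain ⟨m, hm⟩ := orderOf_dvd_of_mem_zpowers hzy
  have hm0 : m ≠ 0 := by rintro rfl; have := orderOf_pos y; omega
  have hm1 : m ≠ 1 := by
    rintro rfl
    exact hyz (mem_zpowers_of_orderOf_le hzy (by omega))
  rw [hm]
  obtain rfl | hm3 : m = 2 ∨ 3 ≤ m := by omega
  swap
  · exact two_mul_totient_le hm3
  rcases Nat.even_or_odd (orderOf z) with he | ho
  · rw [mul_comm _ 2, Nat.totient_two_mul_of_even he]
  -- The exceptional case: m = 2 and o(z) is odd, where φ(o(y)) = φ(o(z)). The involution t of ⟨y⟩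
  -- is not adjacent to z, hence not to x, and it will turn out to have no twins, against the
  -- assumption that y does not separate.
  exfalso
  have hz1 : orderOf z ≠ 1 := by rw [Ne, orderOf_eq_one_iff]; exact hne1 z hxz
  obtain ⟨t, hty, ht2⟩ := exists_mem_zpowers_orderOf_eq y (hm ▸ dvd_mul_left 2 (orderOf z))
  have hzt : ¬ (powerGraph G).ClosedAdj z t := by
    rw [powerGraph_closedAdj]
    rintro (h1 | h1)
    · have := (Nat.dvd_prime Nat.prime_two).1 (ht2 ▸ orderOf_dvd_of_mem_zpowers h1)
      rcases this with h2 | h2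
      · exact hz1 h2
      · rw [h2] at ho; exact absurd ho (by decide)
    · have := orderOf_dvd_of_mem_zpowers h1
      rw [ht2] at this
      exact (Nat.not_even_iff_odd.2 ho) (even_iff_two_dvd.2 this)
  refine hs ⟨t, powerGraph_closedAdj.2 (Or.inr hty), fun h => hzt ((hcx t).1 h), ?_⟩
  -- A twin v ≠ t would lie properly above t and thus have order a power of 2. Like t it is adjacent
  -- to y, whose order is twice an odd number: v ∈ ⟨y⟩ forces o(v) to divide 2, and y ∈ ⟨v⟩ forces
  -- o(z) = 1.
  refine Set.ncard_eq_one.2 ⟨t, Set.eq_singleton_iff_unique_mem.2 ⟨rfl, fun v hv => ?_⟩⟩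
  have hv1 : v ≠ 1 := by
    rintro rfl
    exact hzt (SimpleGraph.ClosedAdj.symm
      (SimpleGraph.ClosedTwins.dominates (SimpleGraph.ClosedTwins.symm hv)
        powerGraph_dominates_one z))
  have hsmall : v ∈ Subgroup.zpowers t → v = t := by
    intro hvt
    by_contra hne
    have hsq : t ^ (2 : ℤ) = 1 := by
      have : t ^ 2 = 1 := by rw [← ht2, pow_orderOf_eq_one]
      exact_mod_cast this
    obtain ⟨k, hk⟩ := Subgroup.mem_zpowers_iff.1 hvt
    rcases Int.even_or_odd' k with ⟨j, rfl | rfl⟩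
    · apply hv1
      rw [← hk, zpow_mul, hsq, one_zpow]
    · apply hne
      rw [← hk, zpow_add, zpow_mul, hsq, one_zpow, one_mul, zpow_one]
  rcases powerGraph_closedAdj.1 (SimpleGraph.ClosedTwins.closedAdj hv) with h1 | h1
  swap
  · exact hsmall h1
  by_contra hne
  have hvt : v ∉ Subgroup.zpowers t := fun h => hne (hsmall h)
  have hcv := SimpleGraph.closedTwins_iff.1 hv
  obtain ⟨p, k, hp, hvp⟩ := orderOf_eq_prime_pow_of_comparable h1
    (by rintro rfl; simp at ht2) hvt fun w hw =>
      (powerGraph_closedAdj.1 ((hcv w).2 (powerGraph_closedAdj.2 (Or.inr hw)))).symm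
  have h2v : 2 ∣ orderOf v := ht2 ▸ orderOf_dvd_of_mem_zpowers h1
  obtain rfl : 2 = p := (Nat.prime_dvd_prime_iff_eq Nat.prime_two hp).1
    (Nat.prime_two.dvd_of_dvd_pow (hvp ▸ h2v))
  have hcop : ∀ j, Nat.Coprime (2 ^ j) (orderOf z) := fun j =>
    Nat.Coprime.pow_left j (Nat.coprime_two_left.2 ho)
  rcases powerGraph_closedAdj.1 ((hcv y).1 (powerGraph_closedAdj.2 (Or.inl hty))) with h2 | h2
  · have h3 := orderOf_dvd_of_mem_zpowers h2
    rw [hm, hvp] at h3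
    have h4 : orderOf v ∣ orderOf t := by
      rw [hvp, ht2]
      exact (hcop k).dvd_of_dvd_mul_left h3
    exact hvt (mem_zpowers_of_orderOf_dvd h2 hty h4)
  · have h3 := orderOf_dvd_of_mem_zpowers h2
    rw [hm, hvp] at h3
    exact hz1 ((hcop k).symm.eq_one_of_dvd ((dvd_mul_right _ 2).trans h3))

theorem powerGraph_above_iff {x y : G} (h : (powerGraph G).ClosedAdj x y)
    (ht : ¬ (powerGraph G).ClosedTwins x y) (hx : ¬ (powerGraph G).Dominates x)
    (hy : ¬ (powerGraph G).Dominates y) :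
    (powerGraph G).Above y x ↔ x ∈ Subgroup.zpowers y := by
  constructor
  · rintro (hs | ⟨hs, hlt⟩)
    · exact mem_zpowers_of_separates h hy hs
    · refine (powerGraph_closedAdj.1 h).resolve_right fun hyx => ?_
      exact hlt.asymm (twinCard_lt hyx (fun h => ht h.symm) hy hs)
  · intro hxy
    by_cases hs : (powerGraph G).Separates y x
    · exact Or.inl hs
    · refine Or.inr ⟨fun hs' => ?_, twinCard_lt hxy ht hx hs⟩
      exact ht (powerGraph_closedTwins_of_zpowers_eq
        (zpowers_eq_of_mem hxy (mem_zpowers_of_separates h.symm hx hs')))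

/-- In a nontrivial cyclic group the φ(|G|) generators and the identity dominate. Otherwise let x be
a dominating element of largest order: the dominating elements lie in ⟨x⟩ and number at most
2φ(o(x)), identity included. Every y outside ⟨x⟩ satisfies x ∈ ⟨y⟩. So for |G| = 2 o(x) such a y
would generate G, while an index of at least 3 gives φ(|G|) ≥ 2φ(o(x)). The trivial group needs its
own clause because its generator is the identity. -/
theorem powerGraph_cyclic_iff : (∃ g : G, ∀ x, x ∈ Subgroup.zpowers g) ↔
    Nat.card G = 1 ∨
      Nat.totient (Nat.card G) < Set.ncard {v | (powerGraph G).Dominates v} := by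
  have hcard : ∀ {g : G}, orderOf g = Nat.card G → ∀ x, x ∈ Subgroup.zpowers g := by
    intro g hg x
    have : Subgroup.zpowers g = ⊤ := by
      rw [← Subgroup.card_eq_iff_eq_top, Nat.card_zpowers, hg]
    rw [this]; trivial
  constructor
  · rintro ⟨g, hg⟩
    have ho : orderOf g = Nat.card G := by
      rw [← Nat.card_zpowers, Subgroup.card_eq_iff_eq_top, Subgroup.eq_top_iff']
      exact hg
    by_cases h1 : Nat.card G = 1
    · exact Or.inl h1
    · right
      rw [← ho, ← ncard_generators]
      refine Set.ncard_lt_ncard ⟨fun y hy x => ?_, fun h => ?_⟩ (Set.toFinite _)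
      · exact powerGraph_closedAdj.2 (Or.inr ((show Subgroup.zpowers y = _ from hy) ▸ hg x))
      · have h2 : Subgroup.zpowers (1 : G) = Subgroup.zpowers g := h powerGraph_dominates_one
        have h3 : orderOf g = 1 := by
          rw [← Nat.card_zpowers, ← h2, Nat.card_zpowers, orderOf_one]
        exact h1 (ho ▸ h3)
  · rintro (h1 | hlt)
    · exact ⟨1, hcard (by rw [orderOf_one, h1])⟩
    obtain ⟨x, hx, hmax⟩ := Set.exists_max_image {v | (powerGraph G).Dominates v} orderOf
      (Set.toFinite _) ⟨1, powerGraph_dominates_one⟩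
    by_contra hcyc
    push Not at hcyc
    have hsub : ∀ v, (powerGraph G).Dominates v → v ∈ Subgroup.zpowers x := fun v hv => by
      rcases powerGraph_closedAdj.1 (hx v) with h | h
      · exact mem_zpowers_of_orderOf_le h (hmax v hv)
      · exact h
    have hle : Set.ncard {v | (powerGraph G).Dominates v} ≤ 2 * Nat.totient (orderOf x) := by
      have := ncard_lt_two_mul_totient (x := x) (S := {v | (powerGraph G).Dominates v} \ {1})
        (fun v hv => hsub v hv.1) (fun v hv => hv.2)
        (fun v hv w _ => (powerGraph_closedAdj.1 (hv.1 w)).symm)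
      rw [Set.ncard_sdiff_singleton_of_mem
        (show (1 : G) ∈ {v | (powerGraph G).Dominates v} from powerGraph_dominates_one)] at this
      omega
    obtain ⟨m, hm⟩ := orderOf_dvd_natCard x
    have hpos : 0 < Nat.card G := Nat.card_pos
    obtain ⟨y, hy⟩ := hcyc x
    have hxy : x ∈ Subgroup.zpowers y := (powerGraph_closedAdj.1 (hx y)).resolve_right hy
    obtain rfl | rfl | rfl | hm3 : m = 0 ∨ m = 1 ∨ m = 2 ∨ 3 ≤ m := by omega
    · omega
    · exact hy (hcard (by omega) y)
    · obtain ⟨j, hj⟩ := orderOf_dvd_of_mem_zpowers hxy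
      have hdvd : orderOf x * j ∣ orderOf x * 2 := hj ▸ hm ▸ orderOf_dvd_natCard y
      rcases (Nat.dvd_prime Nat.prime_two).1
        (Nat.dvd_of_mul_dvd_mul_left (orderOf_pos x) hdvd) with rfl | rfl
      · exact hy (mem_zpowers_of_orderOf_le hxy (by omega))
      · obtain ⟨z, hz⟩ := hcyc y
        exact hz (hcard (by omega) z)
    · have := two_mul_totient_le (d := orderOf x) hm3
      rw [← hm] at this
      omega

/-- The vertices of the power graph that are closed twins of generators of maximal cyclic
subgroups. -/
theorem powerGraph_top_iff {v : G} :
    (((Nat.card G = 1 ∨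
        Nat.totient (Nat.card G) < Set.ncard {v | (powerGraph G).Dominates v}) ∧
        (powerGraph G).Dominates v) ∨
      (¬ (Nat.card G = 1 ∨
        Nat.totient (Nat.card G) < Set.ncard {v | (powerGraph G).Dominates v}) ∧
        ¬ (powerGraph G).Dominates v ∧ ∀ y, (powerGraph G).ClosedAdj v y →
          ¬ (powerGraph G).Dominates y → ¬ (powerGraph G).ClosedTwins v y →
          ¬ (powerGraph G).Above y v)) ↔
    ∃ g, IsMaxGenerator g ∧ (powerGraph G).ClosedTwins v g := by
  rw [← powerGraph_cyclic_iff]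
  by_cases hc : ∃ g : G, ∀ x, x ∈ Subgroup.zpowers g
  · simp only [hc, true_and, not_true_eq_false, false_and, or_false]
    obtain ⟨g, hg⟩ := hc
    have hdom : ∀ k : G, g ∈ Subgroup.zpowers k → (powerGraph G).Dominates k := fun k hk x =>
      powerGraph_closedAdj.2 (Or.inr (mem_zpowers_trans (hg x) hk))
    constructor
    · intro hv
      refine ⟨g, fun h _ => hg h, SimpleGraph.closedTwins_iff.2 fun x => ?_⟩
      exact iff_of_true (hv x) (hdom g (Subgroup.mem_zpowers g) x)
    · rintro ⟨k, hk, ht⟩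
      exact SimpleGraph.ClosedTwins.dominates ht.symm (hdom k (hk g (hg k)))
  · simp only [hc, not_false_eq_true, true_and, false_and, false_or]
    have hdom : ∀ g : G, IsMaxGenerator g → ¬ (powerGraph G).Dominates g := fun g hg h =>
      hc ⟨g, fun x => (powerGraph_detects g hg x).1 (h x)⟩
    constructor
    · rintro ⟨h1, h2⟩
      obtain ⟨g, hg, hv⟩ := exists_isMaxGenerator v
      refine ⟨g, hg, by_contra fun ht => ?_⟩
      have hadj : (powerGraph G).ClosedAdj v g := powerGraph_closedAdj.2 (Or.inl hv)
      exact h2 g hadj (hdom g hg) ht ((powerGraph_above_iff hadj ht h1 (hdom g hg)).2 hv)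
    · rintro ⟨g, hg, ht⟩
      have h1 : ¬ (powerGraph G).Dominates v := fun h =>
        hdom g hg (SimpleGraph.ClosedTwins.dominates ht h)
      -- A vertex y above v lies in ⟨g⟩, that is, between v and its twin g, and is therefore a twin
      -- of v.
      refine ⟨h1, fun y hy hy1 hy2 hab => hy2 ?_⟩
      have hvy := (powerGraph_above_iff hy hy2 h1 hy1).1 hab
      exact powerGraph_closedTwins_between hvy ((powerGraph_detects g hg y).1
        ((SimpleGraph.closedTwins_iff.1 ht y).1 hy)) ht h1

end Orientation

/-! ## The reductions in terms of cyclic subgroups -/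

section TwinClass

variable {G : Type*} [Group G]

/-- The closed out-neighbourhood of an element is the cyclic subgroup it generates, and this also
determines the in-neighbourhood. So the vertices of the first three reductions are the cyclic
subgroups. -/
theorem twinClass_eq_iff {a b : G} :
    twinClass a = twinClass b ↔ Subgroup.zpowers a = Subgroup.zpowers b := by
  have h : twinClass a = twinClass b ↔
      (coloredDirectedPowerGraph G).toDigraph.closedTwinSetoid.r a b := Quotient.eq
  rw [h]
  have ho : ∀ u : G, insert u {w | (directedPowerGraph G).Adj u w} = Subgroup.zpowers u := by
    intro u
    rw [insert_outNeighbors]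
    ext w
    exact directedPowerGraph_adj
  have hi : ∀ u : G, insert u {w | (directedPowerGraph G).Adj w u} =
      {w | u ∈ Subgroup.zpowers w} := by
    intro u
    ext w
    simp only [Set.mem_insert_iff, Set.mem_ofPred_eq, directedPowerGraph_adj,
      or_iff_right_iff_imp]
    rintro rfl
    exact Subgroup.mem_zpowers w
  constructor
  · rintro ⟨h1, -⟩
    have h2 : insert a {w | (directedPowerGraph G).Adj a w} =
      insert b {w | (directedPowerGraph G).Adj b w} := h1
    rw [ho, ho] at h2
    exact SetLike.coe_injective h2
  · intro e
    refine ⟨(ho a).trans (e ▸ (ho b).symm), (hi a).trans (Eq.trans ?_ (hi b).symm)⟩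
    ext w
    simp only [Set.mem_ofPred_eq, ← Subgroup.zpowers_le, e]

theorem twinClass_surjective : Function.Surjective (twinClass : G → TwinClass G) :=
  Quotient.mk_surjective

namespace TwinClass

/-- The cyclic subgroup generated by the elements of a twin class. -/
noncomputable def zpowers (A : TwinClass G) : Subgroup G :=
  Quotient.lift Subgroup.zpowers
    (fun a b h => twinClass_eq_iff.1 (Quotient.sound h : twinClass a = twinClass b)) A

@[simp]
theorem zpowers_twinClass (a : G) : zpowers (twinClass a) = Subgroup.zpowers a := rfl

theorem zpowers_injective : Function.Injective (zpowers : TwinClass G → Subgroup G) := by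
  intro A B h
  obtain ⟨a, rfl⟩ := twinClass_surjective A
  obtain ⟨b, rfl⟩ := twinClass_surjective B
  exact twinClass_eq_iff.2 h

theorem zpowers_inj {A B : TwinClass G} : A.zpowers = B.zpowers ↔ A = B :=
  zpowers_injective.eq_iff

/-- The order of the cyclic subgroup. -/
noncomputable def card (A : TwinClass G) : ℕ := Nat.card A.zpowers

theorem card_twinClass (a : G) : (twinClass a).card = orderOf a := Nat.card_zpowers a

instance [Finite G] : Finite (TwinClass G) := Finite.of_surjective _ twinClass_surjective

theorem exists_zpowers_eq_inf (A B : TwinClass G) :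
    ∃ C : TwinClass G, C.zpowers = A.zpowers ⊓ B.zpowers := by
  obtain ⟨a, rfl⟩ := twinClass_surjective A
  have : IsCyclic ((twinClass a).zpowers ⊓ B.zpowers : Subgroup G) := by
    have h : (twinClass a).zpowers ⊓ B.zpowers ≤ Subgroup.zpowers a := inf_le_left
    exact isCyclic_of_injective (Subgroup.inclusion h) (Subgroup.inclusion_injective h)
  obtain ⟨c, hc⟩ := (Subgroup.isCyclic_iff_exists_zpowers_eq_top _).1 this
  exact ⟨twinClass c, hc⟩

section

variable [Finite G] {A B C : TwinClass G}

theorem card_pos (A : TwinClass G) : 0 < A.card := Nat.card_pos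

theorem card_lt (h : A.zpowers < B.zpowers) : A.card < B.card :=
  Set.ncard_lt_ncard h (Set.toFinite _)

theorem card_le (h : A.zpowers ≤ B.zpowers) : A.card ≤ B.card :=
  Set.ncard_le_ncard h (Set.toFinite _)

theorem card_le_natCard (A : TwinClass G) : A.card ≤ Nat.card G :=
  Nat.card_le_card_of_injective _ Subtype.val_injective

theorem zpowers_le_iff_dvd (h : A.zpowers ≤ C.zpowers) (h' : B.zpowers ≤ C.zpowers) :
    A.zpowers ≤ B.zpowers ↔ A.card ∣ B.card := by
  obtain ⟨a, rfl⟩ := twinClass_surjective A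
  obtain ⟨b, rfl⟩ := twinClass_surjective B
  obtain ⟨c, rfl⟩ := twinClass_surjective C
  rw [card_twinClass, card_twinClass]
  simp only [zpowers_twinClass, Subgroup.zpowers_le] at *
  exact mem_zpowers_iff_orderOf_dvd h h'

theorem exists_card_eq {d : ℕ} (h : d ∣ A.card) :
    ∃ B : TwinClass G, B.zpowers ≤ A.zpowers ∧ B.card = d := by
  obtain ⟨a, rfl⟩ := twinClass_surjective A
  rw [card_twinClass] at h
  obtain ⟨b, hb, hd⟩ := exists_mem_zpowers_orderOf_eq a h
  exact ⟨twinClass b, by simpa using hb, by rw [card_twinClass, hd]⟩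

theorem card_dvd (h : A.zpowers ≤ B.zpowers) : A.card ∣ B.card :=
  (zpowers_le_iff_dvd h le_rfl).1 h

end

end TwinClass

/-- `C` is a maximal proper cyclic subgroup of `A`. -/
def TwinClass.IsCover (C A : TwinClass G) : Prop :=
  C.zpowers < A.zpowers ∧ ∀ B : TwinClass G, ¬ (C.zpowers < B.zpowers ∧ B.zpowers < A.zpowers)

theorem reductionOne_adj {A B : TwinClass G} :
    (reductionOne G).Adj A B ↔ B.zpowers ≤ A.zpowers := by
  constructor
  · rintro ⟨a, b, rfl, rfl, h⟩
    exact Subgroup.zpowers_le.2 (directedPowerGraph_adj.1 h)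
  · intro h
    obtain ⟨a, rfl⟩ := twinClass_surjective A
    obtain ⟨b, rfl⟩ := twinClass_surjective B
    exact ⟨a, b, rfl, rfl, directedPowerGraph_adj.2 (Subgroup.zpowers_le.1 h)⟩

theorem reductionThree_color (A : TwinClass G) : (reductionThree G).color A = A.card := by
  obtain ⟨a, rfl⟩ := twinClass_surjective A
  show Set.ncard {w | (directedPowerGraph G).Adj a w} = _
  rw [TwinClass.card, TwinClass.zpowers_twinClass]
  simp only [directedPowerGraph_adj]
  exact (Nat.card_coe_set_eq _).symm

theorem reductionTwo_adj {A C : TwinClass G} :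
    (reductionTwo G).Adj A C ↔ TwinClass.IsCover C A := by
  have h : ∀ A C : TwinClass G, (A ≠ C ∧ (reductionOne G).Adj A C) ↔ C.zpowers < A.zpowers := by
    intro A C
    rw [reductionOne_adj, lt_iff_le_and_ne, Ne, Ne, TwinClass.zpowers_inj, and_comm, eq_comm]
  show ((A ≠ C ∧ (reductionOne G).Adj A C) ∧ ¬ ∃ B, (A ≠ B ∧ (reductionOne G).Adj A B) ∧
    (B ≠ C ∧ (reductionOne G).Adj B C)) ↔ _
  simp only [h, not_exists, TwinClass.IsCover, and_comm]

theorem reductionThree_adj {A C : TwinClass G} :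
    (reductionThree G).Adj A C ↔ TwinClass.IsCover A C ∨ TwinClass.IsCover C A := by
  show (SimpleGraph.fromRel (reductionTwo G).Adj).Adj A C ↔ _
  rw [SimpleGraph.fromRel_adj, reductionTwo_adj, reductionTwo_adj, or_comm]
  refine ⟨And.right, fun h => ⟨?_, h⟩⟩
  rintro rfl
  exact h.elim (fun h => lt_irrefl _ h.1) fun h => lt_irrefl _ h.1

theorem reductionFour_color_inl (A : CCVertex G) :
    (reductionFour G).color (Sum.inl A) = A.1.card := reductionThree_color A.1

variable [Finite G]

/-- The orders restore the directions that were removed from the Hasse diagram. -/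
theorem reductionThree_adj_and_color_lt {A C : TwinClass G} :
    ((reductionThree G).Adj A C ∧ (reductionThree G).color C < (reductionThree G).color A) ↔
      TwinClass.IsCover C A := by
  rw [reductionThree_adj, reductionThree_color, reductionThree_color]
  constructor
  · rintro ⟨h | h, hlt⟩
    · exact absurd (TwinClass.card_lt h.1) hlt.asymm
    · exact h
  · exact fun h => ⟨Or.inr h, TwinClass.card_lt h.1⟩

theorem TwinClass.exists_isCover {A B : TwinClass G} (h : B.zpowers < A.zpowers) :
    ∃ C : TwinClass G, B.zpowers ≤ C.zpowers ∧ C.IsCover A := by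
  obtain ⟨C, ⟨h1, h2⟩, hmax⟩ := Set.exists_max_image
    {C : TwinClass G | B.zpowers ≤ C.zpowers ∧ C.zpowers < A.zpowers} TwinClass.card
    (Set.toFinite _) ⟨B, le_rfl, h⟩
  exact ⟨C, h1, h2, fun D ⟨h3, h4⟩ =>
    (TwinClass.card_lt h3).not_ge (hmax D ⟨h1.trans h3.le, h4⟩)⟩

/-- In a finite partial order the covering relation generates the order, so `Des` is a principal
down-set. The induction descends through a cover below `A`. -/
theorem reductionThree_des (A : TwinClass G) :
    (reductionThree G).Des A = {B | B.zpowers ≤ A.zpowers} := by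
  ext B
  simp only [ColoredGraph.Des, reductionThree_adj_and_color_lt, Set.mem_ofPred_eq]
  constructor
  · intro h
    induction h with
    | refl => exact le_rfl
    | tail _ h ih => exact h.1.le.trans ih
  · intro h
    generalize hn : A.card = n
    induction n using Nat.strong_induction_on generalizing A with
    | _ n ih =>
      rcases h.eq_or_lt with e | hlt
      · rw [TwinClass.zpowers_inj.1 e]
      · obtain ⟨C, h1, h2⟩ := TwinClass.exists_isCover hlt
        exact .head h2 (ih _ (hn ▸ TwinClass.card_lt h2.1) C h1 rfl)

/-- The intersection of cyclic subgroups is cyclic, hence itself a vertex and the greatest element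
of the common down-set. The supremum is therefore attained. -/
theorem reductionFour_color_inr (A B : CCVertex G) (h : ¬ s(A, B).IsDiag) :
    (reductionFour G).color (Sum.inr ⟨s(A, B), h⟩) =
      Nat.card (A.1.zpowers ⊓ B.1.zpowers : Subgroup G) := by
  obtain ⟨C, hC⟩ := A.1.exists_zpowers_eq_inf B.1
  have e : {c | ∃ v, (∀ g ∈ s(A, B), v ∈ (reductionThree G).Des g.1) ∧
      c = (reductionThree G).color v} = {c | ∃ v : TwinClass G, v.zpowers ≤ C.zpowers ∧
        c = v.card} := by
    ext c
    simp only [Sym2.mem_iff, forall_eq_or_imp, forall_eq, reductionThree_des, Set.mem_ofPred_eq,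
      reductionThree_color, hC, le_inf_iff]
  show sSup {c | ∃ v, (∀ g ∈ s(A, B), v ∈ (reductionThree G).Des g.1) ∧
      c = (reductionThree G).color v} = _
  rw [e, ← hC]
  refine IsGreatest.csSup_eq ⟨⟨C, le_rfl, rfl⟩, ?_⟩
  rintro _ ⟨v, hv, rfl⟩
  exact TwinClass.card_le hv

end TwinClass

/-! ## Output of graphs -/

namespace World

variable {w : World} {R : ℕ → Prop} {r : ℕ → ℕ → Prop} {col : ℕ → ℕ} {s : RamState}

/-- The coloured graph `Z` is a copy of the graph with vertex set `R`, adjacency `r` and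
colours `col`. -/
def Presents (w : World) (R : ℕ → Prop) (r : ℕ → ℕ → Prop) (col : ℕ → ℕ) {V : Type*}
    (Z : ColoredGraph V) : Prop :=
  ∃ φ : V → ℕ, Function.Injective φ ∧ (∀ c, (∃ a, φ a = c) ↔ c < w.base ^ 2 ∧ R c) ∧
    (∀ a b, r (φ a) (φ b) ↔ Z.Adj a b) ∧ ∀ a, col (φ a) = Z.color a

/-- A single output is isomorphic to every coloured graph that the world presents. This uniformity
over all groups that may have produced the input is needed later for the isomorphism test. Existence
of one such graph ensures that the written relation is symmetric and irreflexive. -/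
theorem Roomy.holds_coloredGraph (h : w.Roomy) (hs : Represents s (w.emit R r col))
    (hZ : ∃ (V : Type) (Z : ColoredGraph V), w.Presents R r col Z) :
    ∃ (k : ℕ) (Y : ColoredGraph (Fin k)), s.Holds (encodeColoredGraph Y) ∧
      ∀ (V : Type) (Z : ColoredGraph V), w.Presents R r col Z → Y.IsIso Z := by
  obtain ⟨V₀, Z₀, φ₀, hφ₀, hR₀, hr₀, hc₀⟩ := hZ
  obtain ⟨σ₀, hσ₀⟩ := h.exists_equiv hφ₀ hR₀
  refine ⟨_, ⟨Z₀.toSimpleGraph.comap σ₀, fun i => Z₀.color (σ₀ i)⟩, ?_, ?_⟩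
  · have := h.holds_emit hs
    simp only [← hσ₀, hr₀, hc₀] at this
    exact this
  · rintro V Z ⟨φ, hφ, hR, hr, hc⟩
    obtain ⟨σ, hσ⟩ := h.exists_equiv hφ hR
    refine ⟨⟨σ, fun {i j} => ?_⟩, fun i => ?_⟩
    · rw [← hr, hσ, hσ, ← hσ₀, ← hσ₀, hr₀]
      rfl
    · show Z.color (σ i) = Z₀.color (σ₀ i)
      rw [← hc, hσ, ← hσ₀, hc₀]

theorem Roomy.holds_digraph (h : w.Roomy) (hs : Represents s (w.emit R r col)) :
    ∃ (k : ℕ) (D : Digraph (Fin k)), s.Holds (encodeDigraph D) ∧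
      ∀ (V : Type) (E : Digraph V) (φ : V → ℕ), Function.Injective φ →
        (∀ c, (∃ a, φ a = c) ↔ c < w.base ^ 2 ∧ R c) → (∀ a b, r (φ a) (φ b) ↔ E.Adj a b) →
        D.IsIso E := by
  refine ⟨w.count w.pairs R, ⟨fun i j => r (w.nth R i) (w.nth R j)⟩, ?_, ?_⟩
  · have := h.holds_emit hs
    rw [RamState.holds_three] at this
    exact RamState.holds_two.2 ⟨this.1, this.2.1⟩
  · intro V E φ hφ hR hr
    obtain ⟨σ, hσ⟩ := h.exists_equiv hφ hR
    refine ⟨σ, fun {i j} => ?_⟩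
    rw [← hr, hσ, hσ]

end World

/-! ## Covering cycles -/

namespace World

variable (w : World)

/-- Closed neighbourhoods. -/
def ClosedAdj (u v : ℕ) : Prop := u = v ∨ w.Adj u v

/-- Closed twins. -/
def Twins (u v : ℕ) : Prop := w.All w.order fun x => w.ClosedAdj u x ↔ w.ClosedAdj v x

/-- Dominating vertices. -/
def Dominates (v : ℕ) : Prop := w.All w.order fun x => w.ClosedAdj v x

/-- The number of closed twins. -/
noncomputable def twinCard (v : ℕ) : ℕ := w.count w.order fun u => w.Twins v u

/-- See `SimpleGraph.Separates`. -/
def Separates (y x : ℕ) : Prop :=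
  w.Ex w.order fun t => w.ClosedAdj y t ∧ ¬ w.ClosedAdj x t ∧ w.twinCard t = 1

/-- See `SimpleGraph.Above`. -/
def Above (y x : ℕ) : Prop :=
  w.Separates y x ∨ (¬ w.Separates x y ∧ w.twinCard x < w.twinCard y)

/-- Divisibility of numbers. -/
def Dvd (d k : ℕ) : Prop := w.Ex (k + 1) fun q => w.mul q d = k

/-- Euler's function. -/
noncomputable def totient (n : ℕ) : ℕ :=
  w.count n fun k => w.All (n + 1) fun d => w.Dvd d n → w.Dvd d k → d = 1

/-- The criterion for power graphs of cyclic groups. -/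
def Cyclic : Prop := w.order = 1 ∨ w.totient w.order < w.count w.order fun v => w.Dominates v

/-- In a power graph: twins of generators of maximal cyclic subgroups. -/
def PowerTop (v : ℕ) : Prop :=
  (w.Cyclic ∧ w.Dominates v) ∨ (¬ w.Cyclic ∧ ¬ w.Dominates v ∧ w.All w.order fun y =>
    w.ClosedAdj v y → ¬ w.Dominates y → ¬ w.Twins v y → ¬ w.Above y v)

/-- In an enhanced power graph: twins of generators of maximal cyclic subgroups. -/
def EnhancedTop (v : ℕ) : Prop :=
  w.All w.order fun x => w.ClosedAdj v x → w.All w.order fun y => w.ClosedAdj v y →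
    w.ClosedAdj x y

/-- The first element with property `top` of a twin class. -/
def FirstTwin (top : ℕ → Prop) (v : ℕ) : Prop := top v ∧ w.All v fun u => ¬ w.Twins u v

end World

section Instances

variable {F G : World → (ℕ → ℕ) → ℕ} [hF : Evaluable F] [hG : Evaluable G]

theorem Decides.closedAdj_base : Decides fun w e => w.ClosedAdj (e 0) (e 1) := by
  unfold World.ClosedAdj; infer_instance

instance Decides.closedAdj : Decides fun w e => w.ClosedAdj (F w e) (G w e) :=
  comp₂ closedAdj_base hF hG

theorem Decides.twins_base : Decides fun w e => w.Twins (e 0) (e 1) := by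
  unfold World.Twins; infer_instance

instance Decides.twins : Decides fun w e => w.Twins (F w e) (G w e) := comp₂ twins_base hF hG

theorem Decides.dominates_base : Decides fun w e => w.Dominates (e 0) := by
  unfold World.Dominates; infer_instance

instance Decides.dominates : Decides fun w e => w.Dominates (F w e) := comp₁ dominates_base hF

theorem Evaluable.twinCard_base : Evaluable fun w e => w.twinCard (e 0) := by
  unfold World.twinCard; infer_instance

instance Evaluable.twinCard : Evaluable fun w e => w.twinCard (F w e) := comp₁ twinCard_base hF

theorem Decides.separates_base : Decides fun w e => w.Separates (e 0) (e 1) := by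
  unfold World.Separates; infer_instance

instance Decides.separates : Decides fun w e => w.Separates (F w e) (G w e) :=
  comp₂ separates_base hF hG

theorem Decides.above_base : Decides fun w e => w.Above (e 0) (e 1) := by
  unfold World.Above; infer_instance

instance Decides.above : Decides fun w e => w.Above (F w e) (G w e) := comp₂ above_base hF hG

theorem Decides.dvd_base : Decides fun w e => w.Dvd (e 0) (e 1) := by
  unfold World.Dvd; infer_instance

instance Decides.dvd : Decides fun w e => w.Dvd (F w e) (G w e) := comp₂ dvd_base hF hG

theorem Evaluable.totient_base : Evaluable fun w e => w.totient (e 0) := by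
  unfold World.totient; infer_instance

instance Evaluable.totient : Evaluable fun w e => w.totient (F w e) := comp₁ totient_base hF

theorem Decides.powerTop_base : Decides fun w e => w.PowerTop (e 0) := by
  unfold World.PowerTop World.Cyclic; infer_instance

theorem Decides.enhancedTop_base : Decides fun w e => w.EnhancedTop (e 0) := by
  unfold World.EnhancedTop; infer_instance

theorem Decides.firstTwin_base {top : World → ℕ → Prop} (h : Decides fun w e => top w (e 0)) :
    Decides fun w e => w.FirstTwin (top w) (e 0) := by
  unfold World.FirstTwin; infer_instance

end Instances

namespace World

variable {w : World}

theorem dvd_iff {d k : ℕ} (hk : k < w.size) : w.Dvd d k ↔ d ∣ k := by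
  rw [Dvd, World.ex_iff hk]
  constructor
  · rintro ⟨q, hq, e⟩
    rw [mul_eq (by omega)] at e
    exact ⟨q, by rw [← e, mul_comm]⟩
  · rintro ⟨q, e⟩
    by_cases hd : d = 0
    · exact ⟨0, by omega, by rw [mul_eq (by omega), e, hd]; simp⟩
    · have : q ≤ k := by rw [e]; exact Nat.le_mul_of_pos_left q (by omega)
      exact ⟨q, by omega, by rw [mul_eq (by omega), e, mul_comm]⟩

theorem totient_eq {n : ℕ} (hn : n < w.size) : w.totient n = Nat.totient n := by
  classical
  rw [totient, World.count_eq hn.le, Nat.totient_eq_card_coprime]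
  congr 1
  refine Finset.filter_congr fun k hk => ?_
  rw [Finset.mem_range] at hk
  rw [World.all_iff (by omega)]
  simp only [dvd_iff hn, dvd_iff (hk.trans hn)]
  constructor
  · intro h
    have hg := Nat.gcd_dvd_left n k
    exact h _ (Nat.lt_succ_of_le (Nat.le_of_dvd (by omega) hg)) hg (Nat.gcd_dvd_right n k)
  · intro h d _ h1 h2
    exact Nat.eq_one_of_dvd_coprimes h h1 h2

variable {V : Type*} {code : V → ℕ} {X : SimpleGraph V}

theorem Reads.closedAdj_iff (h : w.Reads code X.Adj) {a b : V} :
    w.ClosedAdj (code a) (code b) ↔ X.ClosedAdj a b := by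
  rw [ClosedAdj, SimpleGraph.ClosedAdj, h.adj_iff, h.codes.injective.eq_iff]

theorem Reads.twins_iff (h : w.Reads code X.Adj) {a b : V} :
    w.Twins (code a) (code b) ↔ X.ClosedTwins a b := by
  rw [Twins, h.codes.all_iff, SimpleGraph.closedTwins_iff]
  simp only [h.closedAdj_iff]

theorem Reads.dominates_iff (h : w.Reads code X.Adj) {a : V} :
    w.Dominates (code a) ↔ X.Dominates a := by
  rw [Dominates, h.codes.all_iff, SimpleGraph.Dominates]
  simp only [h.closedAdj_iff]

theorem Reads.twinCard_eq (h : w.Reads code X.Adj) {a : V} :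
    w.twinCard (code a) = X.twinCard a := by
  rw [twinCard, h.codes.count_eq, SimpleGraph.twinCard]
  simp only [h.twins_iff]

theorem Reads.separates_iff (h : w.Reads code X.Adj) {a b : V} :
    w.Separates (code a) (code b) ↔ X.Separates a b := by
  rw [Separates, h.codes.ex_iff, SimpleGraph.Separates]
  simp only [h.closedAdj_iff, h.twinCard_eq]

theorem Reads.above_iff (h : w.Reads code X.Adj) {a b : V} :
    w.Above (code a) (code b) ↔ X.Above a b := by
  rw [Above, SimpleGraph.Above, h.separates_iff, h.separates_iff, h.twinCard_eq, h.twinCard_eq]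

theorem Reads.powerTop_iff {G : Type*} [Group G] [Finite G] {code : G → ℕ}
    (h : w.Reads code (powerGraph G).Adj) {a : G} :
    w.PowerTop (code a) ↔ ∃ g, IsMaxGenerator g ∧ (powerGraph G).ClosedTwins a g := by
  rw [← powerGraph_top_iff, PowerTop, Cyclic, h.codes.all_iff, h.codes.count_eq,
    totient_eq (h.order_lt.trans_le h.base_le), h.dominates_iff, h.codes.card_eq]
  simp only [h.dominates_iff, h.closedAdj_iff, h.twins_iff, h.above_iff]

theorem Reads.enhancedTop_iff {G : Type*} [Group G] [Finite G] {code : G → ℕ}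
    (h : w.Reads code (enhancedPowerGraph G).Adj) {a : G} :
    w.EnhancedTop (code a) ↔
      ∃ g, IsMaxGenerator g ∧ (enhancedPowerGraph G).ClosedTwins a g := by
  rw [← enhancedPowerGraph_clique_iff, EnhancedTop, h.codes.all_iff]
  simp only [h.codes.all_iff, h.closedAdj_iff]

theorem Reads.firstTwin_iff (h : w.Reads code X.Adj) {top : ℕ → Prop} {a : V} :
    w.FirstTwin top (code a) ↔
      top (code a) ∧ ∀ b, code b < code a → ¬ X.ClosedTwins b a := by
  have hlt := h.codes.lt a
  have hle := h.codes.le_size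
  rw [FirstTwin, World.all_iff (by omega)]
  refine and_congr_right fun _ => ⟨fun hh b hb => ?_, fun hh u hu => ?_⟩
  · rw [← h.twins_iff]; exact hh _ hb
  · obtain ⟨b, rfl⟩ := (h.codes.exists_iff u).2 (by omega)
    rw [h.twins_iff]; exact hh b hu

end World

theorem World.Reads.isCCGSetUpToTwins {w : World} {G : Type*} [Group G] [Finite G]
    {X : SimpleGraph G} {code : G → ℕ} (h : w.Reads code X.Adj) (hX : X.DetectsMaxCyclic)
    {top : ℕ → Prop}
    (htop : ∀ a, top (code a) ↔ ∃ g, IsMaxGenerator g ∧ X.ClosedTwins a g) :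
    IsCCGSetUpToTwins X {a | w.FirstTwin top (code a)} := by
  simp only [h.firstTwin_iff, htop]
  refine isCCGSetUpToTwins_of_transversal hX (fun v hv => hv.1) (fun g hg => ?_)
    fun u hu v hv ht => ?_
  · obtain ⟨v, hv, hmin⟩ := h.codes.exists_least (q := fun v => X.ClosedTwins v g) ⟨g, rfl⟩
    exact ⟨v, ⟨⟨g, hg, hv⟩, fun b hb ht => hmin b hb (ht.trans hv)⟩, hv⟩
  · rcases lt_trichotomy (code u) (code v) with hlt | e | hlt
    · exact absurd ht (hv.2 u hlt)
    · exact h.codes.injective e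
    · exact absurd ht.symm (hu.2 v hlt)

theorem SimpleGraph.Iso.natCard_eq {n : ℕ} {V : Type*} {X : SimpleGraph (Fin n)}
    {Y : SimpleGraph V} (f : X ≃g Y) : Nat.card V = n := by
  rw [← Nat.card_congr f.toEquiv, Nat.card_fin]

/-- The program that finds CCG-sets, for power graphs and for enhanced power graphs. The graph is
kept. -/
theorem exists_solves_ccgSet (K : (G : Type) → [Group G] → SimpleGraph G)
    (hK : ∀ (G : Type) [Group G], (K G).DetectsMaxCyclic) (top : World → ℕ → Prop)
    (hd : Decides fun w e => top w (e 0))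
    (htop : ∀ (G : Type) [Group G] [Finite G] (w : World) (code : G → ℕ),
      w.Reads code (K G).Adj → ∀ a, top w (code a) ↔
        ∃ g, IsMaxGenerator g ∧ (K G).ClosedTwins a g) :
    ∃ (P : RamProg) (p : ℕ[X]), ∀ (n : ℕ) (X : SimpleGraph (Fin n)),
      P.Solves p n (encodeGraph X) fun output => ∃ S : Set (Fin n),
        output = encodeMarkedGraph X S ∧ ∀ (G : Type) [Group G] [Finite G] (f : X ≃g K G),
          IsCCGSetUpToTwins (K G) (f '' S) := by
  classical
  have h1 := Decides.firstTwin_base hd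
  have h2 : Evaluable fun w e => if w.FirstTwin (top w) (e 0) then 1 else 0 := inferInstance
  obtain ⟨P, p, hP⟩ := (Realizable.write (a := 2)
    (f := fun w v => if w.FirstTwin (top w) v then 1 else 0) (by simp) h2).exists_run_graph
  refine ⟨P, p, fun n X s hs => ?_⟩
  obtain ⟨t, ht, s', hr, hw, hfr⟩ := hP s
  rw [encodeGraph, RamState.holds_two, holdsWord_singleton, holdsWord_matrixWord] at hs
  rw [hs.1] at ht hw
  -- The set is fixed by the formula before any group is considered, so the same answer serves every
  -- group that the graph comes from.
  refine ⟨t, ht, s', hr, fun a ha => hfr a (by omega), _, ?_,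
    {v : Fin n | World.FirstTwin ⟨(n + 2) ^ 4, n + 2, s.arr⟩
      (top ⟨(n + 2) ^ 4, n + 2, s.arr⟩) v}, rfl, fun G _ _ f => ?_⟩
  · rw [encodeMarkedGraph, RamState.holds_three, holdsWord_singleton, holdsWord_matrixWord,
      setWord, holdsWord_ofFn, hw.2.2 0 (by simp), hw.2.2 1 (by simp), hw.2.2 2 (by simp)]
    refine ⟨hs.1, hs.2, fun i => ?_⟩
    have : (i : ℕ) < (n + 2) ^ 4 := by
      have := i.2
      exact (show (i : ℕ) < n + 2 by omega).trans_le (Nat.le_self_pow (by simp) _)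
    simp [World.write, this]
  · have hR := World.reads_of_holds hs.1 hs.2 f.toEquiv
      (fun i j => (f.map_adj_iff (v := i) (w := j)).symm) (le_refl (n + 2))
    have := hR.isCCGSetUpToTwins (hK G) (htop G _ _ hR)
    convert this using 1
    ext a
    simp only [Set.mem_image, Set.mem_ofPred_eq]
    constructor
    · rintro ⟨i, hi, rfl⟩
      have e : f.toEquiv.symm (f i) = i := f.toEquiv.symm_apply_apply i
      rwa [e]
    · intro ha
      exact ⟨f.toEquiv.symm a, ha, f.toEquiv.apply_symm_apply a⟩

/-! ## Construction of the fourth reduction -/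

section ReductionFour

variable {G : Type*} [Group G]

@[simp]
theorem reductionFour_adj_inl_inl (A B : CCVertex G) :
    ¬ (reductionFour G).Adj (Sum.inl A) (Sum.inl B) := fun h => h.2.elim id id

@[simp]
theorem reductionFour_adj_inl_inr (A : CCVertex G) (e : {e : Sym2 (CCVertex G) // ¬ e.IsDiag}) :
    (reductionFour G).Adj (Sum.inl A) (Sum.inr e) ↔ A ∈ e.1 :=
  ⟨fun h => h.2.elim id False.elim, fun h => ⟨Sum.inl_ne_inr, Or.inl h⟩⟩

@[simp]
theorem reductionFour_adj_inr_inl (A : CCVertex G) (e : {e : Sym2 (CCVertex G) // ¬ e.IsDiag}) :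
    (reductionFour G).Adj (Sum.inr e) (Sum.inl A) ↔ A ∈ e.1 :=
  ⟨fun h => h.2.elim False.elim id, fun h => ⟨Sum.inr_ne_inl, Or.inr h⟩⟩

@[simp]
theorem reductionFour_adj_inr_inr (e e' : {e : Sym2 (CCVertex G) // ¬ e.IsDiag}) :
    ¬ (reductionFour G).Adj (Sum.inr e) (Sum.inr e') := fun h => h.2.elim id id

theorem CCVertex.zpowers_injective :
    Function.Injective fun A : CCVertex G => A.1.zpowers :=
  TwinClass.zpowers_injective.comp Subtype.val_injective

theorem CCVertex.exists_isMaxGenerator [Finite G] (A : CCVertex G) :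
    ∃ g, IsMaxGenerator g ∧ A.1.zpowers = Subgroup.zpowers g := by
  obtain ⟨_, g, hg, rfl⟩ := A
  exact ⟨g, isCCGenerator_iff.1 hg, rfl⟩

/-- A CCG-set up to closed twins, indexed by the maximal cyclic subgroups. -/
theorem IsCCGSetUpToTwins.exists_index [Finite G] {X : SimpleGraph G} (hX : X.DetectsMaxCyclic)
    {S : Set G} (hS : IsCCGSetUpToTwins X S) : ∃ ι : CCVertex G → G,
      (∀ v, (∃ A, ι A = v) ↔ v ∈ S) ∧ ∀ A x, X.ClosedAdj (ι A) x ↔ x ∈ A.1.zpowers := by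
  obtain ⟨h, h1, h2, h3, h4⟩ := hS
  rw [isMinimalCyclicCover_iff] at h4
  have hmax : ∀ v ∈ S, IsMaxGenerator (h v) ∧ X.ClosedTwins v (h v) := fun v hv => by
    by_cases hc : IsCCGenerator v
    · rw [(h1 v hv).1 hc]
      exact ⟨isCCGenerator_iff.1 hc, rfl⟩
    · exact ⟨isCCGenerator_iff.1 ((h1 v hv).2 hc).1, ((h1 v hv).2 hc).2⟩
  have hex : ∀ A : CCVertex G, ∃ v ∈ S, Subgroup.zpowers (h v) = A.1.zpowers := fun A => by
    obtain ⟨g, hg, e⟩ := A.exists_isMaxGenerator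
    have : Subgroup.zpowers g ∈ (fun g : G => Subgroup.zpowers g) '' (h '' S) := by
      rw [h4]; exact ⟨g, hg, rfl⟩
    obtain ⟨_, ⟨v, hv, rfl⟩, e'⟩ := this
    exact ⟨v, hv, e'.trans e.symm⟩
  choose ι hι hιe using hex
  refine ⟨ι, fun v => ⟨?_, fun hv => ?_⟩, fun A x => ?_⟩
  · rintro ⟨A, rfl⟩
    exact hι A
  · refine ⟨⟨twinClass (h v), h v, isCCGenerator_iff.2 (hmax v hv).1, rfl⟩, ?_⟩
    exact h2 (hι _) hv (h3 ⟨_, hι _, rfl⟩ ⟨_, hv, rfl⟩ (hιe _))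
  · rw [SimpleGraph.closedTwins_iff.1 (hmax _ (hι A)).2 x, hX _ (hmax _ (hι A)).1, hιe]

end ReductionFour

namespace World

variable (w : World)

/-- The marked vertices. -/
def Marked (v : ℕ) : Prop := v < w.order ∧ w.color v ≠ 0

/-- The codes of the vertices of the fourth reduction: the pairs `(v, v)` stand for the maximal
cyclic subgroups, the pairs `(u, v)` with `u < v` for their intersections. -/
def MarkedPair (c : ℕ) : Prop :=
  w.Marked (w.fst c) ∧ w.Marked (w.snd c) ∧ w.fst c ≤ w.snd c

/-- `c` is a vertex, and `d` a pair of vertices that contains it. -/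
def Incident (c d : ℕ) : Prop :=
  w.fst c = w.snd c ∧ w.fst d < w.snd d ∧ (w.fst c = w.fst d ∨ w.fst c = w.snd d)

/-- The order of the intersection. -/
noncomputable def meetCard (c : ℕ) : ℕ :=
  w.count w.order fun x => w.ClosedAdj (w.fst c) x ∧ w.ClosedAdj (w.snd c) x

end World

section Instances

variable {F G : World → (ℕ → ℕ) → ℕ} [hF : Evaluable F] [hG : Evaluable G]

theorem Decides.marked_base : Decides fun w e => w.Marked (e 0) := by
  unfold World.Marked; infer_instance

instance Decides.marked : Decides fun w e => w.Marked (F w e) := comp₁ marked_base hF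

theorem Decides.markedPair_base : Decides fun w e => w.MarkedPair (e 0) := by
  unfold World.MarkedPair; infer_instance

theorem Decides.incident_base : Decides fun w e => w.Incident (e 0) (e 1) := by
  unfold World.Incident; infer_instance

instance Decides.incident : Decides fun w e => w.Incident (F w e) (G w e) :=
  comp₂ incident_base hF hG

theorem Evaluable.meetCard_base : Evaluable fun w e => w.meetCard (e 0) := by
  unfold World.meetCard; infer_instance

end Instances

/-- Both kinds of vertices are coded as unordered pairs of marked vertices, the smaller number
first; diagonal pairs stand for the maximal cyclic subgroups. The closed neighbourhood of a marked
vertex is its subgroup, so one colour formula, the number of common closed neighbours, covers both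
kinds. -/
theorem World.Reads.presents_reductionFour {w : World} {G : Type*} [Group G] [Finite G]
    {X : SimpleGraph G} {code : G → ℕ} (h : w.Reads code X.Adj) (hX : X.DetectsMaxCyclic)
    {S : Set G} (hS : IsCCGSetUpToTwins X S) (hmark : ∀ v, w.color (code v) ≠ 0 ↔ v ∈ S) :
    w.Presents w.MarkedPair (fun c d => w.Incident c d ∨ w.Incident d c) w.meetCard
      (reductionFour G) := by
  obtain ⟨ι, h1, h2⟩ := hS.exists_index hX
  set κ : CCVertex G → ℕ := fun A => code (ι A) with hκdef
  have hκ : Function.Injective κ := by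
    intro A B e
    have e' := h.codes.injective e
    refine CCVertex.zpowers_injective (SetLike.ext fun x => ?_)
    rw [← h2, ← h2, e']
  have hlt : ∀ A, κ A < w.base := fun A => (h.codes.lt _).trans h.order_lt
  have hM : ∀ v, w.Marked v ↔ ∃ A, κ A = v := by
    intro v
    constructor
    · rintro ⟨hv, hc⟩
      obtain ⟨a, rfl⟩ := (h.codes.exists_iff v).2 hv
      obtain ⟨A, rfl⟩ := (h1 a).2 ((hmark a).1 hc)
      exact ⟨A, rfl⟩
    · rintro ⟨A, rfl⟩
      exact ⟨h.codes.lt _, (hmark _).2 ((h1 _).1 ⟨A, rfl⟩)⟩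
  let ψ : Sym2 (CCVertex G) → ℕ := Sym2.lift ⟨fun A B => w.pair (min (κ A) (κ B)) (max (κ A) (κ B)),
    fun A B => by simp only [min_comm, max_comm]⟩
  have hψ : ∀ A B, ψ s(A, B) = w.pair (min (κ A) (κ B)) (max (κ A) (κ B)) := fun _ _ => rfl
  have hf : ∀ A B, w.fst (ψ s(A, B)) = min (κ A) (κ B) := fun A B => by
    rw [hψ, h.fst_pair (by simp [hlt]) (by simp [hlt])]
  have hs : ∀ A B, w.snd (ψ s(A, B)) = max (κ A) (κ B) := fun A B => by
    rw [hψ, h.snd_pair (by simp [hlt]) (by simp [hlt])]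
  have hψinj : Function.Injective ψ := by
    intro e e'
    induction e with | _ A B
    induction e' with | _ A' B'
    intro he
    have hmin : min (κ A) (κ B) = min (κ A') (κ B') := by rw [← hf, ← hf, he]
    have hmax : max (κ A) (κ B) = max (κ A') (κ B') := by rw [← hs, ← hs, he]
    rw [Sym2.eq_iff, ← hκ.eq_iff, ← hκ.eq_iff, ← hκ.eq_iff, ← hκ.eq_iff]
    omega
  let φ : ReductionFourVertex G → ℕ := Sum.elim (fun A => ψ s(A, A)) fun e => ψ e.1
  have hdiag : ∀ A (e : {e : Sym2 (CCVertex G) // ¬ e.IsDiag}), s(A, A) ≠ e.1 := by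
    rintro A ⟨e, he⟩ rfl
    exact he rfl
  have hinc : ∀ A (e : {e : Sym2 (CCVertex G) // ¬ e.IsDiag}),
      w.Incident (ψ s(A, A)) (ψ e.1) ↔ A ∈ e.1 := by
    rintro A ⟨e, he⟩
    induction e with | _ B C
    have hne : κ B ≠ κ C := fun e => he (hκ e)
    simp only [Incident, hf, hs, Sym2.mem_iff, ← hκ.eq_iff (a := A)]
    omega
  have hni : ∀ (e : {e : Sym2 (CCVertex G) // ¬ e.IsDiag}) c, ¬ w.Incident (ψ e.1) c := by
    rintro ⟨e, he⟩ c ⟨h3, -⟩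
    induction e with | _ B C
    have hne : κ B ≠ κ C := fun e => he (hκ e)
    simp only [hf, hs] at h3
    omega
  have hnd : ∀ c A, ¬ w.Incident c (ψ s(A, A)) := by
    rintro c A ⟨-, h3, -⟩
    simp only [hf, hs] at h3
    omega
  have hcol : ∀ A B, w.meetCard (ψ s(A, B)) =
      Nat.card (A.1.zpowers ⊓ B.1.zpowers : Subgroup G) := by
    intro A B
    have : ∀ A B, w.count w.order (fun x => w.ClosedAdj (κ A) x ∧ w.ClosedAdj (κ B) x) =
        Nat.card (A.1.zpowers ⊓ B.1.zpowers : Subgroup G) := by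
      intro A B
      rw [h.codes.count_eq]
      simp only [hκdef, h.closedAdj_iff, h2]
      exact (Nat.card_coe_set_eq _).symm
    rw [meetCard, hf, hs]
    rcases le_total (κ A) (κ B) with hle | hle
    · rw [min_eq_left hle, max_eq_right hle, this]
    · rw [min_eq_right hle, max_eq_left hle, this, inf_comm]
  refine ⟨φ, ?_, fun c => ⟨?_, ?_⟩, ?_, ?_⟩
  · rintro (A | e) (B | e') hab
    · have := hψinj hab
      rw [Sym2.eq_iff] at this
      rw [show A = B by tauto]
    · exact absurd (hψinj hab) (hdiag A e')
    · exact absurd (hψinj hab).symm (hdiag B e)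
    · rw [Subtype.ext (hψinj hab)]
  · have key : ∀ e, ψ e < w.base ^ 2 ∧ w.MarkedPair (ψ e) := by
      intro e
      induction e with | _ A B
      refine ⟨by rw [hψ]; exact h.pair_lt (by simp [hlt]) (by simp [hlt]), ?_, ?_, ?_⟩
      · rw [hf, hM]
        rcases min_choice (κ A) (κ B) with e | e <;> rw [e] <;> exact ⟨_, rfl⟩
      · rw [hs, hM]
        rcases max_choice (κ A) (κ B) with e | e <;> rw [e] <;> exact ⟨_, rfl⟩
      · rw [hf, hs]; omega
    rintro ⟨A | e, rfl⟩
    · exact key _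
    · exact key _
  · rintro ⟨hc, hR⟩
    obtain ⟨i, hi, j, hj, rfl⟩ := h.exists_pair hc
    rw [MarkedPair, h.fst_pair hi hj, h.snd_pair hi hj, hM, hM] at hR
    obtain ⟨⟨A, rfl⟩, ⟨B, rfl⟩, hle⟩ := hR
    have e : ψ s(A, B) = w.pair (κ A) (κ B) := by
      rw [hψ, min_eq_left hle, max_eq_right hle]
    by_cases hAB : A = B
    · subst hAB
      exact ⟨Sum.inl A, e⟩
    · exact ⟨Sum.inr ⟨s(A, B), hAB⟩, e⟩
  · rintro (A | e) (B | e')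
    · simp [φ, hnd]
    · simp [φ, hnd, hinc]
    · simp [φ, hnd, hinc]
    · simp [φ, hni]
  · rintro (A | ⟨e, he⟩)
    · rw [reductionFour_color_inl]
      exact (hcol A A).trans (by rw [inf_idem]; rfl)
    · induction e with | _ A B
      rw [reductionFour_color_inr]
      exact hcol A B

theorem exists_solves_reductionFour (K : (G : Type) → [Group G] → SimpleGraph G)
    (hK : ∀ (G : Type) [Group G], (K G).DetectsMaxCyclic) :
    ∃ (P : RamProg) (p : ℕ[X]), ∀ (n : ℕ) (X : SimpleGraph (Fin n)) (S : Set (Fin n)),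
      (∃ (G : Type) (_ : Group G) (_ : Finite G) (f : X ≃g K G),
        IsCCGSetUpToTwins (K G) (f '' S)) →
      P.Solves p n (encodeMarkedGraph X S) fun output => ∃ (k : ℕ) (Y : ColoredGraph (Fin k)),
        output = encodeColoredGraph Y ∧ ∀ (G : Type) [Group G] [Finite G] (f : X ≃g K G),
          IsCCGSetUpToTwins (K G) (f '' S) → Y.IsIso (reductionFour G) := by
  have hd : Decides fun w e => w.Incident (e 0) (e 1) ∨ w.Incident (e 1) (e 0) := inferInstance
  have hreal := Realizable.emit (r := fun w c d => w.Incident c d ∨ w.Incident d c)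
    .markedPair_base hd .meetCard_base
  obtain ⟨P, p, hP⟩ := hreal.exists_run_graph
  refine ⟨P, p, fun n X S hex s hs => ?_⟩
  obtain ⟨t, ht, s', hr, hw, hfr⟩ := hP s
  rw [encodeMarkedGraph, RamState.holds_three, holdsWord_singleton, holdsWord_matrixWord,
    setWord, holdsWord_ofFn] at hs
  obtain ⟨h0, h1, h2⟩ := hs
  rw [h0] at ht hw
  have key : ∀ (G : Type) [Group G] [Finite G] (f : X ≃g K G),
      IsCCGSetUpToTwins (K G) (f '' S) →
      World.Presents ⟨(n + 2) ^ 4, n + 2, s.arr⟩ _ _ _ (reductionFour G) := fun G _ _ f hf => by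
    have hR := World.reads_of_holds h0 h1 f.toEquiv
      (fun i j => (f.map_adj_iff (v := i) (w := j)).symm) (le_refl (n + 2))
    refine hR.presents_reductionFour (hK G) hf fun v => ?_
    simp only [World.color, h2]
    rw [Set.mem_image]
    constructor
    · intro h
      have : f.toEquiv.symm v ∈ S := by
        by_contra hv
        simp [hv] at h
      exact ⟨_, this, f.toEquiv.apply_symm_apply v⟩
    · rintro ⟨i, hi, rfl⟩
      have e : f.toEquiv.symm (f i) = i := f.toEquiv.symm_apply_apply i
      simp [e, hi]
  have hroom : World.Roomy ⟨(n + 2) ^ 4, n + 2, s.arr⟩ := ⟨by simp, rfl⟩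
  obtain ⟨k, Y, hY, hiso⟩ := hroom.holds_coloredGraph hw (by
    obtain ⟨G, _, _, f, hf⟩ := hex
    exact ⟨_, _, key G f hf⟩)
  exact ⟨t, ht, s', hr, fun a ha => hfr a (by omega), _, hY, k, Y, rfl,
    fun G _ _ f hf => hiso _ _ (key G f hf)⟩

/-! ## From the fourth to the third reduction -/

namespace World

/-- The first arrays of the world hold a copy of a coloured graph. -/
structure ReadsColored (w : World) {V : Type*} (code : V → ℕ) (Z : ColoredGraph V) : Prop extends
    w.Reads code Z.Adj where
  color_eq : ∀ a, w.color (code a) = Z.color a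
  color_lt : ∀ a, Z.color a < w.base

theorem readsColored_of_holds {s : RamState} {n B : ℕ} {X : ColoredGraph (Fin n)} {V : Type*}
    {Z : ColoredGraph V} (hs : s.Holds (encodeColoredGraph X)) (hXZ : X.IsIso Z)
    (hB : B = s.arr 0 0 + ∑ v ∈ Finset.range (s.arr 0 0), s.arr 2 v + 2) :
    ∃ code, World.ReadsColored ⟨B ^ 4, B, s.arr⟩ code Z := by
  obtain ⟨f, hf⟩ := hXZ
  rw [encodeColoredGraph, RamState.holds_three, holdsWord_singleton, holdsWord_matrixWord,
    holdsWord_ofFn] at hs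
  obtain ⟨h0, h1, h2⟩ := hs
  refine ⟨_, reads_of_holds h0 h1 f.toEquiv (fun i j => (f.map_adj_iff (v := i) (w := j)).symm)
    (by omega), fun a => ?_, fun a => ?_⟩
  · simp only [World.color, h2, ← hf]
    exact congrArg Z.color (f.toEquiv.apply_symm_apply a)
  · have e : Z.color a = s.arr 2 (f.symm a) := by
      rw [h2, ← hf]
      exact congrArg Z.color (f.toEquiv.apply_symm_apply a).symm
    have : s.arr 2 (f.symm a) ≤ ∑ v ∈ Finset.range (s.arr 0 0), s.arr 2 v :=
      Finset.single_le_sum (f := s.arr 2) (fun _ _ => Nat.zero_le _)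
        (Finset.mem_range.2 (by rw [h0]; exact (f.symm a).2))
    show Z.color a < B
    omega

/-- The program chooses its stride from the number of vertices and the sum of the colours, whereas
time is measured by the order g of the group. With at most g² vertices of colour at most g, the
stride is at most g² + g³ + 2. -/
theorem base_le_of_holds {s : RamState} {n B g : ℕ} {X : ColoredGraph (Fin n)} {V : Type*}
    {Z : ColoredGraph V} (hs : s.Holds (encodeColoredGraph X)) (hXZ : X.IsIso Z)
    (hB : B = s.arr 0 0 + ∑ v ∈ Finset.range (s.arr 0 0), s.arr 2 v + 2)
    (hV : Nat.card V ≤ g ^ 2) (hc : ∀ a, Z.color a ≤ g) :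
    B ≤ (Polynomial.X ^ 2 + Polynomial.X ^ 3 + 2 : ℕ[X]).eval g := by
  obtain ⟨f, hf⟩ := hXZ
  rw [encodeColoredGraph, RamState.holds_three, holdsWord_singleton, holdsWord_matrixWord,
    holdsWord_ofFn] at hs
  obtain ⟨h0, h1, h2⟩ := hs
  have hn : n ≤ g ^ 2 := by rwa [← f.natCard_eq]
  have : ∑ v ∈ Finset.range (s.arr 0 0), s.arr 2 v ≤ n * g := by
    rw [h0]
    refine (Finset.sum_le_card_nsmul _ _ g fun v hv => ?_).trans (by simp)
    rw [Finset.mem_range] at hv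
    have e := h2 ⟨v, hv⟩
    simp only at e
    rw [e, ← hf]
    exact hc _
  simp only [eval_add, eval_pow, eval_X, eval_ofNat]
  nlinarith

variable (w : World)

/-- The vertices of the fourth reduction that stand for maximal cyclic subgroups. -/
def IsTop (v : ℕ) : Prop :=
  v < w.order ∧ w.All w.order fun u => w.Adj v u → w.color u ≤ w.color v

open Classical in
/-- The order of the intersection of two maximal cyclic subgroups. -/
noncomputable def common (u v : ℕ) : ℕ :=
  if u = v then w.color u
  else w.sum w.order fun x => if w.Adj u x ∧ w.Adj x v then w.color x else 0

/-- The pair of the first maximal cyclic subgroup that contains a given cyclic subgroup, and of the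
order of the latter. -/
def SubPair (c : ℕ) : Prop :=
  w.IsTop (w.fst c) ∧ w.Dvd (w.snd c) (w.color (w.fst c)) ∧
    w.All (w.fst c) fun u => w.IsTop u → ¬ w.Dvd (w.snd c) (w.common (w.fst c) u)

/-- Inclusion. -/
def SubLE (c d : ℕ) : Prop :=
  w.Dvd (w.snd c) (w.snd d) ∧ w.Dvd (w.snd c) (w.common (w.fst c) (w.fst d))

/-- Strict inclusion. -/
def SubLT (c d : ℕ) : Prop := w.SubLE c d ∧ ¬ w.SubLE d c

/-- Strict inclusion with nothing in between. -/
def SubCover (c d : ℕ) : Prop :=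
  w.SubLT c d ∧ ¬ w.Ex w.pairs fun b => w.SubPair b ∧ w.SubLT c b ∧ w.SubLT b d

end World

section Instances

variable {F G : World → (ℕ → ℕ) → ℕ} [hF : Evaluable F] [hG : Evaluable G]

theorem Decides.isTop_base : Decides fun w e => w.IsTop (e 0) := by
  unfold World.IsTop; infer_instance

instance Decides.isTop : Decides fun w e => w.IsTop (F w e) := comp₁ isTop_base hF

theorem Evaluable.common_base : Evaluable fun w e => w.common (e 0) (e 1) := by
  unfold World.common; infer_instance

instance Evaluable.common : Evaluable fun w e => w.common (F w e) (G w e) :=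
  comp₂ common_base hF hG

theorem Decides.subPair_base : Decides fun w e => w.SubPair (e 0) := by
  unfold World.SubPair; infer_instance

instance Decides.subPair : Decides fun w e => w.SubPair (F w e) := comp₁ subPair_base hF

theorem Decides.subLT_base : Decides fun w e => w.SubLT (e 0) (e 1) := by
  unfold World.SubLT World.SubLE; infer_instance

instance Decides.subLT : Decides fun w e => w.SubLT (F w e) (G w e) := comp₂ subLT_base hF hG

theorem Decides.subCover_base : Decides fun w e => w.SubCover (e 0) (e 1) := by
  unfold World.SubCover; infer_instance

instance Decides.subCover : Decides fun w e => w.SubCover (F w e) (G w e) :=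
  comp₂ subCover_base hF hG

end Instances

section

variable {G : Type*} [Group G]

namespace ReductionFourVertex

/-- The vertex of a maximal cyclic subgroup. -/
def single (A : CCVertex G) : ReductionFourVertex G := Sum.inl A

/-- The vertex of the intersection of two maximal cyclic subgroups. -/
def meet (A B : CCVertex G) (h : A ≠ B) : ReductionFourVertex G := Sum.inr ⟨s(A, B), h⟩

theorem eq_single_or_eq_meet (a : ReductionFourVertex G) :
    (∃ A, a = single A) ∨ ∃ A B, ∃ h : A ≠ B, a = meet A B h := by
  rcases a with A | ⟨e, he⟩
  · exact Or.inl ⟨A, rfl⟩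
  · induction e with | _ A B
    exact Or.inr ⟨A, B, he, rfl⟩

theorem single_injective : Function.Injective (single : CCVertex G → _) := Sum.inl_injective

theorem meet_eq {A B C D : CCVertex G} {h : A ≠ B} {h' : C ≠ D} (hA : A = C ∨ A = D)
    (hB : B = C ∨ B = D) : meet C D h' = meet A B h := by
  refine congrArg Sum.inr (Subtype.ext (Sym2.eq_iff.2 ?_))
  rcases hA with rfl | rfl <;> rcases hB with rfl | rfl
  · exact absurd rfl h
  · exact Or.inl ⟨rfl, rfl⟩
  · exact Or.inr ⟨rfl, rfl⟩
  · exact absurd rfl h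

theorem not_adj_single {A B : CCVertex G} : ¬ (reductionFour G).Adj (single A) (single B) :=
  reductionFour_adj_inl_inl A B

theorem adj_single_meet {A B C : CCVertex G} {h : A ≠ B} :
    (reductionFour G).Adj (single C) (meet A B h) ↔ C = A ∨ C = B :=
  (reductionFour_adj_inl_inr C _).trans Sym2.mem_iff

theorem color_single {A : CCVertex G} : (reductionFour G).color (single A) = A.1.card :=
  reductionFour_color_inl A

end ReductionFourVertex

variable [Finite G]

theorem ReductionFourVertex.color_meet {A B : CCVertex G} {h : A ≠ B} :
    (reductionFour G).color (meet A B h) =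
    Nat.card (A.1.zpowers ⊓ B.1.zpowers : Subgroup G) :=
  reductionFour_color_inr A B h

instance : Finite (CCVertex G) := Subtype.finite

theorem CCVertex.le_antisymm {A B : CCVertex G} (h : A.1.zpowers ≤ B.1.zpowers) : A = B := by
  obtain ⟨g, hg, e⟩ := A.exists_isMaxGenerator
  obtain ⟨k, hk, e'⟩ := B.exists_isMaxGenerator
  refine CCVertex.zpowers_injective (_root_.le_antisymm h ?_)
  show B.1.zpowers ≤ A.1.zpowers
  rw [e, e'] at h ⊢
  exact Subgroup.zpowers_le.2 (hg k (Subgroup.zpowers_le.1 h))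

theorem CCVertex.exists_le (B : TwinClass G) : ∃ A : CCVertex G, B.zpowers ≤ A.1.zpowers := by
  obtain ⟨b, rfl⟩ := twinClass_surjective B
  obtain ⟨g, hg, h⟩ := _root_.exists_isMaxGenerator b
  exact ⟨⟨twinClass g, g, isCCGenerator_iff.2 hg, rfl⟩, Subgroup.zpowers_le.2 h⟩

theorem natCard_twinClass_le : Nat.card (TwinClass G) ≤ Nat.card G :=
  Nat.card_le_card_of_surjective _ twinClass_surjective

theorem natCard_reductionFourVertex_le : Nat.card (ReductionFourVertex G) ≤ Nat.card G ^ 2 := by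
  classical
  have h : Nat.card (CCVertex G) ≤ Nat.card G :=
    (Nat.card_le_card_of_injective _ Subtype.val_injective).trans natCard_twinClass_le
  have hs : Function.Surjective fun p : CCVertex G × CCVertex G =>
      if h : p.1 = p.2 then ReductionFourVertex.single p.1
      else ReductionFourVertex.meet p.1 p.2 h := by
    intro a
    rcases a.eq_single_or_eq_meet with ⟨A, rfl⟩ | ⟨A, B, h, rfl⟩
    · exact ⟨(A, A), by simp⟩
    · exact ⟨(A, B), dif_neg h⟩
  calc Nat.card (ReductionFourVertex G) ≤ Nat.card (CCVertex G × CCVertex G) :=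
        Nat.card_le_card_of_surjective _ hs
    _ = Nat.card (CCVertex G) ^ 2 := by rw [Nat.card_prod, sq]
    _ ≤ _ := Nat.pow_le_pow_left h 2

theorem reductionFour_color_le (a : ReductionFourVertex G) :
    (reductionFour G).color a ≤ Nat.card G := by
  rcases a.eq_single_or_eq_meet with ⟨A, rfl⟩ | ⟨A, B, h, rfl⟩
  · rw [ReductionFourVertex.color_single]
    exact A.1.card_le_natCard
  · rw [ReductionFourVertex.color_meet]
    exact Nat.card_le_card_of_injective _ Subtype.val_injective

/-- Both `C` and the intersection are subgroups of the cyclic group `A`, where inclusion is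
divisibility of orders. So the intersection orders alone decide which subgroups of `A` also lie in
`B`. -/
theorem TwinClass.le_iff_dvd_inf {A B C : TwinClass G} (h : C.zpowers ≤ A.zpowers) :
    C.zpowers ≤ B.zpowers ↔ C.card ∣ Nat.card (A.zpowers ⊓ B.zpowers : Subgroup G) := by
  obtain ⟨D, hD⟩ := A.exists_zpowers_eq_inf B
  have hDA : D.zpowers ≤ A.zpowers := hD ▸ inf_le_left
  rw [← hD]
  show _ ↔ C.card ∣ D.card
  rw [← zpowers_le_iff_dvd h hDA, hD]
  exact ⟨fun h' => le_inf h h', fun h' => h'.trans inf_le_right⟩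

end

namespace World.ReadsColored

open ReductionFourVertex

variable {w : World} {G : Type*} [Group G] [Finite G] {code : ReductionFourVertex G → ℕ}

/-- The input does not mark the two kinds of vertices. They are told apart because distinct maximal
cyclic subgroups are never nested, so a vertex of an intersection has a neighbour of strictly larger
colour. -/
theorem isTop_iff (h : w.ReadsColored code (reductionFour G)) (v : ℕ) :
    w.IsTop v ↔ ∃ A : CCVertex G, code (single A) = v := by
  have key : ∀ a, w.IsTop (code a) ↔
      ∀ b, (reductionFour G).Adj a b → (reductionFour G).color b ≤ (reductionFour G).color a := by
    intro a
    rw [IsTop, h.codes.all_iff]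
    simp only [h.codes.lt, true_and, h.adj_iff, h.color_eq]
  constructor
  · intro hv
    obtain ⟨a, rfl⟩ := (h.codes.exists_iff v).2 hv.1
    rw [key] at hv
    rcases a.eq_single_or_eq_meet with ⟨A, rfl⟩ | ⟨A, B, hAB, rfl⟩
    · exact ⟨A, rfl⟩
    · exfalso
      have h1 := hv (single A) (SimpleGraph.Adj.symm (adj_single_meet.2 (Or.inl rfl)))
      rw [color_single, color_meet] at h1
      have h2 : A.1.zpowers ⊓ B.1.zpowers = A.1.zpowers :=
        Subgroup.eq_of_le_of_card_ge inf_le_left h1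
      exact hAB (CCVertex.le_antisymm (inf_eq_left.1 h2))
  · rintro ⟨A, rfl⟩
    rw [key]
    intro b hadj
    rcases b.eq_single_or_eq_meet with ⟨B, rfl⟩ | ⟨B, C, hBC, rfl⟩
    · exact absurd hadj not_adj_single
    · rw [color_single, color_meet]
      have hle : B.1.zpowers ⊓ C.1.zpowers ≤ A.1.zpowers := by
        rcases adj_single_meet.1 hadj with rfl | rfl
        · exact inf_le_left
        · exact inf_le_right
      exact Nat.card_le_card_of_injective _ (Subgroup.inclusion_injective hle)

/-- Exactly one vertex is adjacent to both of two distinct maximal ones, so the sum in `common` has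
a single nonzero term. The diagonal case extends the formula to |A ∩ A|. -/
theorem common_eq (h : w.ReadsColored code (reductionFour G)) (A B : CCVertex G) :
    w.common (code (single A)) (code (single B)) =
      Nat.card (A.1.zpowers ⊓ B.1.zpowers : Subgroup G) := by
  rw [common]
  split_ifs with e
  · have e' : A = B := single_injective (h.codes.injective e)
    subst e'
    rw [h.color_eq, color_single, inf_idem]
    rfl
  · have hAB : A ≠ B := fun e' => e (by rw [e'])
    rw [h.codes.sum_eq_single _ (meet A B hAB), if_pos, h.color_eq, color_meet]
    · rw [h.adj_iff, h.adj_iff, adj_single_meet, SimpleGraph.adj_comm, adj_single_meet]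
      simp
    · intro b hne
      rw [h.adj_iff, h.adj_iff, if_neg]
      rintro ⟨h1, h2⟩
      rcases b.eq_single_or_eq_meet with ⟨C, rfl⟩ | ⟨C, D, hCD, rfl⟩
      · exact not_adj_single h1
      · exact hne (meet_eq (adj_single_meet.1 h1) (adj_single_meet.1 h2.symm))

/-- A cyclic subgroup is coded by a maximal cyclic subgroup containing it together with its own
order, which is possible because a cyclic group has exactly one subgroup of each order dividing its
own. -/
theorem presents_reductionThree (h : w.ReadsColored code (reductionFour G)) :
    w.Presents w.SubPair (fun c d => w.SubCover c d ∨ w.SubCover d c) w.snd (reductionThree G) := by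
  set κ : CCVertex G → ℕ := fun A => code (single A) with hκdef
  have hκ : Function.Injective κ := h.codes.injective.comp single_injective
  have hκlt : ∀ A, κ A < w.base := fun A => (h.codes.lt _).trans h.order_lt
  -- A subgroup may lie in several maximal ones; the one with the least number is chosen, so that
  -- every subgroup has a single code.
  have hex : ∀ B : TwinClass G, ∃ A : CCVertex G, B.zpowers ≤ A.1.zpowers ∧
      ∀ A' : CCVertex G, κ A' < κ A → ¬ B.zpowers ≤ A'.1.zpowers := fun B => by
    obtain ⟨A, hA, hmin⟩ := (measure κ).wf.has_min {A : CCVertex G | B.zpowers ≤ A.1.zpowers}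
      (CCVertex.exists_le B)
    exact ⟨A, hA, fun A' hlt hA' => hmin A' hA' hlt⟩
  choose top htop hleast using hex
  have huniq : ∀ B A, B.zpowers ≤ A.1.zpowers →
      (∀ A' : CCVertex G, κ A' < κ A → ¬ B.zpowers ≤ A'.1.zpowers) → top B = A := by
    intro B A h1 h2
    rcases lt_trichotomy (κ (top B)) (κ A) with hlt | e | hlt
    · exact absurd (htop B) (h2 _ hlt)
    · exact hκ e
    · exact absurd h1 (hleast B _ hlt)
  have hcol : ∀ A : CCVertex G, w.color (κ A) = A.1.card := fun A => by
    rw [hκdef, h.color_eq, color_single]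
  have hcardA : ∀ A : CCVertex G, A.1.card < w.base := fun A => by
    rw [← color_single]; exact h.color_lt _
  have hcard : ∀ B : TwinClass G, B.card < w.base := fun B =>
    (TwinClass.card_le (htop B)).trans_lt (hcardA _)
  have hcom : ∀ A B : CCVertex G, w.common (κ A) (κ B) =
      Nat.card (A.1.zpowers ⊓ B.1.zpowers : Subgroup G) := h.common_eq
  have hdvd : ∀ {d k}, k < w.base → (w.Dvd d k ↔ d ∣ k) := fun hk =>
    dvd_iff (hk.trans_le h.base_le)
  have hcomlt : ∀ A B : CCVertex G,
      Nat.card (A.1.zpowers ⊓ B.1.zpowers : Subgroup G) < w.base := fun A B => by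
    obtain ⟨C, hC⟩ := A.1.exists_zpowers_eq_inf B.1
    rw [← hC]
    exact hcard C
  let φ : TwinClass G → ℕ := fun B => w.pair (κ (top B)) B.card
  have hf : ∀ B, w.fst (φ B) = κ (top B) := fun B => h.fst_pair (hκlt _) (hcard B)
  have hs : ∀ B, w.snd (φ B) = B.card := fun B => h.snd_pair (hκlt _) (hcard B)
  -- The second divisibility says that B lies in the maximal subgroup chosen for C. Inside it, the
  -- first divisibility is inclusion.
  have hle : ∀ B C, w.SubLE (φ B) (φ C) ↔ B.zpowers ≤ C.zpowers := by
    intro B C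
    rw [SubLE, hs, hs, hf, hf, hcom, hdvd (hcard C), hdvd (hcomlt _ _),
      ← TwinClass.le_iff_dvd_inf (htop B)]
    constructor
    · rintro ⟨h1, h2⟩
      exact (TwinClass.zpowers_le_iff_dvd h2 (htop C)).2 h1
    · intro h1
      exact ⟨TwinClass.card_dvd h1, h1.trans (htop C)⟩
  have hlt : ∀ B C, w.SubLT (φ B) (φ C) ↔ B.zpowers < C.zpowers := by
    intro B C
    rw [SubLT, hle, hle, lt_iff_le_not_ge]
  have hR : ∀ c, (∃ B, φ B = c) ↔ c < w.base ^ 2 ∧ w.SubPair c := by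
    intro c
    constructor
    · rintro ⟨B, rfl⟩
      refine ⟨h.pair_lt (hκlt _) (hcard B), ?_⟩
      have hκle : κ (top B) ≤ w.size := (hκlt _).le.trans h.base_le
      rw [SubPair, hf, hs, h.isTop_iff, hcol, hdvd (hcardA _), World.all_iff hκle]
      refine ⟨⟨_, rfl⟩, TwinClass.card_dvd (htop B), fun u hu hut => ?_⟩
      obtain ⟨A, rfl⟩ := (h.isTop_iff u).1 hut
      rw [hcom _ A, hdvd (hcomlt _ _), ← TwinClass.le_iff_dvd_inf (htop B)]
      exact hleast B A hu
    · rintro ⟨hc, h1, h2, h3⟩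
      obtain ⟨i, hi, d, hd, rfl⟩ := h.exists_pair hc
      rw [World.all_iff (by rw [h.fst_pair hi hd]; exact hi.le.trans h.base_le)] at h3
      rw [h.fst_pair hi hd] at h1 h2 h3
      rw [h.snd_pair hi hd] at h2 h3
      obtain ⟨A, rfl⟩ := (h.isTop_iff i).1 h1
      rw [show w.color (code (single A)) = A.1.card from hcol A, hdvd (hcardA A)] at h2
      obtain ⟨B, hBA, rfl⟩ := TwinClass.exists_card_eq h2
      refine ⟨B, ?_⟩
      have := huniq B A hBA fun A' hA' => by
        rw [TwinClass.le_iff_dvd_inf hBA, ← hdvd (hcomlt _ _), ← hcom]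
        exact h3 _ hA' ((h.isTop_iff _).2 ⟨A', rfl⟩)
      show w.pair (κ (top B)) B.card = _
      rw [this]
  have hcov : ∀ B C, w.SubCover (φ B) (φ C) ↔ TwinClass.IsCover B C := by
    intro B C
    rw [SubCover, TwinClass.IsCover, hlt, h.pairs_eq, World.ex_iff h.sq_le]
    refine and_congr_right fun _ => ⟨fun h1 D hD => h1 ?_, ?_⟩
    · obtain ⟨hD1, hD2⟩ := (hR _).1 ⟨D, rfl⟩
      exact ⟨φ D, hD1, hD2, (hlt _ _).2 hD.1, (hlt _ _).2 hD.2⟩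
    · rintro h1 ⟨c, hc, hRc, h2, h3⟩
      obtain ⟨D, rfl⟩ := (hR c).2 ⟨hc, hRc⟩
      exact h1 D ⟨(hlt _ _).1 h2, (hlt _ _).1 h3⟩
  refine ⟨φ, fun B C e => ?_, hR, fun B C => ?_, fun B => ?_⟩
  · have h1 := (hle B C).1 (e ▸ (hle B B).2 le_rfl)
    have h2 := (hle C B).1 (e ▸ (hle B B).2 le_rfl)
    exact TwinClass.zpowers_injective (_root_.le_antisymm h1 h2)
  · simp only [hcov, reductionThree_adj]
  · rw [hs, reductionThree_color]

end World.ReadsColored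

theorem exists_solves_reductionThree :
    ∃ (P : RamProg) (p : ℕ[X]), ∀ (n : ℕ) (X : ColoredGraph (Fin n)) (g : ℕ),
      (∃ (G : Type) (_ : Group G) (_ : Finite G), Nat.card G = g ∧ X.IsIso (reductionFour G)) →
      P.Solves p g (encodeColoredGraph X) fun output => ∃ (k : ℕ) (Y : ColoredGraph (Fin k)),
        output = encodeColoredGraph Y ∧ ∀ (G : Type) [Group G] [Finite G],
          X.IsIso (reductionFour G) → Y.IsIso (reductionThree G) := by
  have hd : Decides fun w e => w.SubCover (e 0) (e 1) ∨ w.SubCover (e 1) (e 0) := inferInstance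
  have hreal := Realizable.emit (r := fun w c d => w.SubCover c d ∨ w.SubCover d c)
    .subPair_base hd .snd_base
  obtain ⟨P, p, hP⟩ := hreal.exists_run_coloredGraph
  refine ⟨P, p.comp (X ^ 2 + X ^ 3 + 2), fun n X g hex s hs => ?_⟩
  obtain ⟨t, ht, s', hr, hw, hfr⟩ := hP s _ rfl
  have key : ∀ (G : Type) [Group G] [Finite G], X.IsIso (reductionFour G) →
      World.Presents _ _ _ _ (reductionThree G) := fun G _ _ hG => by
    obtain ⟨code, hcode⟩ := World.readsColored_of_holds hs hG rfl
    exact hcode.presents_reductionThree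
  have hroom : World.Roomy ⟨(s.arr 0 0 + ∑ v ∈ Finset.range (s.arr 0 0), s.arr 2 v + 2) ^ 4,
      s.arr 0 0 + ∑ v ∈ Finset.range (s.arr 0 0), s.arr 2 v + 2, s.arr⟩ := ⟨by simp, rfl⟩
  obtain ⟨G₀, _, _, hg, hG₀⟩ := hex
  obtain ⟨k, Y, hY, hiso⟩ := hroom.holds_coloredGraph hw ⟨_, _, key G₀ hG₀⟩
  refine ⟨t, ht.trans ?_, s', hr, fun a ha => hfr a (by omega), _, hY, k, Y, rfl,
    fun G _ _ hG => hiso _ _ (key G hG)⟩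
  rw [eval_comp]
  refine p.eval_mono_nat (World.base_le_of_holds hs hG₀ rfl ?_ ?_)
  · exact hg ▸ natCard_reductionFourVertex_le
  · exact fun a => hg ▸ reductionFour_color_le a

/-! ## From the third reduction to the directed power graph -/

theorem TwinClass.natCard_fiber {G : Type*} [Group G] [Finite G] (A : TwinClass G) :
    Nat.card {a : G // twinClass a = A} = Nat.totient A.card := by
  obtain ⟨a, rfl⟩ := twinClass_surjective A
  rw [TwinClass.card_twinClass, ← ncard_generators a, ← Nat.card_coe_set_eq]
  simp only [twinClass_eq_iff]
  rfl

namespace World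

variable (w : World)

/-- The fourth array holds a relation. -/
def Below (u v : ℕ) : Prop := w.arr 3 (w.pair u v) ≠ 0

/-- `v` is a neighbour of `u` of a smaller colour. -/
def Lower (u v : ℕ) : Prop := w.Adj u v ∧ w.color v < w.color u

open Classical in
/-- The identity relation is written into the fourth array. -/
noncomputable def initBelow : World := w.write 3 fun c => if w.fst c = w.snd c then 1 else 0

open Classical in
/-- One step in the computation of the reachability relation. -/
noncomputable def stepBelow : World := w.write 3 fun c => if w.Below (w.fst c) (w.snd c) ∨
  w.Ex w.order (fun k => w.Lower (w.fst c) k ∧ w.Below k (w.snd c)) then 1 else 0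

end World

section Instances

variable {F G : World → (ℕ → ℕ) → ℕ} [hF : Evaluable F] [hG : Evaluable G]

theorem Decides.below_base : Decides fun w e => w.Below (e 0) (e 1) := by
  unfold World.Below; infer_instance

instance Decides.below : Decides fun w e => w.Below (F w e) (G w e) := comp₂ below_base hF hG

theorem Decides.lower_base : Decides fun w e => w.Lower (e 0) (e 1) := by
  unfold World.Lower; infer_instance

instance Decides.lower : Decides fun w e => w.Lower (F w e) (G w e) := comp₂ lower_base hF hG

end Instances

theorem Realizable.initBelow : Realizable 13 World.initBelow := by
  classical
  have h : Evaluable fun w e => if w.fst (e 0) = w.snd (e 0) then 1 else 0 := inferInstance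
  exact .write (f := fun w c => if w.fst c = w.snd c then 1 else 0) (by simp) h

theorem Realizable.stepBelow : Realizable 13 World.stepBelow := by
  classical
  have h : Evaluable fun w e => if w.Below (w.fst (e 0)) (w.snd (e 0)) ∨
    w.Ex w.order (fun k => w.Lower (w.fst (e 0)) k ∧ w.Below k (w.snd (e 0))) then 1 else 0 :=
      inferInstance
  exact .write (f := fun w c => if w.Below (w.fst c) (w.snd c) ∨
    w.Ex w.order (fun k => w.Lower (w.fst c) k ∧ w.Below k (w.snd c)) then 1 else 0) (by simp) h

namespace World

variable {w : World}

theorem Roomy.below_write (h : w.Roomy) (f : ℕ → ℕ) {u v : ℕ} (hu : u < w.base)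
    (hv : v < w.base) : (w.write 3 f).Below u v ↔ f (w.pair u v) ≠ 0 := by
  have hlt : w.pair u v < w.size := (h.pair_lt hu hv).trans_le h.sq_le
  have : (w.write 3 f).arr 3 (w.pair u v) = f (w.pair u v) := by simp [World.write, hlt]
  exact this ▸ Iff.rfl

theorem ReadsColored.write (h : w.ReadsColored code Z) (f : ℕ → ℕ) :
    (w.write 3 f).ReadsColored code Z :=
  ⟨⟨⟨h.one_lt, h.size_eq⟩, h.order_lt, ⟨h.codes.le_size, h.codes.injective, h.codes.exists_iff⟩,
    h.adj_iff⟩, h.color_eq, h.color_lt⟩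

variable {G : Type*} [Group G] [Finite G] {code : TwinClass G → ℕ}

theorem ReadsColored.code_lt {V : Type*} {code : V → ℕ} {Z : ColoredGraph V}
    (h : w.ReadsColored code Z) (a : V) : code a < w.base := (h.codes.lt a).trans h.order_lt

/-- The relation in the fourth array is sound for inclusion of subgroups, and complete as long as
the orders differ by at most `m`. -/
def Bounds (w : World) (code : TwinClass G → ℕ) (m : ℕ) : Prop :=
  ∀ A B, (w.Below (code A) (code B) → B.zpowers ≤ A.zpowers) ∧
    (B.zpowers ≤ A.zpowers → A.card ≤ B.card + m → w.Below (code A) (code B))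

theorem ReadsColored.lower_iff (h : w.ReadsColored code (reductionThree G)) (A B : TwinClass G) :
    w.Lower (code A) (code B) ↔ B.IsCover A := by
  rw [Lower, h.adj_iff, h.color_eq, h.color_eq, reductionThree_adj_and_color_lt]

theorem ReadsColored.bounds_init (h : w.ReadsColored code (reductionThree G)) :
    w.initBelow.Bounds code 0 := by
  intro A B
  rw [initBelow, h.below_write _ (h.code_lt A) (h.code_lt B),
    h.fst_pair (h.code_lt A) (h.code_lt B), h.snd_pair (h.code_lt A) (h.code_lt B)]
  simp only [ne_eq, ite_eq_right_iff, one_ne_zero, imp_false, not_not, h.codes.injective.eq_iff]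
  exact ⟨fun e => e ▸ le_rfl, fun h1 h2 =>
    TwinClass.zpowers_injective (Subgroup.eq_of_le_of_card_ge h1 h2).symm⟩

/-- Passing to a cover lowers the order by at least one, so one more round reaches all inclusions
whose orders differ by one more. -/
theorem ReadsColored.bounds_step (h : w.ReadsColored code (reductionThree G)) {m : ℕ}
    (hm : w.Bounds code m) : w.stepBelow.Bounds code (m + 1) := by
  intro A B
  rw [stepBelow, h.below_write _ (h.code_lt A) (h.code_lt B),
    h.fst_pair (h.code_lt A) (h.code_lt B), h.snd_pair (h.code_lt A) (h.code_lt B)]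
  simp only [ne_eq, ite_eq_right_iff, one_ne_zero, imp_false, not_not, h.codes.ex_iff, h.lower_iff]
  constructor
  · rintro (h1 | ⟨C, h1, h2⟩)
    · exact (hm A B).1 h1
    · exact ((hm C B).1 h2).trans h1.1.le
  · intro h1 h2
    rcases h1.eq_or_lt with e | hlt
    · exact Or.inl ((hm A B).2 h1 (by rw [TwinClass.zpowers_inj.1 e]; omega))
    · obtain ⟨C, h3, h4⟩ := TwinClass.exists_isCover hlt
      have := TwinClass.card_lt h4.1
      exact Or.inr ⟨C, h4, (hm C B).2 h3 (by omega)⟩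

theorem ReadsColored.bounds_iterate (h : w.ReadsColored code (reductionThree G)) (m : ℕ) :
    (stepBelow^[m] w.initBelow).ReadsColored code (reductionThree G) ∧
      (stepBelow^[m] w.initBelow).size = w.size ∧ (stepBelow^[m] w.initBelow).base = w.base ∧
      (stepBelow^[m] w.initBelow).Bounds code m := by
  induction m with
  | zero => exact ⟨h.write _, rfl, rfl, h.bounds_init⟩
  | succ m ih =>
    rw [Function.iterate_succ_apply']
    exact ⟨ih.1.write _, ih.2.1, ih.2.2.1, ih.1.bounds_step ih.2.2.2⟩

/-- The world with the reachability relation in the fourth array. -/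
noncomputable def closeBelow (w : World) : World := stepBelow^[w.initBelow.size] w.initBelow

/-- The number of rounds is the size of the world, which exceeds every order. -/
theorem ReadsColored.closeBelow (h : w.ReadsColored code (reductionThree G)) :
    w.closeBelow.ReadsColored code (reductionThree G) ∧
      ∀ A B, w.closeBelow.Below (code A) (code B) ↔ B.zpowers ≤ A.zpowers := by
  obtain ⟨h1, -, -, h2⟩ := h.bounds_iterate w.initBelow.size
  refine ⟨h1, fun A B => ⟨(h2 A B).1, fun h3 => (h2 A B).2 h3 ?_⟩⟩
  have := h.color_lt A
  rw [reductionThree_color] at this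
  have h4 : w.base ≤ w.initBelow.size := h.base_le
  omega

/-- Elements of one twin class are interchangeable in the directed power graph. An element is coded
by its class and its place, below φ of the order, in an arbitrary numbering of that class. -/
theorem ReadsColored.exists_code_group (h : w.ReadsColored code (reductionThree G))
    (hle : ∀ A B, w.Below (code A) (code B) ↔ B.zpowers ≤ A.zpowers) :
    ∃ φ : G → ℕ, Function.Injective φ ∧
      (∀ c, (∃ a, φ a = c) ↔ c < w.base ^ 2 ∧
        (w.fst c < w.order ∧ w.snd c < w.totient (w.color (w.fst c)))) ∧
      ∀ a b, w.Below (w.fst (φ a)) (w.fst (φ b)) ↔ (directedPowerGraph G).Adj a b := by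
  have hcard : ∀ A : TwinClass G, A.card < w.base := fun A => by
    rw [← reductionThree_color]; exact h.color_lt A
  have htot : ∀ A : TwinClass G, w.totient (w.color (code A)) = Nat.totient A.card := fun A => by
    rw [h.color_eq, reductionThree_color, totient_eq ((hcard A).trans_le h.base_le)]
  let ε : ∀ A : TwinClass G, {a : G // twinClass a = A} ≃ Fin (Nat.totient A.card) :=
    fun A => Finite.equivFinOfCardEq A.natCard_fiber
  let φ : G → ℕ := fun a => w.pair (code (twinClass a)) (ε _ ⟨a, rfl⟩)
  have hlt : ∀ a : G, (ε _ ⟨a, rfl⟩ : ℕ) < w.base := fun a =>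
    (ε _ ⟨a, rfl⟩).2.trans_le ((Nat.totient_le _).trans (hcard _).le)
  have hf : ∀ a, w.fst (φ a) = code (twinClass a) := fun a => h.fst_pair (h.code_lt _) (hlt a)
  have hs : ∀ a, w.snd (φ a) = ε _ ⟨a, rfl⟩ := fun a => h.snd_pair (h.code_lt _) (hlt a)
  have hε : ∀ {A : TwinClass G} (a : G) (ha : twinClass a = A),
      (ε A ⟨a, ha⟩ : ℕ) = ε (twinClass a) ⟨a, rfl⟩ := by
    rintro _ a rfl
    rfl
  refine ⟨φ, fun a b e => ?_, fun c => ⟨?_, ?_⟩, fun a b => ?_⟩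
  · have h1 : twinClass a = twinClass b := h.codes.injective (by rw [← hf, ← hf, e])
    have h2 := hs b
    rw [← e, hs, ← hε a h1] at h2
    exact congrArg Subtype.val ((ε _).injective (Fin.ext h2))
  · rintro ⟨a, rfl⟩
    refine ⟨h.pair_lt (h.code_lt _) (hlt a), ?_⟩
    rw [hf, hs, htot]
    exact ⟨h.codes.lt _, (ε _ _).2⟩
  · rintro ⟨hc, h1, h2⟩
    obtain ⟨i, hi, j, hj, rfl⟩ := h.exists_pair hc
    rw [h.fst_pair hi hj] at h1 h2
    rw [h.snd_pair hi hj] at h2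
    obtain ⟨A, rfl⟩ := (h.codes.exists_iff i).2 h1
    rw [htot] at h2
    obtain ⟨⟨a, rfl⟩, ha⟩ := (ε A).surjective ⟨j, h2⟩
    exact ⟨a, by simp only [φ, ha]⟩
  · rw [hf, hf, hle, directedPowerGraph_adj]
    exact Subgroup.zpowers_le

end World

theorem exists_solves_directedPowerGraph :
    ∃ (P : RamProg) (p : ℕ[X]), ∀ (n : ℕ) (X : ColoredGraph (Fin n)) (g : ℕ),
      (∃ (G : Type) (_ : Group G) (_ : Finite G), Nat.card G = g ∧ X.IsIso (reductionThree G)) →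
      P.Solves p g (encodeColoredGraph X) fun output => ∃ (k : ℕ) (D : Digraph (Fin k)),
        output = encodeDigraph D ∧ ∀ (G : Type) [Group G] [Finite G],
          X.IsIso (reductionThree G) → D.IsIso (directedPowerGraph G) := by
  have hR : Decides fun w e => w.fst (e 0) < w.order ∧
    w.snd (e 0) < w.totient (w.color (w.fst (e 0))) := inferInstance
  have hr : Decides fun w e => w.Below (w.fst (e 0)) (w.fst (e 1)) := inferInstance
  -- The colours written here are irrelevant, since a digraph is read from the first two arrays
  -- only. The bound 14 accounts for the iteration counter in array 13.
  have hreal := ((Realizable.emit (R := fun w c => w.fst c < w.order ∧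
    w.snd c < w.totient (w.color (w.fst c))) (r := fun w c d => w.Below (w.fst c) (w.fst d))
    (col := fun _ c => c) hR hr (.var 0)).mono (show 13 ≤ 14 by simp)).comp
    ((Realizable.stepBelow.iterate (by simp)).comp (Realizable.initBelow.mono (by simp)))
  obtain ⟨P, p, hP⟩ := hreal.exists_run_coloredGraph
  refine ⟨P, p.comp (X ^ 2 + X ^ 3 + 2), fun n X g hex s hs => ?_⟩
  obtain ⟨t, ht, s', hr, hw, hfr⟩ := hP s _ rfl
  obtain ⟨G₀, _, _, hg, hG₀⟩ := hex
  obtain ⟨code₀, hcode₀⟩ := World.readsColored_of_holds hs hG₀ rfl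
  obtain ⟨k, D, hD, hiso⟩ := World.Roomy.holds_digraph hcode₀.closeBelow.1.toRoomy hw
  refine ⟨t, ht.trans ?_, s', hr, fun a ha => hfr a (by omega), _, hD, k, D, rfl,
    fun G _ _ hG => ?_⟩
  · rw [eval_comp]
    refine p.eval_mono_nat (World.base_le_of_holds hs hG₀ rfl ?_ ?_)
    · exact hg ▸ natCard_twinClass_le.trans (Nat.le_self_pow (by simp) _)
    · exact fun a => hg ▸ (reductionThree_color a).trans_le a.card_le_natCard
  · obtain ⟨code, hcode⟩ := World.readsColored_of_holds hs hG rfl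
    obtain ⟨φ, h1, h2, h3⟩ := hcode.closeBelow.1.exists_code_group hcode.closeBelow.2
    exact hiso _ _ φ h1 h2 h3

/-! ## From the directed power graph to the enhanced power graph -/

/-- The vertices that have a common in-neighbour are joined. -/
def Digraph.commonGraph {V : Type*} (D : Digraph V) : SimpleGraph V :=
  SimpleGraph.fromRel fun u v => ∃ z, D.Adj z u ∧ D.Adj z v

theorem Digraph.commonGraph_adj {V : Type*} {D : Digraph V} {u v : V} :
    D.commonGraph.Adj u v ↔ u ≠ v ∧ ∃ z, D.Adj z u ∧ D.Adj z v := by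
  rw [Digraph.commonGraph, SimpleGraph.fromRel_adj]
  simp only [and_comm (a := D.Adj _ v), or_self]

theorem commonGraph_eq_comap {V G : Type*} [Group G] {D : Digraph V}
    (f : D.Adj ≃r (directedPowerGraph G).Adj) :
    D.commonGraph = (enhancedPowerGraph G).comap f := by
  ext u v
  rw [Digraph.commonGraph_adj]
  show _ ↔ f u ≠ f v ∧ ∃ z : G, f u ∈ Subgroup.zpowers z ∧ f v ∈ Subgroup.zpowers z
  simp only [f.injective.ne_iff, f.surjective.exists, ← directedPowerGraph_adj, f.map_rel_iff]

namespace World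

variable (w : World)

/-- Distinct numbers with a common in-neighbour. -/
def CommonAdj (u v : ℕ) : Prop := u ≠ v ∧ w.Ex w.order fun z => w.Adj z u ∧ w.Adj z v

end World

theorem Decides.commonAdj_base : Decides fun w e => w.CommonAdj (e 0) (e 1) := by
  unfold World.CommonAdj; infer_instance

/-- The vertices must keep their names, so the graph is not emitted anew: the matrix is overwritten
entry by entry, where entry c belongs to the pair of quotient and remainder of c modulo n. -/
theorem exists_solves_enhancedPowerGraph : ∃ (P : RamProg) (p : ℕ[X]),
    ∀ (n : ℕ) (D : Digraph (Fin n)),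
      P.Solves p n (encodeDigraph D) fun output => output = encodeGraph D.commonGraph := by
  classical
  have h1 : Decides fun w e => w.CommonAdj (w.div (e 0) w.order)
      (e 0 - w.mul (w.div (e 0) w.order) w.order) :=
    Decides.commonAdj_base.comp₂ inferInstance inferInstance
  have h2 : Evaluable fun w e => if w.CommonAdj (w.div (e 0) w.order)
      (e 0 - w.mul (w.div (e 0) w.order) w.order) then 1 else 0 := inferInstance
  obtain ⟨P, p, hP⟩ := (Realizable.write (a := 1) (f := fun w c =>
    if w.CommonAdj (w.div c w.order) (c - w.mul (w.div c w.order) w.order) then 1 else 0)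
    (by simp) h2).exists_run_graph
  refine ⟨P, p, fun n D s hs => ?_⟩
  obtain ⟨t, ht, s', hr, hw, hfr⟩ := hP s
  rw [encodeDigraph, RamState.holds_two, holdsWord_singleton, holdsWord_matrixWord] at hs
  have hR := World.reads_of_holds hs.1 hs.2 (Equiv.refl _) (r := D.Adj) (fun _ _ => Iff.rfl)
    (le_refl (n + 2))
  rw [hs.1] at ht hw
  refine ⟨t, ht, s', hr, fun a ha => hfr a (by omega), _, ?_, rfl⟩
  rw [encodeGraph, RamState.holds_two, holdsWord_singleton, holdsWord_matrixWord,
    hw.2.2 0 (by simp), hw.2.2 1 (by simp)]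
  refine ⟨hs.1, fun i j => ?_⟩
  have hij : (i : ℕ) * n + j < n ^ 2 := by
    have := i.2; have := j.2
    nlinarith
  have hlt : (i : ℕ) * n + j < (n + 2) ^ 4 :=
    hij.trans_le ((Nat.pow_le_pow_left (Nat.le_add_right n 2) 2).trans hR.sq_le)
  have hi : (i : ℕ) < (n + 2) ^ 4 := i.2.trans (hR.order_lt.trans_le hR.base_le |>.trans_eq' hs.1)
  have hd : World.div ⟨(n + 2) ^ 4, n + 2, s.arr⟩ ((i : ℕ) * n + j) n = i := by
    rw [World.div_eq hlt.le (by have := i.2; omega), mul_comm,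
      Nat.mul_add_div (by have := i.2; omega), Nat.div_eq_of_lt j.2, add_zero]
  have ho : World.order ⟨(n + 2) ^ 4, n + 2, s.arr⟩ = n := hs.1
  have hm : World.mul ⟨(n + 2) ^ 4, n + 2, s.arr⟩ i n = i * n :=
    World.mul_eq (w := ⟨(n + 2) ^ 4, n + 2, s.arr⟩) hi.le n
  simp only [World.write, Function.update_self, if_pos hlt, ho, hd, hm,
    Nat.add_sub_cancel_left]
  refine if_congr ?_ rfl rfl
  rw [Digraph.commonGraph_adj, World.CommonAdj, hR.codes.ex_iff]
  refine and_congr (not_congr Fin.ext_iff.symm) (exists_congr fun z => and_congr ?_ ?_)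
  · exact hR.adj_iff z i
  · exact hR.adj_iff z j

/-! ## Cyclic subgroups of nilpotent groups -/

theorem exists_equiv_of_natCard_fiber {α β ι κ : Type*} [Finite α] [Finite β] {f : α → ι}
    {g : β → κ} (Θ : ι ≃ κ)
    (h : ∀ i, Nat.card {a // f a = i} = Nat.card {b // g b = Θ i}) :
    ∃ ψ : α ≃ β, ∀ a, g (ψ a) = Θ (f a) := by
  let ε : ∀ i, {a // f a = i} ≃ {b // g b = Θ i} := fun i =>
    (Finite.equivFinOfCardEq (h i)).trans (Finite.equivFin _).symm
  refine ⟨(Equiv.sigmaFiberEquiv f).symm.trans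
    ((Equiv.sigmaCongr Θ ε).trans (Equiv.sigmaFiberEquiv g)), fun a => ?_⟩
  exact (ε (f a) ⟨a, rfl⟩).2

/-- The divisors form a chain: `n` is a power of a prime. -/
def Nat.ChainDvd (n : ℕ) : Prop := ∀ d e, d ∣ n → e ∣ n → d ∣ e ∨ e ∣ d

theorem Nat.ChainDvd.of_dvd {n m : ℕ} (h : n.ChainDvd) (hm : m ∣ n) : m.ChainDvd :=
  fun _ _ hd he => h _ _ (hd.trans hm) (he.trans hm)

theorem Nat.Prime.chainDvd_pow {p : ℕ} (hp : p.Prime) (k : ℕ) : (p ^ k).ChainDvd := by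
  intro d e hd he
  obtain ⟨i, -, rfl⟩ := (Nat.dvd_prime_pow hp).1 hd
  obtain ⟨j, -, rfl⟩ := (Nat.dvd_prime_pow hp).1 he
  exact (le_total i j).imp (pow_dvd_pow p) (pow_dvd_pow p)

theorem Nat.chainDvd_one : Nat.ChainDvd 1 := by
  simpa using Nat.prime_two.chainDvd_pow 0

theorem Nat.ChainDvd.exists_eq_pow {n : ℕ} (h : n.ChainDvd) (hn : n ≠ 0) :
    ∃ p k, p.Prime ∧ n = p ^ k := by
  by_cases h1 : n = 1
  · exact ⟨2, 0, Nat.prime_two, by simpa using h1⟩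
  · refine ⟨n.minFac, _, Nat.minFac_prime h1, Nat.eq_prime_pow_of_unique_prime_dvd hn
      fun {q} hq hqn => ?_⟩
    rcases h _ _ hqn n.minFac_dvd with hd | hd
    · exact (Nat.prime_dvd_prime_iff_eq hq (Nat.minFac_prime h1)).1 hd
    · exact ((Nat.prime_dvd_prime_iff_eq (Nat.minFac_prime h1) hq).1 hd).symm

theorem Nat.ChainDvd.dvd_or_dvd_of_mul {d m n : ℕ} (h : d.ChainDvd) (hd : d ≠ 0)
    (hmn : m.Coprime n) (hdvd : d ∣ m * n) : d ∣ m ∨ d ∣ n := by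
  obtain ⟨p, k, hp, rfl⟩ := h.exists_eq_pow hd
  by_cases hk : k = 0
  · simp [hk]
  · exact (hmn.isPrimePow_dvd_mul (hp.isPrimePow.pow hk)).1 hdvd

theorem Nat.ChainDvd.comparable {m n : ℕ} (hm : m.ChainDvd) (hn : n.ChainDvd) (hm0 : m ≠ 0)
    (hn0 : n ≠ 0) : m.Coprime n ∨ m ∣ n ∨ n ∣ m := by
  obtain ⟨p, i, hp, rfl⟩ := hm.exists_eq_pow hm0
  obtain ⟨q, j, hq, rfl⟩ := hn.exists_eq_pow hn0
  by_cases e : p = q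
  · subst e
    exact Or.inr ((le_total i j).imp (pow_dvd_pow p) (pow_dvd_pow p))
  · exact Or.inl (((Nat.coprime_primes hp hq).2 e).pow _ _)

/-- A finite nilpotent group is the product of its Sylow subgroups. In each factor both components
have orders that are powers of the same prime and coprime, so one of them is trivial. -/
theorem Group.IsNilpotent.commute_of_coprime {G : Type*} [Group G] [Finite G] [Group.IsNilpotent G]
    {a b : G} (h : (orderOf a).Coprime (orderOf b)) : Commute a b := by
  obtain ⟨e⟩ := ((Group.isNilpotent_of_finite_tfae (G := G)).out 0 4).1 ‹_›
  obtain ⟨f, rfl⟩ := e.surjective a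
  obtain ⟨k, rfl⟩ := e.surjective b
  rw [MulEquiv.orderOf_eq, MulEquiv.orderOf_eq] at h
  refine Commute.map (?_ : Commute f k) e
  refine Pi.commute_iff.2 fun p => Pi.commute_iff.2 fun P => ?_
  have hp : Nat.Prime p := Nat.prime_of_mem_primeFactors p.2
  have : Fact (Nat.Prime p) := ⟨hp⟩
  have hf : orderOf (f p P) ∣ orderOf f := by
    refine orderOf_dvd_of_pow_eq_one ?_
    rw [← Pi.pow_apply, ← Pi.pow_apply, pow_orderOf_eq_one]
    rfl
  have hk : orderOf (k p P) ∣ orderOf k := by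
    refine orderOf_dvd_of_pow_eq_one ?_
    rw [← Pi.pow_apply, ← Pi.pow_apply, pow_orderOf_eq_one]
    rfl
  have hcop : (orderOf (f p P)).Coprime (orderOf (k p P)) :=
    Nat.Coprime.coprime_dvd_left hf (h.coprime_dvd_right hk)
  obtain ⟨i, hi⟩ := IsPGroup.iff_orderOf.1 P.isPGroup' (f p P)
  obtain ⟨j, hj⟩ := IsPGroup.iff_orderOf.1 P.isPGroup' (k p P)
  rw [hi, hj] at hcop
  by_cases hi0 : i = 0
  · rw [orderOf_eq_one_iff.1 (by rw [hi, hi0, pow_zero] : orderOf (f p P) = 1)]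
    exact Commute.one_left _
  · have hj0 : j = 0 := by
      by_contra hj0
      exact hp.one_lt.ne'
        (Nat.eq_one_of_dvd_coprimes hcop (dvd_pow_self _ hi0) (dvd_pow_self _ hj0))
    rw [orderOf_eq_one_iff.1 (by rw [hj, hj0, pow_zero] : orderOf (k p P) = 1)]
    exact Commute.one_right _

/-- The power of ab with exponent o(b) is a power of a with exponent prime to o(a), hence a
generator of ⟨a⟩. -/
theorem mem_zpowers_mul_of_coprime {G : Type*} [Group G] [Finite G] {a b : G} (hab : Commute a b)
    (h : (orderOf a).Coprime (orderOf b)) : a ∈ Subgroup.zpowers (a * b) := by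
  have h1 : (a * b) ^ orderOf b = a ^ orderOf b := by
    rw [hab.mul_pow, pow_orderOf_eq_one, mul_one]
  have h2 : a ∈ Subgroup.zpowers (a ^ orderOf b) :=
    mem_zpowers_of_orderOf_le (Subgroup.npow_mem_zpowers a _) (Nat.Coprime.orderOf_pow h).ge
  rw [← h1] at h2
  exact mem_zpowers_trans h2 (Subgroup.npow_mem_zpowers _ _)

/-- The cyclic subgroups of prime power order. -/
def PrimaryClass (G : Type*) [Group G] : Type _ := {A : TwinClass G // A.card.ChainDvd}

section

variable {G : Type*} [Group G] [Finite G]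

namespace TwinClass

theorem eq_of_le_of_card_dvd {A B : TwinClass G} (h : A.zpowers ≤ B.zpowers)
    (hd : B.card ∣ A.card) : A = B :=
  zpowers_injective (Subgroup.eq_of_le_of_card_ge h (Nat.le_of_dvd A.card_pos hd))

/-- Divisibility may be tested on prime powers, and each prime power dividing the order of `A` is
the order of a primary subgroup of `A`. The two subgroups may live in different groups, which allows
orders to be compared along a bijection. -/
theorem card_dvd_of_primary {H : Type*} [Group H] [Finite H] {A : TwinClass G} {B : TwinClass H}
    (h : ∀ D : PrimaryClass G, D.1.zpowers ≤ A.zpowers →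
      ∃ E : TwinClass H, E.card = D.1.card ∧ E.zpowers ≤ B.zpowers) : A.card ∣ B.card := by
  refine (Nat.dvd_iff_prime_pow_dvd_dvd _ _).2 fun p k hp hd => ?_
  obtain ⟨D, hD, hc⟩ := exists_card_eq hd
  obtain ⟨E, hE, hEB⟩ := h ⟨D, hc ▸ hp.chainDvd_pow k⟩ hD
  rw [← hc, ← show E.card = D.card from hE]
  exact card_dvd hEB

theorem le_iff_primary {A B : TwinClass G} : A.zpowers ≤ B.zpowers ↔
    ∀ D : PrimaryClass G, D.1.zpowers ≤ A.zpowers → D.1.zpowers ≤ B.zpowers := by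
  refine ⟨fun h D hD => hD.trans h, fun h => ?_⟩
  obtain ⟨C, hC⟩ := A.exists_zpowers_eq_inf B
  have : C = A := by
    refine eq_of_le_of_card_dvd (hC ▸ inf_le_left) (card_dvd_of_primary fun D hD => ?_)
    exact ⟨D.1, rfl, hC ▸ le_inf hD (h D hD)⟩
  rw [this] at hC
  exact inf_eq_left.1 hC.symm

/-- The sole use of nilpotency. Take `A` of largest order among the cyclic subgroups whose primary
parts all belong to `S`. If some `B` in `S`, of p-power order, were not below `A`, the p-part of `A`
could be exchanged for `B`, and the result would be larger. -/
theorem exists_primary_iff_mem [Group.IsNilpotent G] {S : Set (PrimaryClass G)}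
    (hne : S.Nonempty) (hdown : ∀ B ∈ S, ∀ D : PrimaryClass G, D.1.zpowers ≤ B.1.zpowers → D ∈ S)
    (hchain : ∀ B ∈ S, ∀ D ∈ S, B.1.card.Coprime D.1.card ∨ B.1.zpowers ≤ D.1.zpowers ∨
      D.1.zpowers ≤ B.1.zpowers) :
    ∃ A : TwinClass G, ∀ B : PrimaryClass G, B.1.zpowers ≤ A.zpowers ↔ B ∈ S := by
  have hbot : ∀ B : TwinClass G, (twinClass (1 : G)).zpowers ≤ B.zpowers := fun B => by
    rw [zpowers_twinClass, Subgroup.zpowers_one_eq_bot]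
    exact bot_le
  obtain ⟨A, hA, hmax⟩ := Set.exists_max_image
    {A : TwinClass G | ∀ B : PrimaryClass G, B.1.zpowers ≤ A.zpowers → B ∈ S} card
    (Set.toFinite _) ⟨twinClass 1, fun B hB => by
      obtain ⟨D, hD⟩ := hne
      exact hdown D hD B (hB.trans (hbot _))⟩
  refine ⟨A, fun B => ⟨hA B, fun hB => ?_⟩⟩
  by_contra hBA
  obtain ⟨p, k, hp, hk⟩ := B.2.exists_eq_pow B.1.card_pos.ne'
  have hA0 := A.card_pos.ne'
  obtain ⟨A₁, hA₁, hc₁⟩ := exists_card_eq (Nat.ordProj_dvd A.card p)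
  obtain ⟨A₂, hA₂, hc₂⟩ := exists_card_eq (Nat.ordCompl_dvd A.card p)
  have hk0 : k ≠ 0 := by
    rintro rfl
    refine hBA (le_trans (le_of_eq ?_) (hbot A))
    refine Subgroup.eq_bot_of_card_eq _ (hk.trans (pow_zero _)) |>.trans ?_
    rw [zpowers_twinClass, Subgroup.zpowers_one_eq_bot]
  have hA₁S : (⟨A₁, hc₁ ▸ hp.chainDvd_pow _⟩ : PrimaryClass G) ∈ S := hA _ hA₁
  -- The p-part `A₁` is in `S`, so it is coprime to or comparable with `B`. If coprime it is
  -- trivial; containing `B` is excluded.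
  have hle : A₁.zpowers ≤ B.1.zpowers := by
    rcases hchain _ hA₁S B hB with h | h | h
    · have : A₁.card.Coprime B.1.card := h
      rw [hc₁, hk] at this
      have h0 : A.card.factorization p = 0 := by
        by_contra h0
        exact hp.one_lt.ne'
          (Nat.eq_one_of_dvd_coprimes this (dvd_pow_self _ h0) (dvd_pow_self _ hk0))
      rw [h0, pow_zero] at hc₁
      rw [Subgroup.eq_bot_of_card_eq _ hc₁]
      exact bot_le
    · exact h
    · exact absurd (h.trans hA₁) hBA
  obtain ⟨a, rfl⟩ := twinClass_surjective A₂
  obtain ⟨b, hb⟩ := twinClass_surjective B.1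
  have hcop : (orderOf a).Coprime (orderOf b) := by
    rw [← card_twinClass, ← card_twinClass, hb, hc₂, hk]
    exact (Nat.Coprime.pow_left _ (Nat.coprime_ordCompl hp hA0)).symm
  have hcomm := Group.IsNilpotent.commute_of_coprime hcop
  have ha' : a ∈ Subgroup.zpowers (a * b) := mem_zpowers_mul_of_coprime hcomm hcop
  have hb' : b ∈ Subgroup.zpowers (a * b) :=
    hcomm.eq ▸ mem_zpowers_mul_of_coprime hcomm.symm hcop.symm
  have hcard : (twinClass (a * b)).card = (twinClass a).card * B.1.card := by
    rw [card_twinClass, hcomm.orderOf_mul_eq_mul_orderOf_of_coprime hcop, ← hb, card_twinClass,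
      card_twinClass]
  have hlt : A₁.card < B.1.card := by
    refine card_lt (lt_of_le_of_ne hle fun e => hBA ?_)
    rw [← e]
    exact hA₁
  -- Here a generates the part of `A` prime to p and b generates `B`. They commute, so ab generates
  -- a cyclic group of order |A₂| |B| > |A|. A primary subgroup of it lies in one of the two
  -- factors, hence is in `S`.
  refine (hmax (twinClass (a * b)) fun D hD => ?_).not_gt ?_
  · have hd := card_dvd hD
    rw [hcard] at hd
    have hcop' : (twinClass a).card.Coprime B.1.card := by
      rw [← hb, card_twinClass, card_twinClass]
      exact hcop
    rcases D.2.dvd_or_dvd_of_mul D.1.card_pos.ne' hcop' hd with h | h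
    · have hle := (zpowers_le_iff_dvd (B := twinClass a) hD (Subgroup.zpowers_le.2 ha')).2 h
      exact hA D (hle.trans hA₂)
    · refine hdown B hB D ((zpowers_le_iff_dvd hD ?_).2 h)
      rw [← hb]
      exact Subgroup.zpowers_le.2 hb'
  · have e := Nat.ordProj_mul_ordCompl_eq_self A.card p
    rw [← hc₂, ← hc₁, mul_comm] at e
    rw [hcard, ← e]
    exact Nat.mul_lt_mul_of_pos_left hlt (card_pos _)

end TwinClass

end

section

variable {G H : Type*} [Group G] [Group H] [Finite G] [Finite H]

/-- A bijection between the cyclic subgroups of `G` and of `H` that respects inclusion and orders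
gives an isomorphism of directed power graphs. -/
theorem TwinClass.directedPowerGraph_isIso (Θ : TwinClass G ≃ TwinClass H)
    (hle : ∀ A B, (Θ A).zpowers ≤ (Θ B).zpowers ↔ A.zpowers ≤ B.zpowers)
    (hcard : ∀ A, (Θ A).card = A.card) : (directedPowerGraph G).IsIso (directedPowerGraph H) := by
  obtain ⟨ψ, hψ⟩ := exists_equiv_of_natCard_fiber (f := (twinClass : G → _))
    (g := (twinClass : H → _)) Θ fun A => by rw [natCard_fiber, natCard_fiber, hcard]
  refine ⟨ψ, fun {a b} => ?_⟩
  rw [directedPowerGraph_adj, directedPowerGraph_adj, ← Subgroup.zpowers_le, ← Subgroup.zpowers_le,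
    ← zpowers_twinClass, ← zpowers_twinClass, hψ, hψ, hle]
  exact Iff.rfl

/-- The primary subgroups of `A` are down-closed and pairwise coprime or comparable; `Φ` preserves
these conditions, so nilpotency of `H` supplies a subgroup with exactly their images below it. The
orders agree because they are determined by the orders of the primary parts. -/
theorem PrimaryClass.exists_twinClass [Group.IsNilpotent H] (Φ : PrimaryClass G ≃ PrimaryClass H)
    (hle : ∀ A B, (Φ A).1.zpowers ≤ (Φ B).1.zpowers ↔ A.1.zpowers ≤ B.1.zpowers)
    (hcard : ∀ A, (Φ A).1.card = A.1.card) (A : TwinClass G) :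
    ∃ A' : TwinClass H, (∀ B, (Φ B).1.zpowers ≤ A'.zpowers ↔ B.1.zpowers ≤ A.zpowers) ∧
      A'.card = A.card := by
  suffices h : ∃ A' : TwinClass H, ∀ B : PrimaryClass H,
      B.1.zpowers ≤ A'.zpowers ↔ B ∈ {D | (Φ.symm D).1.zpowers ≤ A.zpowers} by
    obtain ⟨A', hA'⟩ := h
    have key : ∀ B, (Φ B).1.zpowers ≤ A'.zpowers ↔ B.1.zpowers ≤ A.zpowers := fun B => by
      rw [hA', Set.mem_ofPred_eq, Equiv.symm_apply_apply]
    refine ⟨A', key, Nat.dvd_antisymm (TwinClass.card_dvd_of_primary fun D hD => ?_)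
      (TwinClass.card_dvd_of_primary fun D hD => ⟨(Φ D).1, hcard D, (key D).2 hD⟩)⟩
    obtain ⟨D, rfl⟩ := Φ.surjective D
    exact ⟨D.1, (hcard D).symm, (key D).1 hD⟩
  refine TwinClass.exists_primary_iff_mem ?_ ?_ ?_
  · obtain ⟨D, hD, hc⟩ := TwinClass.exists_card_eq (one_dvd A.card)
    let D' : PrimaryClass G := ⟨D, hc ▸ Nat.chainDvd_one⟩
    refine ⟨Φ D', ?_⟩
    rw [Set.mem_ofPred_eq, Equiv.symm_apply_apply]
    exact hD
  · intro B hB D hDB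
    obtain ⟨B, rfl⟩ := Φ.surjective B
    obtain ⟨D, rfl⟩ := Φ.surjective D
    rw [Set.mem_ofPred_eq, Equiv.symm_apply_apply] at *
    exact ((hle _ _).1 hDB).trans hB
  · intro B hB D hD
    obtain ⟨B, rfl⟩ := Φ.surjective B
    obtain ⟨D, rfl⟩ := Φ.surjective D
    rw [Set.mem_ofPred_eq, Equiv.symm_apply_apply] at hB hD
    rw [hle, hle, hcard, hcard, TwinClass.zpowers_le_iff_dvd hB hD,
      TwinClass.zpowers_le_iff_dvd hD hB]
    exact B.2.comparable D.2 B.1.card_pos.ne' D.1.card_pos.ne'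

/-- A finite nilpotent group is determined, up to isomorphism of directed power graphs, by its
cyclic subgroups of prime power order. -/
theorem PrimaryClass.directedPowerGraph_isIso [Group.IsNilpotent G] [Group.IsNilpotent H]
    (Φ : PrimaryClass G ≃ PrimaryClass H)
    (hle : ∀ A B, (Φ A).1.zpowers ≤ (Φ B).1.zpowers ↔ A.1.zpowers ≤ B.1.zpowers)
    (hcard : ∀ A, (Φ A).1.card = A.1.card) :
    (directedPowerGraph G).IsIso (directedPowerGraph H) := by
  choose Θ hΘ hcΘ using exists_twinClass Φ hle hcard
  have hΘle : ∀ A B, (Θ A).zpowers ≤ (Θ B).zpowers ↔ A.zpowers ≤ B.zpowers := fun A B => by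
    rw [TwinClass.le_iff_primary, TwinClass.le_iff_primary (A := A), Φ.surjective.forall]
    simp only [hΘ]
  refine TwinClass.directedPowerGraph_isIso
    (.ofBijective Θ ⟨fun A B e => ?_, fun A' => ?_⟩) hΘle hcΘ
  · exact TwinClass.zpowers_injective
      (le_antisymm ((hΘle A B).1 (e ▸ le_rfl)) ((hΘle B A).1 (e ▸ le_rfl)))
  · obtain ⟨A, hA, -⟩ := exists_twinClass Φ.symm
      (fun B D => by rw [← hle, Φ.apply_symm_apply, Φ.apply_symm_apply])
      (fun B => by rw [← hcard, Φ.apply_symm_apply]) A'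
    have h : ∀ B : PrimaryClass H, B.1.zpowers ≤ (Θ A).zpowers ↔ B.1.zpowers ≤ A'.zpowers := by
      intro B
      rw [← hA, ← hΘ, Φ.apply_symm_apply]
    exact ⟨A, TwinClass.zpowers_injective (le_antisymm (TwinClass.le_iff_primary.2 fun B => (h B).1)
      (TwinClass.le_iff_primary.2 fun B => (h B).2))⟩

end

/-! ## Refinement of colours -/

/-- Two rooted trees, where `C a c` means that c is a child of a. If related nodes always have their
children matched with related partners, the matching at the roots propagates downwards to an
isomorphism. Rank makes the recursion along parents well founded. -/
theorem exists_equiv_of_children {α β : Type*} {C : α → α → Prop} {C' : β → β → Prop}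
    {rank : α → ℕ} {rank' : β → ℕ} (hC : ∀ a c, C a c → rank a < rank c)
    (hC' : ∀ a c, C' a c → rank' a < rank' c) {r : α} {r' : β} (hr : ∀ c, c ≠ r → ∃ a, C a c)
    (hr' : ∀ c, c ≠ r' → ∃ a, C' a c) (hroot' : ∀ a, ¬ C' a r')
    (hroot : ∀ a, ¬ C a r) (huniq : ∀ a b c, C a c → C b c → a = b)
    (huniq' : ∀ a b c, C' a c → C' b c → a = b) {R : α → β → Prop}
    (hR : ∀ a b, R a b → ∃ e : {c // C a c} ≃ {d // C' b d}, ∀ c, R c.1 (e c).1) (h0 : R r r') :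
    ∃ Φ : α ≃ β, (∀ a c, C a c ↔ C' (Φ a) (Φ c)) ∧ ∀ a, R a (Φ a) := by
  classical
  choose e he using hR
  choose par hpar using hr
  -- The image of c is its partner in the matching chosen between the children of its parent and
  -- those of the image of the parent. The relation `R` is carried along, since the matching exists
  -- only for related nodes.
  let F : ∀ c, (∀ a, rank a < rank c → {b // R a b}) → {b // R c b} := fun c rec =>
    if h : c = r then ⟨r', h ▸ h0⟩
    else
      have hlt := hC _ _ (hpar c h)
      ⟨(e (par c h) (rec _ hlt).1 (rec _ hlt).2 ⟨c, hpar c h⟩).1,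
        he (par c h) (rec _ hlt).1 (rec _ hlt).2 ⟨c, hpar c h⟩⟩
  let Φ : ∀ a, {b // R a b} := (measure rank).wf.fix F
  have hΦ : ∀ c, Φ c = F c fun a _ => Φ a := (measure rank).wf.fix_eq F
  have h1 : (Φ r).1 = r' := by rw [hΦ]; simp [F]
  have h2 : ∀ a c (h : C a c), (Φ c).1 = (e a (Φ a).1 (Φ a).2 ⟨c, h⟩).1 := by
    intro a c h
    have hc : c ≠ r := fun hc => hroot a (hc ▸ h)
    obtain rfl := huniq _ _ _ h (hpar c hc)
    rw [hΦ]
    simp only [F, dif_neg hc]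
  have h3 : ∀ a c, C a c → C' (Φ a).1 (Φ c).1 := fun a c h => by
    rw [h2 a c h]
    exact (e a (Φ a).1 (Φ a).2 ⟨c, h⟩).2
  have hne : ∀ c, c ≠ r → (Φ c).1 ≠ r' := fun c hc e' => hroot' _ (e' ▸ h3 _ _ (hpar c hc))
  have hinj : ∀ n a b, rank a = n → (Φ a).1 = (Φ b).1 → a = b := by
    intro n
    induction n using Nat.strong_induction_on with
    | _ n ih =>
      intro a b hn hab
      by_cases ha : a = r
      · by_contra hb
        exact hne b (fun hb' => hb (ha.trans hb'.symm)) (by rw [← hab, ha, h1])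
      · have hb : b ≠ r := fun hb => hne a ha (by rw [hab, hb, h1])
        have hp := hpar a ha
        have hq := hpar b hb
        have hpq : par a ha = par b hb := ih _ (hn ▸ hC _ _ hp) _ _ rfl
          (huniq' _ _ _ (h3 _ _ hp) (hab ▸ h3 _ _ hq))
        rw [← hpq] at hq
        rw [h2 _ _ hp, h2 _ _ hq] at hab
        exact congrArg Subtype.val ((e _ _ _).injective (Subtype.ext hab))
  have hsurj : ∀ n b, rank' b = n → ∃ a, (Φ a).1 = b := by
    intro n
    induction n using Nat.strong_induction_on with
    | _ n ih =>
      intro b hn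
      by_cases hb : b = r'
      · exact ⟨r, h1.trans hb.symm⟩
      · obtain ⟨q, hq⟩ := hr' b hb
        obtain ⟨p, rfl⟩ := ih _ (hn ▸ hC' _ _ hq) q rfl
        refine ⟨((e p (Φ p).1 (Φ p).2).symm ⟨b, hq⟩).1, ?_⟩
        rw [h2 p _ ((e p (Φ p).1 (Φ p).2).symm ⟨b, hq⟩).2]
        exact congrArg Subtype.val ((e p (Φ p).1 (Φ p).2).apply_symm_apply ⟨b, hq⟩)
  refine ⟨.ofBijective (fun a => (Φ a).1) ⟨fun a b => hinj _ a b rfl, fun b => hsurj _ b rfl⟩,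
    fun a c => ⟨h3 a c, fun h => ?_⟩, fun a => (Φ a).2⟩
  have hc : c ≠ r := by
    rintro rfl
    exact hroot' (Φ a).1 (h1 ▸ (h : C' (Φ a).1 (Φ c).1))
  have : par c hc = a := hinj _ _ _ rfl (huniq' _ _ _ (h3 _ _ (hpar c hc)) h)
  exact this ▸ hpar c hc

namespace ColoredGraph

variable {V W : Type*}

/-- `x` is a neighbour of `u` of a larger colour, which is a prime power. -/
def Child (Z : ColoredGraph V) (u x : V) : Prop :=
  Z.Adj u x ∧ Z.color u < Z.color x ∧ (Z.color x).ChainDvd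

/-- Vertices that are not distinguished by `k` rounds of colour refinement. -/
def Refine (Z : ColoredGraph V) : ℕ → V → V → Prop
  | 0, u, v => Z.color u = Z.color v
  | k + 1, u, v => Z.Refine k u v ∧ ∀ y, Set.ncard {x | Z.Child u x ∧ Z.Refine k y x} =
      Set.ncard {x | Z.Child v x ∧ Z.Refine k y x}

/-- The disjoint union of two coloured graphs. -/
def sum (X : ColoredGraph V) (Y : ColoredGraph W) : ColoredGraph (V ⊕ W) where
  toSimpleGraph := X.toSimpleGraph ⊕g Y.toSimpleGraph
  color := Sum.elim X.color Y.color

variable {Z : ColoredGraph V}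

theorem refine_equivalence (k : ℕ) : Equivalence (Z.Refine k) := by
  induction k with
  | zero => exact ⟨fun _ => rfl, fun h => Eq.symm h, fun h h' => Eq.trans h h'⟩
  | succ k ih =>
    exact ⟨fun u => ⟨ih.refl u, fun _ => rfl⟩, fun h => ⟨ih.symm h.1, fun y => (h.2 y).symm⟩,
      fun h h' => ⟨ih.trans h.1 h'.1, fun y => (h.2 y).trans (h'.2 y)⟩⟩

theorem Refine.mono {k l : ℕ} (hkl : k ≤ l) {u v : V} (h : Z.Refine l u v) : Z.Refine k u v := by
  induction l, hkl using Nat.le_induction with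
  | base => exact h
  | succ l _ ih => exact ih h.1

theorem Refine.color_eq {k : ℕ} {u v : V} (h : Z.Refine k u v) : Z.color u = Z.color v :=
  h.mono (Nat.zero_le k)

/-- Another round of refinement compares the numbers of children in every class of the previous
round; equal numbers give a bijection that respects the classes. -/
theorem Refine.exists_equiv [Finite V] {k : ℕ} {u v : V} (h : Z.Refine (k + 1) u v) :
    ∃ ψ : {x // Z.Child u x} ≃ {x // Z.Child v x}, ∀ x, Z.Refine k x.1 (ψ x).1 := by
  let S : Setoid V := ⟨Z.Refine k, refine_equivalence k⟩
  have hcard : ∀ (u : V) (y : V), Nat.card {x : {x // Z.Child u x} // (⟦x.1⟧ : Quotient S) = ⟦y⟧} =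
      Set.ncard {x | Z.Child u x ∧ Z.Refine k y x} := by
    intro u y
    rw [← Nat.card_coe_set_eq]
    refine Nat.card_congr ((Equiv.subtypeSubtypeEquivSubtypeInter (fun x => Z.Child u x)
      fun x => (⟦x⟧ : Quotient S) = ⟦y⟧).trans (Equiv.subtypeEquivRight fun x => ?_))
    refine and_congr_right fun _ => Quotient.eq.trans ⟨fun h => S.symm h, fun h => S.symm h⟩
  obtain ⟨ψ, hψ⟩ := exists_equiv_of_natCard_fiber
    (f := fun x : {x // Z.Child u x} => (⟦x.1⟧ : Quotient S))
    (g := fun x : {x // Z.Child v x} => (⟦x.1⟧ : Quotient S)) (Equiv.refl _) (by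
      intro i
      induction i using Quotient.inductionOn with | _ y
      exact (hcard u y).trans ((h.2 y).trans (hcard v y).symm))
  exact ⟨ψ, fun x => S.symm (Quotient.exact (hψ x))⟩

/-- Refinement is defined from adjacency and colours alone, so it can never tell a vertex from its
image under an automorphism. -/
theorem refine_apply (σ : Z.toSimpleGraph ≃g Z.toSimpleGraph)
    (hσ : ∀ v, Z.color (σ v) = Z.color v) (k : ℕ) (u : V) : Z.Refine k u (σ u) := by
  induction k generalizing u with
  | zero => exact (hσ u).symm
  | succ k ih =>
    refine ⟨ih u, fun y => ?_⟩
    rw [← Set.ncard_image_of_injective _ σ.injective]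
    congr 1
    ext x
    obtain ⟨x, rfl⟩ := σ.surjective x
    rw [σ.injective.mem_set_image]
    have h1 : Z.Child (σ u) (σ x) ↔ Z.Child u x := by
      rw [Child, Child, hσ, hσ, σ.map_adj_iff]
    have h2 : Z.Refine k y (σ x) ↔ Z.Refine k y x :=
      ⟨fun h => (refine_equivalence k).trans h ((refine_equivalence k).symm (ih x)),
        fun h => (refine_equivalence k).trans h (ih x)⟩
    simp only [Set.mem_ofPred_eq, h1, h2]

/-- The vertices of colour `1` are not distinguished. -/
def RootsRefine (Z : ColoredGraph V) (k : ℕ) : Prop :=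
  ∀ u v, Z.color u = 1 → Z.color v = 1 → Z.Refine k u v

end ColoredGraph

section

variable {G : Type*} [Group G]

theorem TwinClass.eq_of_card_eq_one {A B : TwinClass G} (hA : A.card = 1) (hB : B.card = 1) :
    A = B :=
  zpowers_injective ((Subgroup.eq_bot_of_card_eq _ hA).trans (Subgroup.eq_bot_of_card_eq _ hB).symm)

theorem TwinClass.card_one : (twinClass (1 : G)).card = 1 := by
  rw [card_twinClass, orderOf_one]

/-- The trivial subgroup. -/
noncomputable def PrimaryClass.root (G : Type*) [Group G] : PrimaryClass G :=
  ⟨twinClass 1, by rw [TwinClass.card_one]; exact Nat.chainDvd_one⟩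

variable [Finite G]

namespace PrimaryClass

/-- `C` covers `A`. -/
def Child (A C : PrimaryClass G) : Prop := A.1.IsCover C.1

theorem exists_child {C : PrimaryClass G} {B : TwinClass G} (h : B.zpowers < C.1.zpowers) :
    ∃ A : PrimaryClass G, B.zpowers ≤ A.1.zpowers ∧ Child A C := by
  obtain ⟨A, h1, h2⟩ := TwinClass.exists_isCover h
  exact ⟨⟨A, C.2.of_dvd (TwinClass.card_dvd h2.1.le)⟩, h1, h2⟩

theorem exists_child_of_ne_root {C : PrimaryClass G} (h : C ≠ root G) : ∃ A, Child A C := by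
  have : (twinClass (1 : G)).zpowers < C.1.zpowers := by
    rw [TwinClass.zpowers_twinClass, Subgroup.zpowers_one_eq_bot]
    refine bot_lt_iff_ne_bot.2 fun e => h (Subtype.ext (TwinClass.eq_of_card_eq_one ?_
      TwinClass.card_one))
    rw [TwinClass.card, e]
    exact Subgroup.card_bot
  obtain ⟨A, -, hA⟩ := exists_child this
  exact ⟨A, hA⟩

theorem not_child_root (A : PrimaryClass G) : ¬ Child A (root G) := fun h => by
  have h1 := TwinClass.card_lt h.1
  have h2 : (root G).1.card = 1 := TwinClass.card_one
  have := A.1.card_pos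
  omega

/-- The subgroups of a cyclic group of prime power order form a chain, so it has at most one maximal
subgroup. This is what makes the primary subgroups a tree; with all cyclic subgroups it would fail.
-/
theorem child_unique {A B C : PrimaryClass G} (hA : Child A C) (hB : Child B C) : A = B := by
  rcases C.2 _ _ (TwinClass.card_dvd hA.1.le) (TwinClass.card_dvd hB.1.le) with h | h
  · have hle := (TwinClass.zpowers_le_iff_dvd hA.1.le hB.1.le).2 h
    rcases hle.eq_or_lt with e | hlt
    · exact Subtype.ext (TwinClass.zpowers_injective e)
    · exact absurd ⟨hlt, hB.1⟩ (hA.2 B.1)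
  · have hle := (TwinClass.zpowers_le_iff_dvd hB.1.le hA.1.le).2 h
    rcases hle.eq_or_lt with e | hlt
    · exact Subtype.ext (TwinClass.zpowers_injective e.symm)
    · exact absurd ⟨hlt, hA.1⟩ (hB.2 A.1)

theorem le_iff_reflTransGen {A B : PrimaryClass G} :
    A.1.zpowers ≤ B.1.zpowers ↔ Relation.ReflTransGen Child A B := by
  constructor
  · intro h
    generalize hn : B.1.card = n
    induction n using Nat.strong_induction_on generalizing B with
    | _ n ih =>
      rcases h.eq_or_lt with e | hlt
      · rw [show A = B from Subtype.ext (TwinClass.zpowers_injective e)]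
      · obtain ⟨C, h1, h2⟩ := exists_child hlt
        exact (ih _ (hn ▸ TwinClass.card_lt h2.1) h1 rfl).tail h2
  · intro h
    induction h with
    | refl => exact le_rfl
    | tail _ h ih => exact ih.trans h.1.le

theorem reductionThree_child {A : TwinClass G} {C : TwinClass G} :
    (reductionThree G).Child A C ↔ A.IsCover C ∧ C.card.ChainDvd := by
  rw [ColoredGraph.Child, ← and_assoc, SimpleGraph.adj_comm, reductionThree_adj_and_color_lt,
    reductionThree_color]

end PrimaryClass

variable {H : Type*} [Group H] [Finite H]

theorem child_sum_inl {V W : Type*} {X : ColoredGraph V} {Y : ColoredGraph W} {u : V}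
    {x : V ⊕ W} : (X.sum Y).Child (Sum.inl u) x ↔ ∃ c, X.Child u c ∧ Sum.inl c = x := by
  rcases x with c | c
  · simp [ColoredGraph.Child, ColoredGraph.sum]
  · simp [ColoredGraph.Child, ColoredGraph.sum]

theorem child_sum_inr {V W : Type*} {X : ColoredGraph V} {Y : ColoredGraph W} {u : W}
    {x : V ⊕ W} : (X.sum Y).Child (Sum.inr u) x ↔ ∃ c, Y.Child u c ∧ Sum.inr c = x := by
  rcases x with c | c
  · simp [ColoredGraph.Child, ColoredGraph.sum]
  · simp [ColoredGraph.Child, ColoredGraph.sum]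

/-- The disjoint union makes vertices of both graphs comparable by one refinement. It has no edges
across, so the children of a vertex stay on its side. -/
theorem PrimaryClass.exists_equiv_of_refine {k : ℕ} {A : PrimaryClass G} {B : PrimaryClass H}
    (h : ((reductionThree G).sum (reductionThree H)).Refine (k + 1) (Sum.inl A.1) (Sum.inr B.1)) :
    ∃ e : {C // Child A C} ≃ {D // Child B D}, ∀ C,
      ((reductionThree G).sum (reductionThree H)).Refine k (Sum.inl C.1.1) (Sum.inr (e C).1.1) := by
  obtain ⟨ψ, hψ⟩ := h.exists_equiv
  let ι : {C // Child A C} → {x // ((reductionThree G).sum (reductionThree H)).Child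
      (Sum.inl A.1) x} := fun C => ⟨Sum.inl C.1.1, child_sum_inl.2
    ⟨_, reductionThree_child.2 ⟨C.2, C.1.2⟩, rfl⟩⟩
  let κ : {D // Child B D} → {x // ((reductionThree G).sum (reductionThree H)).Child
      (Sum.inr B.1) x} := fun D => ⟨Sum.inr D.1.1, child_sum_inr.2
    ⟨_, reductionThree_child.2 ⟨D.2, D.1.2⟩, rfl⟩⟩
  have hι : Function.Bijective ι := by
    constructor
    · intro C D e
      exact Subtype.ext (Subtype.ext (Sum.inl_injective (congrArg Subtype.val e)))
    · rintro ⟨x, hx⟩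
      obtain ⟨c, hc, rfl⟩ := child_sum_inl.1 hx
      obtain ⟨h1, h2⟩ := reductionThree_child.1 hc
      exact ⟨⟨⟨c, h2⟩, h1⟩, rfl⟩
  have hκ : Function.Bijective κ := by
    constructor
    · intro C D e
      exact Subtype.ext (Subtype.ext (Sum.inr_injective (congrArg Subtype.val e)))
    · rintro ⟨x, hx⟩
      obtain ⟨c, hc, rfl⟩ := child_sum_inr.1 hx
      obtain ⟨h1, h2⟩ := reductionThree_child.1 hc
      exact ⟨⟨⟨c, h2⟩, h1⟩, rfl⟩
  refine ⟨(Equiv.ofBijective ι hι).trans (ψ.trans (Equiv.ofBijective κ hκ).symm), fun C => ?_⟩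
  have := hψ (ι C)
  rw [← (Equiv.ofBijective κ hκ).apply_symm_apply (ψ (ι C))] at this
  exact this

/-- Each level of the tree uses up one round. Nodes of order d are matched while N - d rounds are
left, and since orders grow along the tree and stay below N, the rounds never run out. -/
theorem directedPowerGraph_isIso_of_rootsRefine [Group.IsNilpotent G] [Group.IsNilpotent H] {N : ℕ}
    (hG : ∀ A : TwinClass G, A.card < N)
    (h : ((reductionThree G).sum (reductionThree H)).RootsRefine N) :
    (directedPowerGraph G).IsIso (directedPowerGraph H) := by
  let Z := (reductionThree G).sum (reductionThree H)
  obtain ⟨Φ, hΦ, hR⟩ := exists_equiv_of_children (C := PrimaryClass.Child (G := G))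
    (C' := PrimaryClass.Child (G := H)) (rank := fun A => A.1.card) (rank' := fun A => A.1.card)
    (fun A C h => TwinClass.card_lt h.1) (fun A C h => TwinClass.card_lt h.1)
    (fun C => PrimaryClass.exists_child_of_ne_root) (fun C => PrimaryClass.exists_child_of_ne_root)
    PrimaryClass.not_child_root PrimaryClass.not_child_root
    (fun A B C => PrimaryClass.child_unique) (fun A B C => PrimaryClass.child_unique)
    (R := fun A B => Z.Refine (N - A.1.card) (Sum.inl A.1) (Sum.inr B.1)) (fun A B hAB => by
      have hlt := hG A.1
      obtain ⟨k, hk⟩ : ∃ k, N - A.1.card = k + 1 := ⟨N - A.1.card - 1, by omega⟩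
      rw [hk] at hAB
      obtain ⟨e, he⟩ := PrimaryClass.exists_equiv_of_refine hAB
      refine ⟨e, fun C => (he C).mono ?_⟩
      have := TwinClass.card_lt C.2.1
      omega)
    ((h (Sum.inl (PrimaryClass.root G).1) (Sum.inr (PrimaryClass.root H).1)
      ((reductionThree_color _).trans TwinClass.card_one)
      ((reductionThree_color _).trans TwinClass.card_one)).mono (Nat.sub_le _ _))
  refine PrimaryClass.directedPowerGraph_isIso Φ (fun A B => ?_) fun A => ?_
  · rw [PrimaryClass.le_iff_reflTransGen, PrimaryClass.le_iff_reflTransGen]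
    constructor
    · intro h
      have := h.lift Φ.symm fun a b hab => (hΦ _ _).2 (by simpa using hab)
      simpa [Function.onFun] using this
    · exact fun h => h.lift Φ fun a b hab => (hΦ a b).1 hab
  · have := (hR A).color_eq
    exact ((reductionThree_color A.1).symm.trans (this.trans (reductionThree_color _))).symm

end

/-- An isomorphism and its inverse together form an automorphism of the disjoint union that
exchanges the two sides. Each side has a single vertex of colour 1, so the automorphism exchanges
the roots. -/
theorem rootsRefine_of_isIso {G H : Type*} [Group G] [Group H]
    (h : (reductionThree G).IsIso (reductionThree H)) (N : ℕ) :
    ((reductionThree G).sum (reductionThree H)).RootsRefine N := by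
  obtain ⟨f, hf⟩ := h
  let Z := (reductionThree G).sum (reductionThree H)
  let σ : Z.toSimpleGraph ≃g Z.toSimpleGraph :=
    ⟨(Equiv.sumCongr f.toEquiv f.toEquiv.symm).trans (Equiv.sumComm _ _), fun {a b} => by
      rcases a with a | a <;> rcases b with b | b
      · exact f.map_adj_iff
      · exact Iff.rfl
      · exact Iff.rfl
      · exact f.symm.map_adj_iff⟩
  have hσ : ∀ v, Z.color (σ v) = Z.color v := by
    rintro (a | b)
    · exact hf a
    · have := hf (f.symm b)
      rw [f.apply_symm_apply] at this
      exact this.symm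
  have hl : ∀ {A B : TwinClass G}, Z.color (Sum.inl A) = 1 → Z.color (Sum.inl B) = 1 → A = B :=
    fun hA hB => TwinClass.eq_of_card_eq_one ((reductionThree_color _).symm.trans hA)
      ((reductionThree_color _).symm.trans hB)
  have hr : ∀ {A B : TwinClass H}, Z.color (Sum.inr A) = 1 → Z.color (Sum.inr B) = 1 → A = B :=
    fun hA hB => TwinClass.eq_of_card_eq_one ((reductionThree_color _).symm.trans hA)
      ((reductionThree_color _).symm.trans hB)
  have key : ∀ A B, Z.color (Sum.inl A) = 1 → Z.color (Sum.inr B) = 1 →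
      Z.Refine N (Sum.inl A) (Sum.inr B) := fun A B hA hB => by
    have := ColoredGraph.refine_apply σ hσ N (Sum.inl A)
    rwa [show σ (Sum.inl A) = Sum.inr B from
      congrArg Sum.inr (hr ((hσ (Sum.inl A)).trans hA) hB)] at this
  rintro (A | A) (B | B) hA hB
  · rw [hl hA hB]
    exact (ColoredGraph.refine_equivalence N).refl _
  · exact key A B hA hB
  · exact (ColoredGraph.refine_equivalence N).symm (key B A hB hA)
  · rw [hr hA hB]
    exact (ColoredGraph.refine_equivalence N).refl _

/-! ## The program for the refinement of colours -/

namespace World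

variable (w : World)

/-- Prime powers. -/
def ChainDvd (n : ℕ) : Prop := w.All (n + 1) fun d => w.All (n + 1) fun e =>
  w.Dvd d n → w.Dvd e n → w.Dvd d e ∨ w.Dvd e d

/-- See `ColoredGraph.Child`. -/
def Child (u x : ℕ) : Prop := w.Adj u x ∧ w.color u < w.color x ∧ w.ChainDvd (w.color x)

/-- See `ColoredGraph.Refine`, where the fourth array holds the relation of the previous round. -/
def RefineStep (u v : ℕ) : Prop := w.Below u v ∧ w.All w.order fun y =>
  (w.count w.order fun x => w.Child u x ∧ w.Below y x) =
    w.count w.order fun x => w.Child v x ∧ w.Below y x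

open Classical in
/-- The relation of having the same colour is written into the fourth array. -/
noncomputable def initRefine : World :=
  w.write 3 fun c => if w.color (w.fst c) = w.color (w.snd c) then 1 else 0

open Classical in
/-- One round of refinement. -/
noncomputable def stepRefine : World :=
  w.write 3 fun c => if w.RefineStep (w.fst c) (w.snd c) then 1 else 0

/-- The relation in the fourth array does not distinguish vertices of colour `1`. -/
def RootsBelow : Prop := w.All w.order fun u => w.All w.order fun v =>
  w.color u = 1 → w.color v = 1 → w.Below u v

open Classical in
/-- The answer is written into the first array. -/
noncomputable def answerRoots : World := w.write 0 fun _ => if w.RootsBelow then 1 else 0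

end World

section Instances

variable {F G : World → (ℕ → ℕ) → ℕ} [hF : Evaluable F] [hG : Evaluable G]

theorem Decides.chainDvd_base : Decides fun w e => w.ChainDvd (e 0) := by
  unfold World.ChainDvd; infer_instance

instance Decides.chainDvd : Decides fun w e => w.ChainDvd (F w e) := comp₁ chainDvd_base hF

theorem Decides.child_base : Decides fun w e => w.Child (e 0) (e 1) := by
  unfold World.Child; infer_instance

instance Decides.child : Decides fun w e => w.Child (F w e) (G w e) := comp₂ child_base hF hG

theorem Decides.refineStep_base : Decides fun w e => w.RefineStep (e 0) (e 1) := by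
  unfold World.RefineStep; infer_instance

instance Decides.refineStep : Decides fun w e => w.RefineStep (F w e) (G w e) :=
  comp₂ refineStep_base hF hG

instance Decides.rootsBelow : Decides fun w _ => w.RootsBelow := by
  unfold World.RootsBelow; infer_instance

end Instances

theorem Realizable.initRefine : Realizable 13 World.initRefine := by
  classical
  have h : Evaluable fun w e =>
    if w.color (w.fst (e 0)) = w.color (w.snd (e 0)) then 1 else 0 := inferInstance
  exact .write (f := fun w c => if w.color (w.fst c) = w.color (w.snd c) then 1 else 0) (by simp) h

theorem Realizable.stepRefine : Realizable 13 World.stepRefine := by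
  classical
  have h : Evaluable fun w e =>
    if w.RefineStep (w.fst (e 0)) (w.snd (e 0)) then 1 else 0 := inferInstance
  exact .write (f := fun w c => if w.RefineStep (w.fst c) (w.snd c) then 1 else 0) (by simp) h

theorem Realizable.answerRoots : Realizable 13 World.answerRoots := by
  classical
  have h : Evaluable fun w _ => if w.RootsBelow then 1 else 0 := inferInstance
  exact .write (f := fun w _ => if w.RootsBelow then 1 else 0) (by simp) h

namespace World

variable {w : World} {V : Type*} {Z : ColoredGraph V} {code : V → ℕ}

theorem chainDvd_iff {n : ℕ} (hn : n < w.size) (h0 : 0 < n) : w.ChainDvd n ↔ n.ChainDvd := by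
  rw [ChainDvd, Nat.ChainDvd, World.all_iff hn]
  constructor
  · intro h d e hd he
    have h1 := Nat.le_of_dvd h0 hd
    have h2 := Nat.le_of_dvd h0 he
    have := (World.all_iff hn _).1 (h d (by omega)) e (by omega)
    rwa [dvd_iff hn, dvd_iff hn, dvd_iff (by omega), dvd_iff (by omega), imp_iff_right hd,
      imp_iff_right he] at this
  · intro h d hd
    rw [World.all_iff hn]
    intro e he
    rw [dvd_iff hn, dvd_iff hn, dvd_iff (by omega), dvd_iff (by omega)]
    exact h d e

theorem ReadsColored.child_iff (h : w.ReadsColored code Z) (a b : V) :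
    w.Child (code a) (code b) ↔ Z.Child a b := by
  rw [Child, ColoredGraph.Child, h.adj_iff, h.color_eq, h.color_eq]
  refine and_congr_right fun _ => and_congr_right fun hlt => ?_
  exact chainDvd_iff ((h.color_lt b).trans_le h.base_le) (by omega)

theorem ReadsColored.refine_init (h : w.ReadsColored code Z) (a b : V) :
    w.initRefine.Below (code a) (code b) ↔ Z.Refine 0 a b := by
  rw [initRefine, h.below_write _ (h.code_lt a) (h.code_lt b),
    h.fst_pair (h.code_lt a) (h.code_lt b), h.snd_pair (h.code_lt a) (h.code_lt b),
    h.color_eq, h.color_eq]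
  simp [ColoredGraph.Refine]

theorem ReadsColored.refine_step (h : w.ReadsColored code Z) {k : ℕ}
    (hk : ∀ a b, w.Below (code a) (code b) ↔ Z.Refine k a b) (a b : V) :
    w.stepRefine.Below (code a) (code b) ↔ Z.Refine (k + 1) a b := by
  rw [stepRefine, h.below_write _ (h.code_lt a) (h.code_lt b),
    h.fst_pair (h.code_lt a) (h.code_lt b), h.snd_pair (h.code_lt a) (h.code_lt b), RefineStep]
  simp only [ne_eq, ite_eq_right_iff, one_ne_zero, imp_false, not_not, h.codes.all_iff,
    h.codes.count_eq, h.child_iff, hk, ColoredGraph.Refine]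

/-- The world after the refinement. -/
noncomputable def refined (w : World) : World := stepRefine^[w.initRefine.size] w.initRefine

theorem ReadsColored.refined (h : w.ReadsColored code Z) :
    w.refined.ReadsColored code Z ∧
      ∀ a b, w.refined.Below (code a) (code b) ↔ Z.Refine w.size a b := by
  have key : ∀ m, (stepRefine^[m] w.initRefine).ReadsColored code Z ∧
      ∀ a b, (stepRefine^[m] w.initRefine).Below (code a) (code b) ↔ Z.Refine m a b := by
    intro m
    induction m with
    | zero => exact ⟨h.write _, h.refine_init⟩
    | succ m ih =>
      rw [Function.iterate_succ_apply']
      exact ⟨ih.1.write _, ih.1.refine_step ih.2⟩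
  exact key _

theorem ReadsColored.rootsBelow_refined (h : w.ReadsColored code Z) :
    w.refined.RootsBelow ↔ Z.RootsRefine w.size := by
  obtain ⟨h1, h2⟩ := h.refined
  rw [RootsBelow, h1.codes.all_iff]
  simp only [h1.codes.all_iff, h1.color_eq, h2]
  rfl

open Classical in
theorem ReadsColored.answerRoots_refined (h : w.ReadsColored code Z) :
    w.refined.answerRoots.arr 0 0 = if Z.RootsRefine w.size then 1 else 0 := by
  have h0 : 0 < w.refined.size :=
    (Nat.zero_lt_of_lt h.refined.1.one_lt).trans_le h.refined.1.base_le
  simp [answerRoots, World.write, h0, h.rootsBelow_refined]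

end World

theorem exists_solves_rootsRefine : ∃ (P : RamProg) (p : ℕ[X]), ∀ (n : ℕ)
    (X : ColoredGraph (Fin n)) (V : Type) (Z : ColoredGraph V) (g : ℕ), X.IsIso Z →
    Nat.card V ≤ g ^ 2 → (∀ a, Z.color a ≤ g) →
    P.Solves p g (encodeColoredGraph X) fun output => ∃ N, (∀ a, Z.color a < N) ∧
      output = encodeAnswer (Z.RootsRefine N) := by
  have hreal := (Realizable.answerRoots.mono (show 13 ≤ 14 by simp)).comp
    ((Realizable.stepRefine.iterate (by simp)).comp (Realizable.initRefine.mono (by simp)))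
  obtain ⟨P, p, hP⟩ := hreal.exists_run_coloredGraph
  refine ⟨P, p.comp (X ^ 2 + X ^ 3 + 2), fun n X V Z g hXZ hV hc s hs => ?_⟩
  obtain ⟨t, ht, s', hr, hw, hfr⟩ := hP s _ rfl
  obtain ⟨code, hcode⟩ := World.readsColored_of_holds hs hXZ rfl
  refine ⟨t, ht.trans ?_, s', hr, fun a ha => hfr a (by omega), _, ?_, _, fun a =>
    (hcode.color_lt a).trans_le hcode.base_le, rfl⟩
  · rw [eval_comp]
    exact p.eval_mono_nat (World.base_le_of_holds hs hXZ rfl hV hc)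
  · rw [encodeAnswer, RamState.holds_one, holdsWord_singleton, hw.2.2 0 (by simp)]
    exact hcode.answerRoots_refined

/-! ## Disjoint unions -/

theorem RamState.holds_append_three {s : RamState} {u v x : List ℕ} {l : List (List ℕ)} :
    s.Holds ([u, v, x] ++ l) ↔ s.Holds [u, v, x] ∧
      RamState.Holds ⟨s.reg, fun a => s.arr (a + 3)⟩ l := by
  rw [holds_iff, holds_iff, holds_iff]
  constructor
  · intro h
    refine ⟨fun a ha => ?_, fun a ha => ?_⟩
    · have := h a (by simp at ha ⊢; omega)
      rwa [List.getElem_append_left ha] at this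
    · have := h (a + 3) (by simp; omega)
      rw [List.getElem_append_right (by simp)] at this
      simpa using this
  · rintro ⟨h1, h2⟩ a ha
    by_cases h : a < 3
    · rw [List.getElem_append_left (by simpa using h)]
      exact h1 a h
    · rw [List.getElem_append_right (by simp; omega)]
      have := h2 (a - 3) (by simp at ha; omega)
      simp only [show a - 3 + 3 = a by omega] at this
      exact this

theorem ColoredGraph.IsIso.trans {U V W : Type*} {X : ColoredGraph U} {Y : ColoredGraph V}
    {Z : ColoredGraph W} (h : X.IsIso Y) (h' : Y.IsIso Z) : X.IsIso Z := by
  obtain ⟨f, hf⟩ := h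
  obtain ⟨k, hk⟩ := h'
  exact ⟨f.trans k, fun v => (hk _).trans (hf v)⟩

theorem ColoredGraph.IsIso.symm {U V : Type*} {X : ColoredGraph U} {Y : ColoredGraph V}
    (h : X.IsIso Y) : Y.IsIso X := by
  obtain ⟨f, hf⟩ := h
  refine ⟨f.symm, fun v => ?_⟩
  rw [← hf, f.apply_symm_apply]

theorem ColoredGraph.IsIso.sum {U V U' V' : Type*} {X : ColoredGraph U} {Y : ColoredGraph V}
    {X' : ColoredGraph U'} {Y' : ColoredGraph V'} (h : X.IsIso X') (h' : Y.IsIso Y') :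
    (X.sum Y).IsIso (X'.sum Y') := by
  obtain ⟨f, hf⟩ := h
  obtain ⟨k, hk⟩ := h'
  refine ⟨⟨Equiv.sumCongr f.toEquiv k.toEquiv, fun {a b} => ?_⟩, ?_⟩
  · rcases a with a | a <;> rcases b with b | b
    · exact f.map_adj_iff
    · exact Iff.rfl
    · exact Iff.rfl
    · exact k.map_adj_iff
  · rintro (a | a)
    · exact hf a
    · exact hk a

namespace World

variable (w : World)

/-- Adjacency in the disjoint union of the two graphs in the first six arrays. -/
def SumAdj (c d : ℕ) : Prop := (c < w.order ∧ d < w.order ∧ w.Adj c d) ∨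
  (w.order ≤ c ∧ w.order ≤ d ∧ w.arr 4 (w.mul (c - w.order) (w.arr 3 0) + (d - w.order)) ≠ 0)

open Classical in
/-- Colours in the disjoint union. -/
noncomputable def sumColor (c : ℕ) : ℕ :=
  if c < w.order then w.color c else w.arr 5 (c - w.order)

end World

theorem Decides.sumAdj_base : Decides fun w e => w.SumAdj (e 0) (e 1) := by
  unfold World.SumAdj; infer_instance

theorem Evaluable.sumColor_base : Evaluable fun w e => w.sumColor (e 0) := by
  unfold World.sumColor; infer_instance

namespace World

theorem presents_sum {w : World} (h : w.Roomy) {n m : ℕ} {X : ColoredGraph (Fin n)}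
    {Y : ColoredGraph (Fin m)} {s : RamState}
    (hs : s.Holds (encodeColoredGraph X ++ encodeColoredGraph Y)) (hw : w.arr = s.arr)
    (hnm : n + m < w.base) :
    w.Presents (fun c => c < w.order + w.arr 3 0) w.SumAdj w.sumColor (X.sum Y) := by
  classical
  rw [encodeColoredGraph, RamState.holds_append_three, encodeColoredGraph, RamState.holds_three,
    RamState.holds_three] at hs
  simp only [holdsWord_singleton, holdsWord_matrixWord, holdsWord_ofFn, ← hw] at hs
  obtain ⟨⟨h0, h1, h2⟩, h3, h4, h5⟩ := hs
  have ho : w.order = n := h0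
  have h3' : w.arr 3 0 = m := h3
  have hb := h.base_le
  have hsq : w.base ≤ w.base ^ 2 := Nat.le_self_pow (by simp) _
  refine ⟨Sum.elim (fun i => (i : ℕ)) fun j => n + j, ?_, fun c => ?_, ?_, ?_⟩
  · rintro (a | a) (b | b) e <;> simp only [Sum.elim_inl, Sum.elim_inr] at e
    · rw [Fin.ext e]
    · have := a.2; omega
    · have := b.2; omega
    · rw [Fin.ext (Nat.add_left_cancel e)]
  · rw [ho, h3']
    constructor
    · rintro ⟨a | a, rfl⟩
      · have := a.2
        simp only [Sum.elim_inl]; omega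
      · have := a.2
        simp only [Sum.elim_inr]; omega
    · rintro ⟨-, hc⟩
      by_cases hcn : c < n
      · exact ⟨Sum.inl ⟨c, hcn⟩, rfl⟩
      · exact ⟨Sum.inr ⟨c - n, by omega⟩, by simp only [Sum.elim_inr]; omega⟩
  · rintro (a | a) (b | b) <;> simp only [SumAdj, ho, h3', Sum.elim_inl, Sum.elim_inr] <;>
      have ha := a.2 <;> have hb := b.2
    · have := h1 a b
      simp only [ha, hb, true_and, Adj, ho, mul_eq (show (a : ℕ) ≤ w.size by omega), this]
      rw [or_iff_left (by omega)]
      simp [ColoredGraph.sum]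
    · refine iff_of_false (by omega) (by simp [ColoredGraph.sum])
    · refine iff_of_false (by omega) (by simp [ColoredGraph.sum])
    · have := h4 a b
      rw [or_iff_right (by omega), Nat.add_sub_cancel_left, Nat.add_sub_cancel_left,
        mul_eq (show (a : ℕ) ≤ w.size by omega)]
      simp only [Nat.reduceAdd] at this
      rw [this]
      simp [ColoredGraph.sum]
  · rintro (a | a)
    · have := a.2
      simp only [sumColor, ho, Sum.elim_inl, if_pos this]
      exact h2 a
    · simp only [sumColor, ho, Sum.elim_inr]
      rw [if_neg (by omega), Nat.add_sub_cancel_left]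
      exact h5 a

end World

theorem exists_solves_sum : ∃ (P : RamProg) (p : ℕ[X]), ∀ (n m : ℕ)
    (X : ColoredGraph (Fin n)) (Y : ColoredGraph (Fin m)) (g : ℕ), n ≤ g → m ≤ g →
    (∀ a, X.color a ≤ g) → (∀ a, Y.color a ≤ g) →
    P.Solves p g (encodeColoredGraph X ++ encodeColoredGraph Y) fun output =>
      ∃ (k : ℕ) (Z : ColoredGraph (Fin k)), output = encodeColoredGraph Z ∧
        Z.IsIso (X.sum Y) := by
  have hR : Decides fun w e => e 0 < w.order + w.arr 3 0 := inferInstance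
  have hreal := Realizable.emit (R := fun w c => c < w.order + w.arr 3 0) hR Decides.sumAdj_base
    Evaluable.sumColor_base
  have hf : Evaluable fun w _ => w.order + w.sum w.order (fun v => w.color v) +
    (w.arr 3 0 + w.sum (w.arr 3 0) (fun v => w.arr 5 v)) + 2 := inferInstance
  obtain ⟨P, p, hP⟩ := hreal.exists_run (.add (.load 0 (.const 0)) (.load 3 (.const 0))) _ hf
  refine ⟨P, p.comp (2 * X + 2 * X ^ 2 + 2), fun n m X Y g hn hm hX hY s hs => ?_⟩
  have hs' := hs
  rw [encodeColoredGraph, RamState.holds_append_three, encodeColoredGraph, RamState.holds_three,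
    RamState.holds_three] at hs'
  simp only [holdsWord_singleton, holdsWord_ofFn] at hs'
  obtain ⟨⟨h0, -, h2⟩, h3, -, h5⟩ := hs'
  simp only [Nat.reduceAdd, Nat.zero_add] at h3 h5
  obtain ⟨t, ht, s', hr, hw, hfr⟩ := hP s ⟨n + m, 0, s.arr⟩
    (by simp [RamExpr.eval, h0, h3]) (by simp only [World.order, h0, h3]; omega)
  set B := World.order ⟨n + m, 0, s.arr⟩ + World.sum ⟨n + m, 0, s.arr⟩
    (World.order ⟨n + m, 0, s.arr⟩) (fun v => World.color ⟨n + m, 0, s.arr⟩ v) +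
    (s.arr 3 0 + World.sum ⟨n + m, 0, s.arr⟩ (s.arr 3 0) (fun v => s.arr 5 v)) + 2 with hBdef
  have hB : n + m + 2 ≤ B ∧ B ≤ (2 * Polynomial.X + 2 * Polynomial.X ^ 2 + 2 : ℕ[X]).eval g := by
    have e1 : World.sum ⟨n + m, 0, s.arr⟩ n (fun v => s.arr 2 v) ≤ n * g := by
      rw [World.sum_eq (by simp)]
      refine (Finset.sum_le_card_nsmul _ _ g fun v hv => ?_).trans (by simp)
      rw [Finset.mem_range] at hv
      exact (h2 ⟨v, hv⟩).trans_le (hX _)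
    have e2 : World.sum ⟨n + m, 0, s.arr⟩ m (fun v => s.arr 5 v) ≤ m * g := by
      rw [World.sum_eq (by simp)]
      refine (Finset.sum_le_card_nsmul _ _ g fun v hv => ?_).trans (by simp)
      rw [Finset.mem_range] at hv
      exact (h5 ⟨v, hv⟩).trans_le (hY _)
    simp only [World.order, World.color, h0, h3] at hBdef
    simp only [eval_add, eval_mul, eval_pow, eval_X, eval_ofNat]
    constructor
    · omega
    · nlinarith
  have hroom : World.Roomy ⟨B ^ 4, B, s.arr⟩ := ⟨by simp only; omega, rfl⟩
  have hpres := World.presents_sum hroom hs rfl (by simp only; omega)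
  obtain ⟨k, Z, hZ, hiso⟩ := hroom.holds_coloredGraph hw ⟨_, _, hpres⟩
  refine ⟨t, ht.trans ?_, s', hr, fun a ha => hfr a (by omega), _, hZ, k, Z, rfl, hiso _ _ hpres⟩
  rw [eval_comp]
  exact p.eval_mono_nat hB.2

/-! ## Composition of the programs -/

/-- The two kinds of graphs to which the programs apply. -/
structure GraphKind (K : (G : Type) → [Group G] → SimpleGraph G) : Prop where
  ccgSet : ∃ (P : RamProg) (p : ℕ[X]), ∀ (n : ℕ) (X : SimpleGraph (Fin n)),
    P.Solves p n (encodeGraph X) fun output => ∃ S : Set (Fin n),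
      output = encodeMarkedGraph X S ∧ ∀ (G : Type) [Group G] [Finite G] (f : X ≃g K G),
        IsCCGSetUpToTwins (K G) (f '' S)
  detects : ∀ (G : Type) [Group G], (K G).DetectsMaxCyclic
  iso : ∀ (G H : Type) [Group G] [Group H], (directedPowerGraph G).IsIso (directedPowerGraph H) →
    Nonempty (K G ≃g K H)

theorem graphKind_powerGraph : GraphKind fun G _ => powerGraph G where
  ccgSet := exists_solves_ccgSet _ (fun _ _ => powerGraph_detects) _ Decides.powerTop_base
    fun _ _ _ _ _ h _ => h.powerTop_iff
  detects _ _ := powerGraph_detects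
  iso G H _ _ h := by
    obtain ⟨f⟩ := h
    refine ⟨f.toEquiv, fun {a b} => ?_⟩
    show (f a ≠ f b ∧ _) ↔ (a ≠ b ∧ _)
    rw [f.injective.ne_iff, ← f.map_rel_iff, ← f.map_rel_iff (a := b)]
    rfl

theorem graphKind_enhancedPowerGraph : GraphKind fun G _ => enhancedPowerGraph G where
  ccgSet := exists_solves_ccgSet _ (fun _ _ => enhancedPowerGraph_detects) _
    Decides.enhancedTop_base fun _ _ _ _ _ h _ => h.enhancedTop_iff
  detects _ _ := enhancedPowerGraph_detects
  iso G H _ _ h := by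
    obtain ⟨f⟩ := h
    have e : ∀ (K : Type) [Group K] (u v : K), (enhancedPowerGraph K).Adj u v ↔
        (directedPowerGraph K).commonGraph.Adj u v := fun K _ u v => by
      rw [commonGraph_eq_comap (RelIso.refl _)]
      rfl
    refine ⟨f.toEquiv, fun {a b} => ?_⟩
    rw [e, e, Digraph.commonGraph_adj, Digraph.commonGraph_adj, f.surjective.exists]
    show (f a ≠ f b ∧ ∃ z, (directedPowerGraph H).Adj (f z) (f a) ∧ _) ↔ _
    simp only [f.injective.ne_iff, ← f.map_rel_iff]
    rfl

variable {K : (G : Type) → [Group G] → SimpleGraph G}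

/-! ## Moving words between arrays -/

/-- The word of the array `b` is copied to the array `a`, where the cell `0` of the array `c` bounds
its length. -/
theorem exists_copyWord (c : ℕ) {a b : ℕ} (hab : a ≠ b) : ∃ (P : RamProg) (p : ℕ[X]),
    ∀ s : RamState, ∃ t ≤ p.eval (s.arr c 0), ∃ s', Runs P s t s' ∧
      (∀ d, d ≠ a → s'.arr d = s.arr d) ∧ ∀ u : List ℕ, u.length ≤ (s.arr c 0 + 2) ^ 4 →
        HoldsWord (s.arr b) u → HoldsWord (s'.arr a) u := by
  have hf : Evaluable fun w _ => w.size + 2 := inferInstance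
  -- Run only for its side effect: it puts the fourth power of the stride into register 0, so that
  -- the copying loop is long enough for a matrix, and changes no array.
  obtain ⟨P, p, hP⟩ := (Realizable.id (m := 0)).exists_run (.load c (.const 0)) _ hf
  refine ⟨P.seq (.copy b a), p.comp (X + 2) + (X * 12 + 6 : ℕ[X]).comp ((X + 2) ^ 4), fun s => ?_⟩
  obtain ⟨t, ht, s₁, hr, hw, hfr⟩ := hP s _ rfl (by simp)
  have hreg : s₁.reg 0 = (s.arr c 0 + 2) ^ 4 := hw.1
  have harr : s₁.arr = s.arr := funext fun d => hfr d (Nat.zero_le d)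
  obtain ⟨t', ht', s₂, hr', -, -, h⟩ := Runs.copy hab s₁
  rw [hreg, harr] at h
  rw [hreg] at ht'
  refine ⟨_, ?_, s₂, .seq hr hr', fun d hd => by rw [h, Function.update_of_ne hd], ?_⟩
  · rw [eval_add, eval_comp, eval_comp]
    refine Nat.add_le_add (by simpa [RamExpr.eval] using ht) (by simpa using ht')
  · intro u hu hb k x hx
    have hk : k < u.length := (List.getElem?_eq_some_iff.1 hx).1
    rw [h, Function.update_self, if_pos (hk.trans_le hu)]
    exact hb k x hx

/-- The words of `l` stand at the beginning of the arrays from `b` on. -/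
def RamState.HoldsAt (s : RamState) (b : ℕ) (l : List (List ℕ)) : Prop :=
  RamState.Holds ⟨s.reg, fun a => s.arr (a + b)⟩ l

theorem RamState.HoldsAt.congr {s s' : RamState} {b : ℕ} {l : List (List ℕ)} (h : s.HoldsAt b l)
    (hl : l.length ≤ 3) (hs : ∀ d, b ≤ d → d < b + 3 → s'.arr d = s.arr d) : s'.HoldsAt b l := by
  intro a k u hu x hx
  have ha : a < l.length := (List.getElem?_eq_some_iff.1 hu).1
  exact (congrFun (hs (a + b) (by omega) (by omega)) k).trans (h a k u hu x hx)

theorem exists_move {a b : ℕ} (hab : b + 3 ≤ a ∨ a + 3 ≤ b) : ∃ (P : RamProg) (p : ℕ[X]),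
    ∀ (s : RamState) (n : ℕ) (l : List (List ℕ)), s.arr b 0 = n → l.length ≤ 3 →
      (∀ u ∈ l, u.length ≤ (n + 2) ^ 4) → s.HoldsAt b l →
      ∃ t ≤ p.eval n, ∃ s', Runs P s t s' ∧ (∀ d, d < a ∨ a + 3 ≤ d → s'.arr d = s.arr d) ∧
        s'.HoldsAt a l := by
  obtain ⟨P, p, hP⟩ := exists_copyWord b (show a ≠ b by omega)
  obtain ⟨Q, q, hQ⟩ := exists_copyWord b (show a + 1 ≠ b + 1 by omega)
  obtain ⟨R, r, hR⟩ := exists_copyWord b (show a + 2 ≠ b + 2 by omega)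
  refine ⟨P.seq (Q.seq R), p + (q + r), fun s n l hn hl hlen hs => ?_⟩
  obtain ⟨t₁, ht₁, s₁, r₁, f₁, h₁⟩ := hP s
  obtain ⟨t₂, ht₂, s₂, r₂, f₂, h₂⟩ := hQ s₁
  obtain ⟨t₃, ht₃, s₃, r₃, f₃, h₃⟩ := hR s₂
  rw [f₁ b (by omega)] at ht₂ h₂
  rw [f₂ b (by omega), f₁ b (by omega)] at ht₃ h₃
  rw [hn] at *
  refine ⟨t₁ + (t₂ + t₃), by simp only [eval_add]; omega, s₃, .seq r₁ (.seq r₂ r₃),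
    fun d hd => by rw [f₃ d (by omega), f₂ d (by omega), f₁ d (by omega)], fun i k u hu => ?_⟩
  have hi : i < l.length := (List.getElem?_eq_some_iff.1 hu).1
  have hu' := hlen u (List.mem_of_getElem? hu)
  have hsu : HoldsWord (s.arr (i + b)) u := fun k x hx => hs i k u hu x hx
  suffices h : HoldsWord (s₃.arr (i + a)) u from h k
  obtain rfl | rfl | rfl : i = 0 ∨ i = 1 ∨ i = 2 := by omega
  · rw [Nat.zero_add] at *
    rw [f₃ a (by omega), f₂ a (by omega)]
    exact h₁ u hu' hsu
  · rw [Nat.add_comm 1] at *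
    rw [f₃ _ (by omega)]
    exact h₂ u hu' (by rwa [f₁ _ (by omega)])
  · rw [Nat.add_comm 2] at *
    exact h₃ u hu' (by rwa [f₂ _ (by omega), f₁ _ (by omega)])

theorem length_le_of_mem_encodeGraph {n : ℕ} {X : SimpleGraph (Fin n)} :
    ∀ u ∈ encodeGraph X, u.length ≤ (n + 2) ^ 4 := by
  have h1 : n + 2 ≤ (n + 2) ^ 4 := Nat.le_self_pow (by simp) _
  have h2 : (n + 2) ^ 2 ≤ (n + 2) ^ 4 := Nat.pow_le_pow_right (by omega) (by simp)
  have h3 : n * n ≤ (n + 2) ^ 2 := by nlinarith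
  simp only [encodeGraph, List.mem_cons, List.not_mem_nil, or_false]
  rintro u (rfl | rfl)
  · simp; omega
  · simp [matrixWord, Function.comp_def]; omega

theorem length_le_of_mem_encodeColoredGraph {n : ℕ} {X : ColoredGraph (Fin n)} :
    ∀ u ∈ encodeColoredGraph X, u.length ≤ (n + 2) ^ 4 := by
  have h1 : n + 2 ≤ (n + 2) ^ 4 := Nat.le_self_pow (by simp) _
  intro u hu
  have hu' : u ∈ encodeGraph X.toSimpleGraph ∨ u = List.ofFn X.color := by
    simpa [encodeColoredGraph, encodeGraph, or_assoc] using hu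
  rcases hu' with h | rfl
  · exact length_le_of_mem_encodeGraph u h
  · simp; omega

/-! ## The tasks -/

theorem GraphKind.findsCCGSet (hK : GraphKind K) : FindsCCGSetInPolyTime K := by
  obtain ⟨P, p, hP⟩ := hK.ccgSet
  -- The marked set stands in array 2, behind the retained graph, but the required output is a
  -- single word in array 0.
  obtain ⟨Q, q, hQ⟩ := exists_copyWord 0 (show 0 ≠ 2 by simp)
  refine ⟨P.seq Q, p + q, fun n X G _ _ f => ?_⟩
  rw [f.natCard_eq]
  obtain ⟨t, ht, s, hr, -, _, hs, S, rfl, hS⟩ := hP n X _ (RamState.holds_init _)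
  rw [encodeMarkedGraph, RamState.holds_three, holdsWord_singleton] at hs
  obtain ⟨t', ht', s', hr', -, h⟩ := hQ s
  rw [hs.1] at ht' h
  refine ⟨t + t', by rw [eval_add]; omega, s', .seq hr hr', _,
    RamState.holds_one.2 (h (setWord S) ?_ hs.2.2), S, rfl, hS G f⟩
  have : n + 2 ≤ (n + 2) ^ 4 := Nat.le_self_pow (by simp) _
  simp [setWord]
  omega

theorem GraphKind.constructsReductionFour (hK : GraphKind K) :
    ConstructsReductionFourInPolyTime K := by
  obtain ⟨P, p, hP⟩ := exists_solves_reductionFour K hK.detects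
  refine ⟨P, p, fun n X S G _ _ f hS => ?_⟩
  rw [f.natCard_eq]
  refine ((hP n X S ⟨G, _, ‹_›, f, hS⟩).mono ?_).computes
  rintro _ ⟨k, Y, rfl, h⟩
  exact ⟨k, Y, rfl, h G f hS⟩

theorem restoresReductionThree : RestoresReductionThreeInPolyTime := by
  obtain ⟨P, p, hP⟩ := exists_solves_reductionThree
  refine ⟨P, p, fun n X G _ _ hX => ((hP n X _ ⟨G, _, ‹_›, rfl, hX⟩).mono ?_).computes⟩
  rintro _ ⟨k, Y, rfl, h⟩
  exact ⟨k, Y, rfl, h G hX⟩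

theorem restoresDirectedPowerGraph : RestoresDirectedPowerGraphInPolyTime := by
  obtain ⟨P, p, hP⟩ := exists_solves_directedPowerGraph
  refine ⟨P, p, fun n X G _ _ hX => ((hP n X _ ⟨G, _, ‹_›, rfl, hX⟩).mono ?_).computes⟩
  rintro _ ⟨k, Y, rfl, h⟩
  exact ⟨k, Y, rfl, h G hX⟩

/-- From a graph of the given kind to the third reduction. -/
theorem GraphKind.exists_solves_reductionThree (hK : GraphKind K) :
    ∃ (P : RamProg) (p : ℕ[X]), ∀ (n : ℕ) (X : SimpleGraph (Fin n)),
      (∃ (G : Type) (_ : Group G) (_ : Finite G), Nonempty (X ≃g K G)) →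
      P.Solves p n (encodeGraph X) fun output => ∃ (k : ℕ) (Y : ColoredGraph (Fin k)),
        output = encodeColoredGraph Y ∧ ∀ (G : Type) [Group G] [Finite G],
          Nonempty (X ≃g K G) → Y.IsIso (reductionThree G) := by
  obtain ⟨P, p, hP⟩ := hK.ccgSet
  obtain ⟨Q, q, hQ⟩ := exists_solves_reductionFour K hK.detects
  obtain ⟨R, r, hR⟩ := _root_.exists_solves_reductionThree
  refine ⟨_, _, fun n X hX => (hP n X).seq (Q := Q.seq R) (q := q + r) ?_⟩
  obtain ⟨G, _, _, ⟨f⟩⟩ := hX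
  rintro _ ⟨S, rfl, hS⟩
  refine (hQ n X S ⟨G, _, ‹_›, f, hS G f⟩).seq ?_
  rintro _ ⟨k, Y, rfl, hY⟩
  refine (hR k Y n ⟨G, _, ‹_›, f.natCard_eq, hY G f (hS G f)⟩).mono ?_
  rintro _ ⟨l, Z, rfl, hZ⟩
  exact ⟨l, Z, rfl, fun G _ _ ⟨f⟩ => hZ G (hY G f (hS G f))⟩

theorem GraphKind.exists_solves_directedPowerGraph (hK : GraphKind K) :
    ∃ (P : RamProg) (p : ℕ[X]), ∀ (n : ℕ) (X : SimpleGraph (Fin n)) (G : Type) [Group G] [Finite G],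
      Nonempty (X ≃g K G) → P.Solves p n (encodeGraph X) fun output =>
        ∃ (k : ℕ) (D : Digraph (Fin k)), output = encodeDigraph D ∧
          D.IsIso (directedPowerGraph G) := by
  obtain ⟨P, p, hP⟩ := hK.exists_solves_reductionThree
  obtain ⟨Q, q, hQ⟩ := _root_.exists_solves_directedPowerGraph
  refine ⟨_, _, fun n X G _ _ hX => (hP n X ⟨G, _, ‹_›, hX⟩).seq (Q := Q) (q := q) ?_⟩
  obtain ⟨f⟩ := hX
  rintro _ ⟨k, Y, rfl, hY⟩
  refine (hQ k Y n ⟨G, _, ‹_›, f.natCard_eq, hY G ⟨f⟩⟩).mono ?_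
  rintro _ ⟨l, D, rfl, hD⟩
  exact ⟨l, D, rfl, hD G (hY G ⟨f⟩)⟩

theorem GraphKind.reconstructsDirectedPowerGraph (hK : GraphKind K) :
    ReconstructsDirectedPowerGraphInPolyTime K := by
  obtain ⟨P, p, hP⟩ := hK.exists_solves_directedPowerGraph
  refine ⟨P, p, fun n X G _ _ hX => ?_⟩
  rw [hX.some.natCard_eq]
  exact (hP n X G hX).computes

theorem constructsEnhancedFromDirected : ConstructsEnhancedFromDirectedInPolyTime := by
  obtain ⟨P, p, hP⟩ := exists_solves_enhancedPowerGraph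
  refine ⟨P, p, fun n D G _ _ f => ?_⟩
  rw [← Nat.card_congr f.toEquiv, Nat.card_fin, ← commonGraph_eq_comap f]
  exact (hP n D).computes

theorem constructsEnhancedFromPower : ConstructsEnhancedFromPowerInPolyTime := by
  obtain ⟨P, p, hP⟩ := graphKind_powerGraph.exists_solves_directedPowerGraph
  obtain ⟨Q, q, hQ⟩ := exists_solves_enhancedPowerGraph
  refine ⟨P.seq Q, p + q, fun n X G _ _ hX => ?_⟩
  rw [hX.some.natCard_eq]
  refine ((hP n X G hX).seq ?_).computes
  rintro _ ⟨k, D, rfl, ⟨f⟩⟩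
  have hk : k = n := by
    rw [← hX.some.natCard_eq, ← Nat.card_congr f.toEquiv, Nat.card_fin]
  subst hk
  refine (hQ _ D).mono ?_
  rintro _ rfl
  refine ⟨_, _, rfl, ⟨f.toEquiv, fun {a b} => ?_⟩⟩
  rw [commonGraph_eq_comap f]
  rfl

/-- From two graphs of the given kind to the third reductions. -/
theorem GraphKind.exists_solves_reductionThree_pair (hK : GraphKind K) :
    ∃ (P : RamProg) (p : ℕ[X]), ∀ (n m : ℕ) (X : SimpleGraph (Fin n)) (Y : SimpleGraph (Fin m))
      (G H : Type) [Group G] [Finite G] [Group H] [Finite H],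
      Nonempty (X ≃g K G) → Nonempty (Y ≃g K H) →
      ∀ s : RamState, s.Holds (encodeGraph X ++ encodeGraph Y) →
        ∃ t ≤ p.eval (n + m), ∃ s', Runs P s t s' ∧
          ∃ (k l : ℕ) (X' : ColoredGraph (Fin k)) (Y' : ColoredGraph (Fin l)),
            s'.Holds (encodeColoredGraph X' ++ encodeColoredGraph Y') ∧
            (∀ (G : Type) [Group G] [Finite G], Nonempty (X ≃g K G) → X'.IsIso (reductionThree G)) ∧
            Y'.IsIso (reductionThree H) := by
  obtain ⟨R, r, hR⟩ := hK.exists_solves_reductionThree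
  -- The reduction works from array 0 on and spares the arrays from 20 on. So the second graph is
  -- parked at 22 and the first result at 25; at the end the results are placed at 0 and 3.
  obtain ⟨P₁, p₁, h₁⟩ := exists_move (b := 2) (a := 22) (by simp)
  obtain ⟨P₂, p₂, h₂⟩ := exists_move (b := 0) (a := 25) (by simp)
  obtain ⟨P₃, p₃, h₃⟩ := exists_move (b := 22) (a := 0) (by simp)
  obtain ⟨P₄, p₄, h₄⟩ := exists_move (b := 0) (a := 3) (by simp)
  obtain ⟨P₅, p₅, h₅⟩ := exists_move (b := 25) (a := 0) (by simp)
  refine ⟨P₁.seq (R.seq (P₂.seq (P₃.seq (R.seq (P₄.seq P₅))))),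
    p₁ + (r + (p₂ + (p₃ + (r + (p₄ + p₅))))), fun n m X Y G H _ _ _ _ hX hY s hs => ?_⟩
  have hcard : ∀ {k n : ℕ} {Z : ColoredGraph (Fin k)} {X : SimpleGraph (Fin n)} {G : Type}
      [Group G] [Finite G], Nonempty (X ≃g K G) → Z.IsIso (reductionThree G) → k ≤ n := by
    intro k n Z X G _ _ ⟨f⟩ ⟨e, _⟩
    rw [← e.natCard_eq, ← f.natCard_eq]
    exact natCard_twinClass_le
  have hl : ∀ {n : ℕ} (X : SimpleGraph (Fin n)), (encodeGraph X).length ≤ 3 := by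
    simp [encodeGraph]
  have hl' : ∀ {n : ℕ} (X : ColoredGraph (Fin n)), (encodeColoredGraph X).length ≤ 3 := by
    simp [encodeColoredGraph]
  have hn : ∀ {s : RamState} {b n : ℕ} {X : SimpleGraph (Fin n)}, s.HoldsAt b (encodeGraph X) →
      s.arr b 0 = n := fun {s b n X} h => by
    simpa [encodeGraph] using h 0 0 [n] rfl n rfl
  have hn' : ∀ {s : RamState} {b n : ℕ} {X : ColoredGraph (Fin n)},
      s.HoldsAt b (encodeColoredGraph X) → s.arr b 0 = n := fun {s b n X} h => by
    simpa [encodeColoredGraph] using h 0 0 [n] rfl n rfl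
  have hsX : s.HoldsAt 0 (encodeGraph X) := fun a k u hu x hx =>
    hs a k u (by
      rw [List.getElem?_append_left (List.getElem?_eq_some_iff.1 hu).1]
      exact hu) x hx
  have hsY : s.HoldsAt 2 (encodeGraph Y) := fun a k u hu x hx => hs (a + 2) k u (by
    rw [List.getElem?_append_right (by simp [encodeGraph])]
    simpa [encodeGraph] using hu) x hx
  obtain ⟨t₁, ht₁, s₁, r₁, f₁, a₁⟩ :=
    h₁ s m _ (hn hsY) (hl Y) length_le_of_mem_encodeGraph hsY
  obtain ⟨t₂, ht₂, s₂, r₂, f₂, _, a₂, k, X', rfl, hX'⟩ := hR n X ⟨G, _, ‹_›, hX⟩ s₁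
    (hsX.congr (hl X) fun d _ hd => f₁ d (by omega) : s₁.HoldsAt 0 _)
  obtain ⟨t₃, ht₃, s₃, r₃, f₃, a₃⟩ :=
    h₂ s₂ k _ (hn' (b := 0) a₂) (hl' X') length_le_of_mem_encodeColoredGraph a₂
  have b₃ := a₁.congr (s' := s₃) (hl Y) fun d _ hd =>
    (f₃ d (by omega)).trans (f₂ d (by omega))
  obtain ⟨t₄, ht₄, s₄, r₄, f₄, a₄⟩ :=
    h₃ s₃ m _ (hn b₃) (hl Y) length_le_of_mem_encodeGraph b₃
  obtain ⟨t₅, ht₅, s₅, r₅, f₅, _, a₅, l, Y', rfl, hY'⟩ := hR m Y ⟨H, _, ‹_›, hY⟩ s₄ a₄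
  obtain ⟨t₆, ht₆, s₆, r₆, f₆, a₆⟩ :=
    h₄ s₅ l _ (hn' (b := 0) a₅) (hl' Y') length_le_of_mem_encodeColoredGraph a₅
  have b₆ := a₃.congr (s' := s₆) (hl' X') fun d _ hd =>
    (f₆ d (by omega)).trans ((f₅ d (by omega)).trans (f₄ d (by omega)))
  obtain ⟨t₇, ht₇, s₇, r₇, f₇, a₇⟩ :=
    h₅ s₆ k _ (hn' b₆) (hl' X') length_le_of_mem_encodeColoredGraph b₆
  have hk := hcard hX (hX' G hX)
  have hl := hcard hY (hY' H hY)
  have e₁ := p₁.eval_mono_nat (show m ≤ n + m by omega)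
  have e₂ := r.eval_mono_nat (show n ≤ n + m by omega)
  have e₃ := p₂.eval_mono_nat (show k ≤ n + m by omega)
  have e₄ := p₃.eval_mono_nat (show m ≤ n + m by omega)
  have e₅ := r.eval_mono_nat (show m ≤ n + m by omega)
  have e₆ := p₄.eval_mono_nat (show l ≤ n + m by omega)
  have e₇ := p₅.eval_mono_nat (show k ≤ n + m by omega)
  refine ⟨_, ?_, s₇, .seq r₁ (.seq r₂ (.seq r₃ (.seq r₄ (.seq r₅ (.seq r₆ r₇))))), k, l, X', Y',
    RamState.holds_append_three.2 ⟨a₇, ?_⟩, hX', hY' H hY⟩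
  · simp only [eval_add]
    omega
  · exact a₆.congr (hl' Y') fun d _ hd => f₇ d (by omega)

theorem GraphKind.decidesNilpotentIso (hK : GraphKind K) : DecidesNilpotentIsoInPolyTime K := by
  obtain ⟨P, p, hP⟩ := hK.exists_solves_reductionThree_pair
  obtain ⟨Q, q, hQ⟩ := exists_solves_sum
  obtain ⟨R, r, hR⟩ := exists_solves_rootsRefine
  refine ⟨P.seq (Q.seq R), p + (q + r),
    fun n m X Y G H _ _ _ _ _ _ hX hY => ?_⟩
  obtain ⟨f⟩ := hX
  obtain ⟨e⟩ := hY
  rw [f.natCard_eq, e.natCard_eq]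
  obtain ⟨t, ht, s, hr, k, l, X', Y', hs, hX', hY'⟩ :=
    hP n m X Y G H ⟨f⟩ ⟨e⟩ _ (RamState.holds_init _)
  have hGX := hX' G ⟨f⟩
  have hcG : ∀ A : TwinClass G, A.card ≤ n := fun A => f.natCard_eq ▸ A.card_le_natCard
  have hcH : ∀ A : TwinClass H, A.card ≤ m := fun A => e.natCard_eq ▸ A.card_le_natCard
  have hkn : Nat.card (TwinClass G) ≤ n := f.natCard_eq ▸ natCard_twinClass_le
  have hlm : Nat.card (TwinClass H) ≤ m := e.natCard_eq ▸ natCard_twinClass_le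
  have hsol := (hQ k l X' Y' (n + m) ?_ ?_ ?_ ?_).seq (Q := R) (q := r) (ok' := fun output =>
    output = encodeAnswer (Nonempty (X ≃g Y))) ?_
  · obtain ⟨t', ht', s', hr', -, o, ho, hok⟩ := hsol s hs
    rw [eval_add] at ht'
    exact ⟨t + t', by rw [eval_add, eval_add]; omega, s', .seq hr hr', o, ho, hok⟩
  · obtain ⟨φ, -⟩ := hGX
    rw [← φ.natCard_eq]; omega
  · obtain ⟨φ, -⟩ := hY'
    rw [← φ.natCard_eq]; omega
  · obtain ⟨φ, hφ⟩ := hGX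
    intro a
    rw [← hφ, reductionThree_color]
    exact (hcG _).trans (by omega)
  · obtain ⟨φ, hφ⟩ := hY'
    intro a
    rw [← hφ, reductionThree_color]
    exact (hcH _).trans (by omega)
  · rintro _ ⟨j, Z, rfl, hZ⟩
    have hZ' : Z.IsIso ((reductionThree G).sum (reductionThree H)) := hZ.trans (hGX.sum hY')
    refine (hR j Z _ _ (n + m) hZ' ?_ ?_).mono ?_
    · rw [Nat.card_sum]
      exact (Nat.add_le_add hkn hlm).trans (Nat.le_self_pow (by simp) _)
    · rintro (A | A)
      · exact ((reductionThree_color A).trans_le (hcG A)).trans (by omega)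
      · exact ((reductionThree_color A).trans_le (hcH A)).trans (by omega)
    · rintro _ ⟨N, hN, rfl⟩
      congr 1
      refine propext ⟨fun h => ?_, fun ⟨φ⟩ => ?_⟩
      · obtain ⟨ψ⟩ := hK.iso G H (directedPowerGraph_isIso_of_rootsRefine
          (fun A => (reductionThree_color A).symm.trans_lt (hN (Sum.inl A))) h)
        exact ⟨f.trans (ψ.trans e.symm)⟩
      -- If the graphs are isomorphic, the first one also comes from `H`. The reduction computed
      -- from it is therefore a copy of both third reductions, so these are isomorphic to each
      -- other.
      · exact rootsRefine_of_isIso (hGX.symm.trans (hX' H ⟨φ.trans e⟩)) N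

theorem mainTheorem4 :
    -- The route from the power graph and from the enhanced power graph
    (FindsCCGSetInPolyTime (fun G _ => powerGraph G) ∧
      FindsCCGSetInPolyTime (fun G _ => enhancedPowerGraph G)) ∧
    (ConstructsReductionFourInPolyTime (fun G _ => powerGraph G) ∧
      ConstructsReductionFourInPolyTime (fun G _ => enhancedPowerGraph G)) ∧
    RestoresReductionThreeInPolyTime ∧
    RestoresDirectedPowerGraphInPolyTime ∧
    -- Reconstruction
    (ReconstructsDirectedPowerGraphInPolyTime (fun G _ => powerGraph G) ∧
      ReconstructsDirectedPowerGraphInPolyTime (fun G _ => enhancedPowerGraph G)) ∧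
    (ConstructsEnhancedFromDirectedInPolyTime ∧
      ConstructsEnhancedFromPowerInPolyTime) ∧
    -- Isomorphism for nilpotent groups
    (DecidesNilpotentIsoInPolyTime (fun G _ => powerGraph G) ∧
      DecidesNilpotentIsoInPolyTime (fun G _ => enhancedPowerGraph G)) := by
  exact ⟨⟨graphKind_powerGraph.findsCCGSet, graphKind_enhancedPowerGraph.findsCCGSet⟩,
    ⟨graphKind_powerGraph.constructsReductionFour,
      graphKind_enhancedPowerGraph.constructsReductionFour⟩,
    restoresReductionThree, restoresDirectedPowerGraph,
    ⟨graphKind_powerGraph.reconstructsDirectedPowerGraph,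
      graphKind_enhancedPowerGraph.reconstructsDirectedPowerGraph⟩,
    ⟨constructsEnhancedFromDirected, constructsEnhancedFromPower⟩,
    ⟨graphKind_powerGraph.decidesNilpotentIso, graphKind_enhancedPowerGraph.decidesNilpotentIso⟩⟩
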